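/- Let $k$ be an algebraically closed field of characteristic $2$, let $n\ge 0$ and $0\le 2i\le n$, and let $e\in\mathfrak g=\mathfrak{gl}(n,k)$ be a nilpotent matrix of partition type $2^i.1^{n-2i}$, that is, the Jordan normal form of $e$ has $i$ nilpotent blocks of size $2$ and $n-2i$ blocks of size $1$. Write $\mathfrak z_{\mathfrak g}(e)=\{x\in\mathfrak g : xe=ex\}$ and $\mathcal N_1=\{x\in\mathfrak g : x^2=0\}$, and regard $\mathfrak z_{\mathfrak g}(e)\cap\mathcal N_1$ as a subset of the affine space of $n\times n$ matrices with its Zariski topology. (a) If $n$ is even, then $\mathfrak z_{\mathfrak g}(e)\cap\mathcal N_1$ has exactly $[i/2]+1$ irreducible components, each of dimension $(n^2+(n-2i)^2)/4=\dim\mathfrak z_{\mathfrak g}(e)/2$. (b) If $n$ is odd, then $\mathfrak z_{\mathfrak g}(e)\cap\mathcal N_1$ has exactly $i+1$ irreducible components, each of dimension $(n^2+(n-2i)^2-2)/4=(\dim\mathfrak z_{\mathfrak g}(e)-1)/2$. Here $[i/2]$ is the integer part of $i/2$. In particular $\mathfrak z_{\mathfrak g}(e)\cap\mathcal N_1$ is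 equidimensional. -/

import Mathlib

/-- The Zariski topology on the affine space `σ → k`: the closed sets are exactly the zero loci
of ideals of polynomials. -/
@[reducible]
def zariskiTopology (k σ : Type*) [Field k] : TopologicalSpace (σ → k) :=
  TopologicalSpace.ofClosed
    (Set.range fun I : Ideal (MvPolynomial σ k) => MvPolynomial.zeroLocus k I)
    ⟨⊤, MvPolynomial.zeroLocus_top⟩
    (by
      intro A hA
      refine ⟨⨆ I ∈ {I : Ideal (MvPolynomial σ k) | MvPolynomial.zeroLocus k I ∈ A}, I, ?_⟩
      refine Set.Subset.antisymm ?_ ?_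
      · intro x hx Z hZ
        obtain ⟨I, rfl⟩ := hA hZ
        exact MvPolynomial.zeroLocus_anti_mono (le_iSup₂_of_le I hZ le_rfl) hx
      · refine MvPolynomial.le_zeroLocus_iff_le_vanishingIdeal.2 (iSup₂_le fun I hI => ?_)
        exact MvPolynomial.le_zeroLocus_iff_le_vanishingIdeal.1 (Set.sInter_subset_of_mem hI))
    (by
      rintro _ ⟨I, rfl⟩ _ ⟨J, rfl⟩
      refine ⟨I * J, Set.Subset.antisymm ?_ ?_⟩
      · intro x hx
        by_contra hcon
        simp only [Set.mem_union, MvPolynomial.mem_zeroLocus_iff, not_or, not_forall] at hcon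
        obtain ⟨⟨p, hp, hpx⟩, q, hq, hqx⟩ := hcon
        have h := hx (p * q) (Ideal.mul_mem_mul hp hq)
        rw [map_mul] at h
        exact (mul_ne_zero hpx hqx) h
      · rintro x (hx | hx)
        · exact MvPolynomial.zeroLocus_anti_mono Ideal.mul_le_left hx
        · exact MvPolynomial.zeroLocus_anti_mono Ideal.mul_le_right hx)

/-- The Zariski topology on the affine space of `n × n` matrices, the coordinates being the
matrix entries. -/
@[reducible]
def matrixZariskiTopology (k : Type*) [Field k] (n : ℕ) :
    TopologicalSpace (Matrix (Fin n) (Fin n) k) :=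
  TopologicalSpace.induced (fun x (p : Fin n × Fin n) => x p.1 p.2)
    (zariskiTopology k (Fin n × Fin n))

attribute [local instance] matrixZariskiTopology

/-- The nilpotent Jordan block of size `m`: ones on the superdiagonal, zeros elsewhere. -/
def nilpotentJordanBlock (k : Type*) [Field k] (m : ℕ) : Matrix (Fin m) (Fin m) k :=
  Matrix.of fun a b => if (a : ℕ) + 1 = (b : ℕ) then 1 else 0

/-- `e` is nilpotent with partition type `parts`: it is conjugate to a block diagonal matrix whose
diagonal blocks are nilpotent Jordan blocks, the multiset of block sizes being `parts`. -/
def HasPartitionType {k : Type*} [Field k] {n : ℕ} (e : Matrix (Fin n) (Fin n) k)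
    (parts : Multiset ℕ) : Prop :=
  ∃ (r : ℕ) (s : Fin r → ℕ) (f : (Σ a : Fin r, Fin (s a)) ≃ Fin n),
    Finset.univ.val.map s = parts ∧
      IsConj e (Matrix.reindex f f (Matrix.blockDiagonal' fun a => nilpotentJordanBlock k (s a)))

/-- The set `𝔷_𝔤(e) ∩ 𝒩₁` for `𝔤 = 𝔤𝔩(n, k)` in characteristic `2`: the matrices commuting with
`e` whose square is zero. -/
def centralizerSquareZero {k : Type*} [Field k] {n : ℕ} (e : Matrix (Fin n) (Fin n) k) :
    Set (Matrix (Fin n) (Fin n) k) :=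
  {x | x ∈ Subalgebra.centralizer k {e} ∧ x ^ 2 = 0}

/-!
# Square-zero elements of the centralizer of a square-zero matrix in characteristic two

After a change of basis `e` acts on `U ⊕ W ⊕ U`, mapping the first copy of `U` identically to the
last one. Its centralizer consists of the block matrices `[[A, 0, 0], [C, D, 0], [B, F, A]]`, encoded
as `Tup k U W`, and in characteristic two such a matrix has square zero if and only if
`A² = 0`, `D² = 0`, `C A + D C = 0`, `A F + F D = 0` and `A B + B A + F C = 0`. So `A` and `D` are
differentials, and `C`, `F` are chain maps whose composition `F C` is null-homotopic by means of `B`.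
Up to conjugation `A` and `D` are the normal forms `sqNormal k r a` and `sqNormal k s b`, where `a`
and `b` are the dimensions of their homology.

*Only the least possible `b` matters.* If `b ≥ 2`, then unipotent conjugations reduce `C`, `F`
and `B` to their blocks `c`, `f`, `β` on homology, with `f c = 0`. There is a square-zero tuple
commuting with the given one and with nonzero `D`-component on homology
(`exists_commuting_square_zero`); if `c = 0` and `f ≠ 0` it is made from the Krylov spaces
of `β` and `f`. Adding its multiples yields a line in the variety along which the rank of `D` is
larger (`exists_line_of_normal`). By induction the tuples with `b ≤ 1`, that is `b = 0` or `b = 1`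
according to the parity of `dim W`, are dense (`sqZero_subset_of_isClosed`).

*Strata.* If `b = 0`, the maps `C` and `F` are zero on homology. If `b = 1`, they induce a row and
a column whose product vanishes, so one of them is zero. The tuples with `F` zero on homology and
given `r`, `s`, `b` form `stratum`; those with `C` zero on homology are their transposes. A
stratum has a rational chart: a slice for the conjugation action, times the affine space of the free
entries of `B`, `C`, `F`. The chart has a rational inverse (`chartRead_chart`), so the closure of
the stratum is irreducible, and its Krull dimension is the number of parameters by
`topologicalKrullDim_closure_image`; this number turns out not to depend on `r`.

*Counting.* The closures for different `r` are distinguished by the minors of `A`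
(`eq_of_closure_stratum_eq`). For `b = 1` a closure differs from its transpose, unless `a = 0`, by
`homology_F_eq_zero_of_mem_closure`. As all dimensions agree, none of these sets contains another
one, so they are the irreducible components (`ncard_irreducibleComponents`): with `i = dim U` there
are `i / 2 + 1` of them for `b = 0`, and `(i / 2 + 1) + (i + 1) / 2 = i + 1` for `b = 1`.
-/

set_option linter.unusedSectionVars false


/-! ### Polynomial functions on a vector space and the Zariski topology -/

/-- The algebra of polynomial functions on the vector space `E`: the functions generated by the
linear forms. -/
def polyFun (k E : Type*) [Field k] [AddCommGroup E] [Module k E] : Subalgebra k (E → k) :=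
  Algebra.adjoin k (Set.range fun l : Module.Dual k E => (l : E → k))

/-- The topology on the vector space `E` is the Zariski topology: the closed sets are the
zero sets of families of polynomial functions. -/
class IsZariski (k E : Type*) [Field k] [AddCommGroup E] [Module k E] [TopologicalSpace E] :
    Prop where
  isClosed_iff : ∀ C : Set E, IsClosed C ↔
    ∃ P : Set (E → k), P ⊆ polyFun k E ∧ C = {x | ∀ f ∈ P, f x = 0}

section PolyFun

variable {k E F : Type*} [Field k] [AddCommGroup E] [Module k E] [AddCommGroup F] [Module k F]

theorem linearForm_mem_polyFun (l : Module.Dual k E) : (fun x => l x) ∈ polyFun k E :=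
  Algebra.subset_adjoin ⟨l, rfl⟩

theorem const_mem_polyFun (c : k) : (fun _ : E => c) ∈ polyFun k E :=
  (polyFun k E).algebraMap_mem c

/-- To compose the polynomial functions on `E` with a map `φ` it suffices to do so with the linear
forms. -/
theorem comp_mem_of_linearForm {X : Type*} (S : Subalgebra k (X → k)) (φ : X → E)
    (h : ∀ l : Module.Dual k E, (fun t => l (φ t)) ∈ S) {p : E → k} (hp : p ∈ polyFun k E) :
    (fun t => p (φ t)) ∈ S := by
  induction hp using Algebra.adjoin_induction with
  | mem x hx => obtain ⟨l, rfl⟩ := hx; exact h l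
  | algebraMap r => exact S.algebraMap_mem r
  | add x y _ _ hx hy => exact S.add_mem hx hy
  | mul x y _ _ hx hy => exact S.mul_mem hx hy

theorem comp_linearMap_mem_polyFun (φ : F →ₗ[k] E) {p : E → k} (hp : p ∈ polyFun k E) :
    (fun t => p (φ t)) ∈ polyFun k F :=
  comp_mem_of_linearForm _ _ (fun l => linearForm_mem_polyFun (l ∘ₗ φ)) hp

/-- Polynomials in the coordinates of a basis, as functions on the space. -/
noncomputable def basisEval {ι : Type*} (b : Module.Basis ι k F) :
    MvPolynomial ι k →ₐ[k] (F → k) :=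
  MvPolynomial.aeval fun i => (b.coord i : F → k)

theorem basisEval_apply {ι : Type*} (b : Module.Basis ι k F) (p : MvPolynomial ι k) (t : F) :
    basisEval b p t = MvPolynomial.eval (fun i => b.repr t i) p := by
  have : (Pi.evalAlgHom k (fun _ : F => k) t).comp (basisEval b) =
      MvPolynomial.aeval fun i => b.repr t i := by
    ext i
    simp [basisEval]
  simpa [MvPolynomial.aeval_eq_eval] using DFunLike.congr_fun this p

theorem range_basisEval {ι : Type*} [Finite ι] (b : Module.Basis ι k F) :
    (basisEval b).range = polyFun k F := by
  cases nonempty_fintype ι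
  rw [basisEval, ← Algebra.adjoin_range_eq_range_aeval]
  refine le_antisymm (Algebra.adjoin_mono ?_) (Algebra.adjoin_le ?_)
  · rintro _ ⟨i, rfl⟩
    exact ⟨b.coord i, rfl⟩
  · rintro _ ⟨l, rfl⟩
    have : (l : F → k) = ∑ i, l (b i) • (b.coord i : F → k) := by
      funext t
      have := congrArg l (b.sum_repr t)
      rw [map_sum] at this
      rw [← this, Finset.sum_apply]
      simp [mul_comm]
    change (l : F → k) ∈ _
    rw [this]
    refine Subalgebra.sum_mem _ fun i _ => Subalgebra.smul_mem _ ?_ _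
    exact Algebra.subset_adjoin (Set.mem_range_self i)

/-- Over an infinite field, polynomial functions are determined by their polynomials, so they
form a domain. -/
theorem polyFun_eq_zero_or_eq_zero [Infinite k] [FiniteDimensional k F] {p q : F → k}
    (hp : p ∈ polyFun k F) (hq : q ∈ polyFun k F) (h : ∀ t, p t * q t = 0) :
    (∀ t, p t = 0) ∨ ∀ t, q t = 0 := by
  let b := Module.finBasis k F
  rw [← range_basisEval b] at hp hq
  obtain ⟨P, rfl⟩ := hp
  obtain ⟨Q, rfl⟩ := hq
  have : P * Q = 0 := by
    refine MvPolynomial.funext fun x => ?_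
    have := h (b.equivFun.symm x)
    rw [AlgHom.toRingHom_eq_coe, RingHom.coe_coe, ← Pi.mul_apply, ← map_mul,
      basisEval_apply] at this
    have hx : (fun i => b.repr (b.equivFun.symm x) i) = x := b.equivFun.apply_symm_apply x
    rwa [hx, ← map_zero (MvPolynomial.eval x)] at this
  rcases mul_eq_zero.1 this with rfl | rfl
  · exact .inl fun t => by simp
  · exact .inr fun t => by simp

/-- Functions on `F` that are regular where `g ≠ 0`: a power of `g` clears the denominators.
Their values on the zero set of `g` are irrelevant. -/
def regularAway (g : polyFun k F) : Subalgebra k (F → k) where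
  carrier := {f | ∃ N : ℕ, ∃ p ∈ polyFun k F, ∀ t, g.1 t ≠ 0 → f t * g.1 t ^ N = p t}
  mul_mem' := by
    rintro a b ⟨N, p, hp, h⟩ ⟨M, q, hq, h'⟩
    refine ⟨N + M, p * q, mul_mem hp hq, fun t ht => ?_⟩
    rw [Pi.mul_apply, Pi.mul_apply, ← h t ht, ← h' t ht]
    ring
  add_mem' := by
    rintro a b ⟨N, p, hp, h⟩ ⟨M, q, hq, h'⟩
    refine ⟨N + M, p * g.1 ^ M + q * g.1 ^ N, add_mem (mul_mem hp (pow_mem g.2 _))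
      (mul_mem hq (pow_mem g.2 _)), fun t ht => ?_⟩
    simp only [Pi.add_apply, Pi.mul_apply, Pi.pow_apply, ← h t ht, ← h' t ht]
    ring
  algebraMap_mem' r := ⟨0, algebraMap _ _ r, (polyFun k F).algebraMap_mem r, by simp⟩

theorem polyFun_le_regularAway (g : polyFun k F) : polyFun k F ≤ regularAway g :=
  fun p hp => ⟨0, p, hp, by simp⟩

theorem mem_regularAway_of_mul_eq (g : polyFun k F) {f p : F → k} (hp : p ∈ polyFun k F)
    (h : ∀ t, g.1 t ≠ 0 → f t * g.1 t = p t) : f ∈ regularAway g :=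
  ⟨1, p, hp, by simpa using h⟩

theorem regularAway_eq_zero_or_eq_zero [Infinite k] [FiniteDimensional k F] {g : polyFun k F}
    {f f' : F → k} (hf : f ∈ regularAway g) (hf' : f' ∈ regularAway g)
    (h : ∀ t, g.1 t ≠ 0 → f t * f' t = 0) :
    (∀ t, g.1 t ≠ 0 → f t = 0) ∨ ∀ t, g.1 t ≠ 0 → f' t = 0 := by
  obtain ⟨N, p, hp, hN⟩ := hf
  obtain ⟨M, q, hq, hM⟩ := hf'
  have key : ∀ {f p : F → k} {N : ℕ}, (∀ t, g.1 t ≠ 0 → f t * g.1 t ^ N = p t) →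
      (∀ t, p t * g.1 t = 0) → ∀ t, g.1 t ≠ 0 → f t = 0 := fun hN h t ht => by
    have := h t
    rw [← hN t ht] at this
    simpa [ht] using this
  have : ∀ t, (p * g.1) t * (q * g.1) t = 0 := fun t => by
    by_cases ht : g.1 t = 0
    · simp [ht]
    · simp only [Pi.mul_apply, ← hN t ht, ← hM t ht]
      linear_combination (g.1 t ^ (N + M + 2)) * h t ht
  exact (polyFun_eq_zero_or_eq_zero (mul_mem hp g.2) (mul_mem hq g.2) this).imp (key hN) (key hM)

/-- The map `φ` is regular where `g ≠ 0`. -/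
def IsRegularAway (g : polyFun k F) (φ : F → E) : Prop :=
  ∀ l : Module.Dual k E, (fun t => l (φ t)) ∈ regularAway g

theorem IsRegularAway.comp {g : polyFun k F} {φ : F → E} (hφ : IsRegularAway g φ) {p : E → k}
    (hp : p ∈ polyFun k E) : (fun t => p (φ t)) ∈ regularAway g :=
  comp_mem_of_linearForm _ _ hφ hp

section Closed

variable [TopologicalSpace E] [IsZariski k E]

theorem isClosed_zeroSet {p : E → k} (hp : p ∈ polyFun k E) : IsClosed {x | p x = 0} :=
  (IsZariski.isClosed_iff (k := k) _).2 ⟨{p}, by simpa using hp, by simp⟩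

theorem IsClosed.mem_of_polyFun {C : Set E} (hC : IsClosed C) {x : E}
    (h : ∀ p ∈ polyFun k E, (∀ y ∈ C, p y = 0) → p x = 0) : x ∈ C := by
  obtain ⟨P, hP, rfl⟩ := (IsZariski.isClosed_iff (k := k) _).1 hC
  exact fun p hp => h p (hP hp) fun y hy => hy p hp

theorem polyFun_eq_zero_of_mem_closure {S : Set E} {p : E → k} (hp : p ∈ polyFun k E)
    (h : ∀ y ∈ S, p y = 0) {x : E} (hx : x ∈ closure S) : p x = 0 :=
  closure_minimal (t := {x | p x = 0}) h (isClosed_zeroSet hp) hx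

/-- Vanishing of a regular function extends to the closure, within its domain. -/
theorem regularAway_eq_zero_of_mem_closure {g : polyFun k E} {S : Set E} {f : E → k}
    (hf : f ∈ regularAway g) (h : ∀ y ∈ S, g.1 y ≠ 0 → f y = 0) {x : E} (hx : x ∈ closure S)
    (hgx : g.1 x ≠ 0) : f x = 0 := by
  obtain ⟨N, p, hp, hN⟩ := hf
  have := polyFun_eq_zero_of_mem_closure (p := p * g.1) (mul_mem hp g.2) (fun y hy => by
    by_cases hy' : g.1 y = 0
    · simp [hy']
    · simp [← hN y hy', h y hy hy']) hx
  simpa [← hN x hgx, hgx] using this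

theorem continuous_linearMap [TopologicalSpace F] [IsZariski k F] (φ : F →ₗ[k] E) :
    Continuous φ := by
  refine continuous_iff_isClosed.2 fun C hC => ?_
  obtain ⟨P, hP, rfl⟩ := (IsZariski.isClosed_iff (k := k) _).1 hC
  refine (IsZariski.isClosed_iff (k := k) _).2 ⟨(fun p t => p (φ t)) '' P, ?_, by ext; simp⟩
  rintro _ ⟨p, hp, rfl⟩
  exact comp_linearMap_mem_polyFun φ (hP hp)

/-- A regular map sends its whole domain into a closed set as soon as it sends a nonempty
open part of it there. -/
theorem IsRegularAway.mem_of_isClosed [Infinite k] [FiniteDimensional k F] {g : polyFun k F}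
    {φ : F → E} (hφ : IsRegularAway g φ) {C : Set E} (hC : IsClosed C) {h : F → k}
    (hh : h ∈ regularAway g) {t₀ : F} (ht₀ : g.1 t₀ ≠ 0) (hht₀ : h t₀ ≠ 0)
    (H : ∀ t, g.1 t ≠ 0 → h t ≠ 0 → φ t ∈ C) {t : F} (ht : g.1 t ≠ 0) : φ t ∈ C := by
  refine hC.mem_of_polyFun (k := k) fun p hp hpC => ?_
  refine (regularAway_eq_zero_or_eq_zero (hφ.comp hp) hh fun s hs => ?_).resolve_right
    (fun h' => hht₀ (h' t₀ ht₀)) t ht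
  by_cases hs' : h s = 0
  · simp [hs']
  · simp [hpC _ (H s hs hs')]

/-- The closure of the image of a regular map is irreducible; the parameters are restricted to an
affine subspace `t₀ + V` in order to obtain chains of irreducible sets later. -/
theorem IsRegularAway.isIrreducible_closure [Infinite k] [FiniteDimensional k F] {g : polyFun k F}
    {φ : F → E} (hφ : IsRegularAway g φ) {S : Set F} (V : Submodule k F) (t₀ : F)
    (hS : S = {t | t - t₀ ∈ V ∧ g.1 t ≠ 0}) (ht₀ : g.1 t₀ ≠ 0) :
    IsIrreducible (closure (φ '' S)) := by
  subst hS
  rw [isIrreducible_iff_closure]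
  refine ⟨⟨φ t₀, t₀, by simp [ht₀], rfl⟩, ?_⟩
  rw [isPreirreducible_iff_isClosed_union_isClosed]
  intro Z₁ Z₂ hZ₁ hZ₂ hsub
  by_contra! hcon
  simp only [Set.not_subset] at hcon
  obtain ⟨⟨x₁, hx₁, hx₁'⟩, x₂, hx₂, hx₂'⟩ := hcon
  obtain ⟨P₁, hP₁, rfl⟩ := (IsZariski.isClosed_iff (k := k) _).1 hZ₁
  obtain ⟨P₂, hP₂, rfl⟩ := (IsZariski.isClosed_iff (k := k) _).1 hZ₂
  simp only [Set.mem_ofPred_eq, not_forall] at hx₁' hx₂'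
  obtain ⟨p, hp, hpx⟩ := hx₁'
  obtain ⟨q, hq, hqx⟩ := hx₂'
  obtain ⟨s₁, ⟨hs₁, hg₁⟩, rfl⟩ := hx₁
  obtain ⟨s₂, ⟨hs₂, hg₂⟩, rfl⟩ := hx₂
  obtain ⟨N, a, ha, hN⟩ := hφ.comp (hP₁ hp)
  obtain ⟨M, b, hb, hM⟩ := hφ.comp (hP₂ hq)
  -- Restrict the numerators to the affine subspace `t₀ + V`.
  have hres : ∀ f ∈ polyFun k F, (fun v : V => f (t₀ + v)) ∈ polyFun k V := fun f hf =>
    comp_mem_of_linearForm (polyFun k V) (fun v : V => t₀ + (v : F)) (fun l => by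
      simp only [map_add]
      exact add_mem (const_mem_polyFun _) (linearForm_mem_polyFun (l ∘ₗ V.subtype))) hf
  have := polyFun_eq_zero_or_eq_zero (hres (a * g.1) (mul_mem ha g.2))
    (hres (b * g.1) (mul_mem hb g.2)) fun v => by
      by_cases hv : g.1 (t₀ + v) = 0
      · simp [hv]
      · simp only [Pi.mul_apply, ← hN _ hv, ← hM _ hv]
        rcases hsub ⟨t₀ + v, ⟨by simp, hv⟩, rfl⟩ with h | h
        · simp [h p hp]
        · simp [h q hq]
  rcases this with h | h
  · have := h ⟨s₁ - t₀, hs₁⟩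
    simp [← hN _ hg₁, hg₁, hpx] at this
  · have := h ⟨s₂ - t₀, hs₂⟩
    simp [← hM _ hg₂, hg₂, hqx] at this

end Closed

end PolyFun

/-! ### The dimension of a rationally parametrized closed set -/

/-- A nontrivial relation strictly decreases the transcendence degree: if all the elements of a
transcendence basis of the quotient `B` are lifted to `A`, an element of the kernel would be
algebraic over the lifts, hence divide a nonzero polynomial in them. -/
theorem trdeg_lt_of_surjective_of_not_injective {k A B : Type u} [Field k] [CommRing A]
    [CommRing B] [IsDomain A] [IsDomain B] [Algebra k A] [Algebra k B] (f : A →ₐ[k] B)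
    (hf : Function.Surjective f) {a : A} (ha : a ≠ 0) (hfa : f a = 0)
    (hA : Algebra.trdeg k A < Cardinal.aleph0) : Algebra.trdeg k B < Algebra.trdeg k A := by
  obtain ⟨ι, y, hy⟩ := exists_isTranscendenceBasis' k B
  choose z hz using fun i => hf (y i)
  have hz' : AlgebraicIndependent k z := .of_comp f (by
    have : f ∘ z = y := funext hz
    rw [this]; exact hy.1)
  by_contra! hle
  rw [← hy.cardinalMk_eq_trdeg] at hle
  have hzb := hz'.isTranscendenceBasis_of_trdeg_le hA hle
  obtain ⟨r, hr, q, hq⟩ :=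
    (hzb.isAlgebraic.1 a).exists_nonzero_dvd (mem_nonZeroDivisors_of_ne_zero ha)
  obtain ⟨r, hr'⟩ := r
  rw [Algebra.adjoin_range_eq_range_aeval] at hr'
  obtain ⟨P, rfl⟩ := hr'
  refine hr (Subtype.ext ?_)
  have h0 : MvPolynomial.aeval y P = 0 := by
    have := congrArg f hq
    rw [map_mul, hfa, zero_mul] at this
    have h1 : f (MvPolynomial.aeval z P) = 0 := this
    have h2 : f.comp (MvPolynomial.aeval z) = MvPolynomial.aeval y := by
      ext i
      simp [hz]
    rw [← h2]
    exact h1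
  have : P = 0 := by
    have := (algebraicIndependent_iff.1 hy.1) P h0
    exact this
  simp [this]

/-- A quotient of two elements of a subring is algebraic over it. -/
theorem isAlgebraic_of_mul_mem {k A : Type*} [Field k] [CommRing A] [IsDomain A] [Algebra k A]
    {S : Subalgebra k A} {g p x : A} (hg : g ∈ S) (hp : p ∈ S) (hg0 : g ≠ 0) (h : g * x = p) :
    IsAlgebraic S x := by
  refine ⟨Polynomial.C ⟨g, hg⟩ * Polynomial.X - Polynomial.C ⟨p, hp⟩, fun h0 => ?_, ?_⟩
  · have := congrArg (fun q => Polynomial.coeff q 1) h0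
    simp only [Polynomial.coeff_sub, Polynomial.coeff_C_mul, Polynomial.coeff_X_one,
      Polynomial.coeff_C_succ, mul_one, sub_zero, Polynomial.coeff_zero] at this
    exact hg0 (congrArg Subtype.val this)
  · rw [map_sub, map_mul, Polynomial.aeval_C, Polynomial.aeval_X, Polynomial.aeval_C, sub_eq_zero]
    exact h

theorem IsIrreducible.preimage_of_isInducing {X Y : Type*} [TopologicalSpace X]
    [TopologicalSpace Y] {f : Y → X} (hf : Topology.IsInducing f) {L : Set X}
    (hL : IsIrreducible L) (hLf : L ⊆ Set.range f) : IsIrreducible (f ⁻¹' L) := by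
  refine ⟨?_, ?_⟩
  · obtain ⟨x, hx⟩ := hL.nonempty
    obtain ⟨y, rfl⟩ := hLf hx
    exact ⟨y, hx⟩
  · rintro u v hu hv ⟨a, ha, hau⟩ ⟨b, hb, hbv⟩
    obtain ⟨u', hu', rfl⟩ := hf.isOpen_iff.1 hu
    obtain ⟨v', hv', rfl⟩ := hf.isOpen_iff.1 hv
    obtain ⟨x, hx, hx'⟩ := hL.isPreirreducible u' v' hu' hv' ⟨_, ha, hau⟩ ⟨_, hb, hbv⟩
    obtain ⟨y, rfl⟩ := hLf hx
    exact ⟨y, hx, hx'⟩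

section Dimension

variable {k E F : Type u} [Field k] [AddCommGroup E] [Module k E] [AddCommGroup F] [Module k F]

/-- Restriction of functions to a subset, as an algebra homomorphism. -/
def restrictHom (k : Type*) [Field k] {E : Type*} (Z : Set E) : (E → k) →ₐ[k] (Z → k) where
  toFun f z := f z
  map_one' := rfl
  map_mul' _ _ := rfl
  map_zero' := rfl
  map_add' _ _ := rfl
  commutes' _ := rfl

/-- The coordinate ring of a subset `Z` of `E`: the polynomial functions, restricted to `Z`. -/
def coordRing (k : Type*) {E : Type*} [Field k] [AddCommGroup E] [Module k E] (Z : Set E) :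
    Subalgebra k (Z → k) :=
  (polyFun k E).map (restrictHom k Z)

/-- The ring of regular functions on the set where `g` does not vanish. -/
def regularRing (g : polyFun k F) : Subalgebra k ({t | g.1 t ≠ 0} → k) :=
  (regularAway g).map (restrictHom k _)

theorem isDomain_coordRing [TopologicalSpace E] [IsZariski k E] {Z : Set E}
    (hZ : IsIrreducible Z) : IsDomain (coordRing k Z) := by
  obtain ⟨z, hz⟩ := hZ.nonempty
  have : Nontrivial (coordRing k Z) :=
    ⟨0, 1, fun h => zero_ne_one (α := k) (congrFun (congrArg Subtype.val h) ⟨z, hz⟩)⟩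
  have : NoZeroDivisors (coordRing k Z) := by
    refine ⟨?_⟩
    rintro ⟨_, p, hp, rfl⟩ ⟨_, q, hq, rfl⟩ h
    have h' : ∀ x ∈ Z, p x * q x = 0 := fun x hx =>
      congrFun (congrArg Subtype.val h) ⟨x, hx⟩
    have := (isPreirreducible_iff_isClosed_union_isClosed.1 hZ.isPreirreducible)
      {x | p x = 0} {x | q x = 0} (isClosed_zeroSet hp) (isClosed_zeroSet hq)
      (fun x hx => mul_eq_zero.1 (h' x hx))
    refine this.imp (fun h => ?_) (fun h => ?_) <;>
    · ext ⟨x, hx⟩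
      exact h hx
  exact NoZeroDivisors.to_isDomain _

theorem finiteType_coordRing [FiniteDimensional k E] (Z : Set E) :
    Algebra.FiniteType k (coordRing k Z) := by
  rw [← Subalgebra.fg_iff_finiteType]
  refine Subalgebra.FG.map _ ?_
  rw [← range_basisEval (Module.finBasis k E), ← Algebra.map_top]
  exact Subalgebra.FG.map _ Algebra.FiniteType.out

theorem trdeg_coordRing_lt [TopologicalSpace E] [IsZariski k E] [FiniteDimensional k E]
    {Z Z' : Set E} (hZ : IsIrreducible Z) (hZ' : IsIrreducible Z') (hcl : IsClosed Z)
    (hlt : Z ⊂ Z') :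
    Algebra.trdeg k (coordRing k Z) < Algebra.trdeg k (coordRing k Z') := by
  have := isDomain_coordRing (k := k) hZ
  have := isDomain_coordRing (k := k) hZ'
  have := finiteType_coordRing (k := k) Z'
  let res : (Z' → k) →ₐ[k] (Z → k) :=
    { toFun := fun f z => f ⟨z, hlt.1 z.2⟩
      map_one' := rfl
      map_mul' := fun _ _ => rfl
      map_zero' := rfl
      map_add' := fun _ _ => rfl
      commutes' := fun _ => rfl }
  have hres : ∀ f : coordRing k Z', res f.1 ∈ coordRing k Z := by
    rintro ⟨_, p, hp, rfl⟩
    exact ⟨p, hp, rfl⟩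
  let f : coordRing k Z' →ₐ[k] coordRing k Z :=
    (res.comp (coordRing k Z').val).codRestrict _ hres
  obtain ⟨x, hx, hxZ⟩ := Set.exists_of_ssubset hlt
  have : ∃ p ∈ polyFun k E, (∀ y ∈ Z, p y = 0) ∧ p x ≠ 0 := by
    by_contra! h
    exact hxZ (hcl.mem_of_polyFun (k := k) h)
  obtain ⟨p, hp, hpZ, hpx⟩ := this
  refine trdeg_lt_of_surjective_of_not_injective f ?_
    (a := ⟨restrictHom k Z' p, p, hp, rfl⟩) ?_ ?_ (trdeg_lt_aleph0_of_finiteType ..)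
  · rintro ⟨_, p, hp, rfl⟩
    exact ⟨⟨_, p, hp, rfl⟩, rfl⟩
  · exact fun h => hpx (congrFun (congrArg Subtype.val h) ⟨x, hx⟩)
  · ext ⟨y, hy⟩
    exact hpZ y hy

/-- The linear coordinates of `F` generate the field of fractions of the ring of regular
functions. -/
theorem trdeg_regularRing_le [Infinite k] [FiniteDimensional k F] {g : polyFun k F}
    {t₀ : F} (ht₀ : g.1 t₀ ≠ 0) : Algebra.trdeg k (regularRing g) ≤ Module.finrank k F := by
  have : Nontrivial (regularRing g) :=
    ⟨0, 1, fun h => zero_ne_one (α := k) (congrFun (congrArg Subtype.val h) ⟨t₀, ht₀⟩)⟩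
  have : NoZeroDivisors (regularRing g) := by
    refine ⟨?_⟩
    rintro ⟨_, p, hp, rfl⟩ ⟨_, q, hq, rfl⟩ h
    refine (regularAway_eq_zero_or_eq_zero hp hq fun t ht =>
      congrFun (congrArg Subtype.val h) ⟨t, ht⟩).imp (fun h => ?_) (fun h => ?_) <;>
    · ext ⟨x, hx⟩
      exact h x hx
  have : IsDomain (regularRing g) := NoZeroDivisors.to_isDomain _
  let b := Module.finBasis k F
  let R : polyFun k F →ₐ[k] regularRing g :=
    ((restrictHom k _).comp (polyFun k F).val).codRestrict _
      fun p => ⟨p, polyFun_le_regularAway g p.2, rfl⟩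
  let s : Set (regularRing g) := Set.range fun i => R ⟨_, linearForm_mem_polyFun (b.coord i)⟩
  have hRs : ∀ p, R p ∈ Algebra.adjoin k s := by
    rintro ⟨p, hp⟩
    have hp' := hp
    rw [← range_basisEval b] at hp'
    obtain ⟨P, rfl⟩ := hp'
    have : R ⟨_, hp⟩ = MvPolynomial.aeval
        (fun i => R ⟨_, linearForm_mem_polyFun (b.coord i)⟩) P := by
      have h2 : (restrictHom k _).comp (basisEval b) = (regularRing g).val.comp
          (MvPolynomial.aeval fun i => R ⟨_, linearForm_mem_polyFun (b.coord i)⟩) := by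
        ext i
        simp [basisEval, R]
        rfl
      exact Subtype.ext (DFunLike.congr_fun h2 P)
    rw [this, Algebra.adjoin_range_eq_range_aeval]
    exact ⟨P, rfl⟩
  have : Algebra.IsAlgebraic (Algebra.adjoin k s) (regularRing g) := by
    refine ⟨?_⟩
    rintro ⟨_, f, ⟨N, p, hp, h⟩, rfl⟩
    have hne : R g ≠ 0 := fun h0 => ht₀ (congrFun (congrArg Subtype.val h0) ⟨t₀, ht₀⟩)
    refine isAlgebraic_of_mul_mem (pow_mem (hRs g) N) (hRs ⟨p, hp⟩) (pow_ne_zero N hne) ?_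
    ext ⟨t, ht⟩
    have := h t ht
    rw [mul_comm] at this
    exact this
  refine (Algebra.IsAlgebraic.trdeg_le_cardinalMk k s).trans ?_
  have := Cardinal.mk_range_le_lift
    (f := fun i => R ⟨_, linearForm_mem_polyFun (b.coord i)⟩)
  simpa [s] using this

/-- The polynomial functions on the closure of the image of a regular map embed into the regular
functions on the domain. -/
theorem trdeg_coordRing_closure_le [TopologicalSpace E] [IsZariski k E] [Infinite k]
    [FiniteDimensional k F] {g : polyFun k F} {φ : F → E} (hφ : IsRegularAway g φ)
    {t₀ : F} (ht₀ : g.1 t₀ ≠ 0) :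
    Algebra.trdeg k (coordRing k (closure (φ '' {t | g.1 t ≠ 0}))) ≤ Module.finrank k F := by
  refine le_trans ?_ (trdeg_regularRing_le ht₀)
  have hmem : ∀ t : {t | g.1 t ≠ 0}, φ t ∈ closure (φ '' {t | g.1 t ≠ 0}) := fun t =>
    subset_closure ⟨t, t.2, rfl⟩
  let pull : (closure (φ '' {t | g.1 t ≠ 0}) → k) →ₐ[k] ({t | g.1 t ≠ 0} → k) :=
    { toFun := fun f t => f ⟨φ t, hmem t⟩
      map_one' := rfl
      map_mul' := fun _ _ => rfl
      map_zero' := rfl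
      map_add' := fun _ _ => rfl
      commutes' := fun _ => rfl }
  have hpull : ∀ f : coordRing k (closure (φ '' {t | g.1 t ≠ 0})), pull f.1 ∈ regularRing g := by
    rintro ⟨_, p, hp, rfl⟩
    exact ⟨_, hφ.comp hp, rfl⟩
  refine trdeg_le_of_injective ((pull.comp (Subalgebra.val _)).codRestrict _ hpull) ?_
  rw [injective_iff_map_eq_zero]
  rintro ⟨_, p, hp, rfl⟩ h
  ext ⟨x, hx⟩
  refine polyFun_eq_zero_of_mem_closure hp ?_ hx
  rintro _ ⟨t, ht, rfl⟩
  exact congrFun (congrArg Subtype.val h) ⟨t, ht⟩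

/-- An irreducible closed set that is the closure of the image of a regular map with a regular
left inverse has the dimension of the parameter space. Chains of irreducible closed subsets are
bounded by the transcendence degree, and the images of a flag of affine subspaces form a chain
of maximal length. -/
theorem topologicalKrullDim_closure_image [TopologicalSpace E] [IsZariski k E] [Infinite k]
    [FiniteDimensional k F] [FiniteDimensional k E] {g : polyFun k F} {g' : polyFun k E}
    {φ : F → E} (hφ : IsRegularAway g φ) {ρ : E → F} (hρ : IsRegularAway g' ρ)
    (hg : ∀ t, g.1 t ≠ 0 → g'.1 (φ t) ≠ 0) (hρφ : ∀ t, g.1 t ≠ 0 → ρ (φ t) = t)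
    {t₀ : F} (ht₀ : g.1 t₀ ≠ 0) :
    topologicalKrullDim (closure (φ '' {t | g.1 t ≠ 0})) = Module.finrank k F := by
  set Z := closure (φ '' {t | g.1 t ≠ 0}) with hZ
  apply le_antisymm
  · -- The transcendence degree is a strictly monotone function with values at most `finrank k F`.
    refine iSup_le fun p => ?_
    let h : TopologicalSpace.IrreducibleCloseds Z → ℕ := fun L =>
      Cardinal.toNat (Algebra.trdeg k (coordRing k (TopologicalSpace.IrreducibleCloseds.map
        (Subtype.val : Z → E) continuous_subtype_val L : Set E)))
    have hlt : ∀ L : TopologicalSpace.IrreducibleCloseds Z,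
        Algebra.trdeg k (coordRing k (TopologicalSpace.IrreducibleCloseds.map
        (Subtype.val : Z → E) continuous_subtype_val L : Set E)) < Cardinal.aleph0 := fun L =>
      have := isDomain_coordRing (k := k) (TopologicalSpace.IrreducibleCloseds.map
        (Subtype.val : Z → E) continuous_subtype_val L).isIrreducible
      have := finiteType_coordRing (k := k) (TopologicalSpace.IrreducibleCloseds.map
        (Subtype.val : Z → E) continuous_subtype_val L : Set E)
      trdeg_lt_aleph0_of_finiteType ..
    have hmono : StrictMono h := fun L L' hLL' => by
      refine Cardinal.toNat_lt_toNat (trdeg_coordRing_lt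
        (TopologicalSpace.IrreducibleCloseds.isIrreducible _)
        (TopologicalSpace.IrreducibleCloseds.isIrreducible _)
        (TopologicalSpace.IrreducibleCloseds.isClosed _) ?_) (hlt L')
      exact TopologicalSpace.IrreducibleCloseds.map_strictMono_of_isInducing .subtypeVal hLL'
    have hle : ∀ L, h L ≤ Module.finrank k F := fun L => by
      have hsub : (TopologicalSpace.IrreducibleCloseds.map
        (Subtype.val : Z → E) continuous_subtype_val L : Set E) ⊆ Z := by
        refine closure_minimal ?_ isClosed_closure
        rintro _ ⟨x, -, rfl⟩
        exact x.2
      have hZi : IsIrreducible Z := hφ.isIrreducible_closure ⊤ t₀ (by simp) ht₀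
      have h1 : Algebra.trdeg k (coordRing k Z) ≤ Module.finrank k F :=
        trdeg_coordRing_closure_le hφ ht₀
      rcases hsub.eq_or_ssubset with heq | hss
      · have h2 := h1
        rw [← heq] at h2
        exact (Cardinal.toNat_le_toNat h2 Cardinal.natCast_lt_aleph0).trans_eq
          (Cardinal.toNat_natCast _)
      · refine (Cardinal.toNat_le_toNat (le_trans ?_ h1) Cardinal.natCast_lt_aleph0).trans_eq
          (Cardinal.toNat_natCast _)
        exact (trdeg_coordRing_lt (TopologicalSpace.IrreducibleCloseds.isIrreducible _)
          hZi (TopologicalSpace.IrreducibleCloseds.isClosed _) hss).le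
    have := LTSeries.head_add_length_le_nat (p.map h hmono)
    have h2 : (p.map h hmono).last ≤ Module.finrank k F := by
      rw [LTSeries.last_map]; exact hle _
    have h3 : p.length ≤ Module.finrank k F := by
      change _ + p.length ≤ _ at this
      omega
    exact_mod_cast h3
  · -- The chain consists of the closures of the images of a flag of affine subspaces `t₀ + V j`.
    let b := Module.finBasis k F
    let d := Module.finrank k F
    let V : ℕ → Submodule k F := fun j => Submodule.span k (b '' {i | (i : ℕ) < j})
    let S : ℕ → Set F := fun j => {t | t - t₀ ∈ V j ∧ g.1 t ≠ 0}
    have hmonoS : ∀ {i j}, i ≤ j → S i ⊆ S j := fun {i j} hij t ht =>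
      ⟨Submodule.span_mono (Set.image_mono fun a (ha : _ < _) => ha.trans_le hij) ht.1, ht.2⟩
    have hSZ : ∀ j, closure (φ '' S j) ⊆ Z := fun j =>
      closure_mono (Set.image_mono fun t ht => ht.2)
    let L : ℕ → TopologicalSpace.IrreducibleCloseds Z := fun j =>
      { carrier := Subtype.val ⁻¹' closure (φ '' S j)
        isIrreducible' := by
          exact (hφ.isIrreducible_closure (V j) t₀ rfl ht₀).preimage_of_isInducing .subtypeVal
            (by simpa using hSZ j)
        isClosed' := isClosed_closure.preimage continuous_subtype_val }
    have hL : ∀ j, j < d → L j < L (j + 1) := fun j hj => by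
      refine lt_of_le_of_ne (fun x hx => closure_mono (Set.image_mono (hmonoS j.le_succ)) hx) ?_
      intro heq
      -- A point of the next affine subspace outside the present one, in the domain of `φ`.
      let l := b.coord ⟨j, hj⟩
      have hlV : ∀ v ∈ V j, l v = 0 := fun v hv => by
        induction hv using Submodule.span_induction with
        | mem x hx =>
          obtain ⟨i, hi, rfl⟩ := hx
          have : i ≠ ⟨j, hj⟩ := fun h => by simp [h] at hi
          simp [l, this]
        | zero => simp
        | add x y _ _ hx hy => simp [hx, hy]
        | smul a x _ hx => simp [hx]
      have hreg : ∀ t ∈ S (j + 1), l t = l t₀ := fun t ht => by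
        have hmem : φ t ∈ closure (φ '' S j) := by
          have h1 : φ t ∈ closure (φ '' S (j + 1)) := subset_closure ⟨t, ht, rfl⟩
          have h2 : (⟨φ t, hSZ _ h1⟩ : Z) ∈ L (j + 1) := h1
          rw [← heq] at h2
          exact h2
        have := regularAway_eq_zero_of_mem_closure (f := fun x => l (ρ x) - l t₀)
          (sub_mem (hρ l) ((regularAway g').algebraMap_mem (l t₀))) (S := φ '' S j) (by
            rintro _ ⟨s, hs, rfl⟩ -
            rw [hρφ s hs.2, ← map_sub]
            exact hlV _ hs.1) hmem (hg t ht.2)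
        rwa [hρφ t ht.2, sub_eq_zero] at this
      have hline : ∀ c : k, g.1 (t₀ + c • b ⟨j, hj⟩) * c = 0 := fun c => by
        by_cases hc : g.1 (t₀ + c • b ⟨j, hj⟩) = 0
        · simp [hc]
        · have := hreg (t₀ + c • b ⟨j, hj⟩) ⟨by
            rw [add_sub_cancel_left]
            exact Submodule.smul_mem _ _ (Submodule.subset_span ⟨_, by simp, rfl⟩), hc⟩
          simp only [map_add, map_smul, add_eq_left, l] at this
          simp at this
          simp [this]
      rcases polyFun_eq_zero_or_eq_zero (F := k)
        (comp_mem_of_linearForm (polyFun k k) (fun c => t₀ + c • b ⟨j, hj⟩) (fun l' => by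
          simp only [map_add]
          exact add_mem (const_mem_polyFun _) (linearForm_mem_polyFun
            (l' ∘ₗ LinearMap.toSpanSingleton k F (b ⟨j, hj⟩)))) g.2)
        (linearForm_mem_polyFun LinearMap.id) hline with h | h
      · exact ht₀ (by simpa using h 0)
      · exact one_ne_zero (h 1)
    let p : LTSeries (TopologicalSpace.IrreducibleCloseds Z) :=
      { length := d
        toFun := fun i => L i
        step := fun i => hL i i.2 }
    exact Order.LTSeries.length_le_krullDim p

end Dimension

/-! ### Regular maps into matrix spaces and products -/

section Regular

variable {k E E' F l m n : Type*} [Field k] [AddCommGroup E] [Module k E] [AddCommGroup E']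
  [Module k E'] [AddCommGroup F] [Module k F] {g : polyFun k F}

theorem isRegularAway_linearMap (φ : F →ₗ[k] E) : IsRegularAway g φ :=
  fun l => polyFun_le_regularAway g (linearForm_mem_polyFun (l ∘ₗ φ))

theorem isRegularAway_const (x : E) : IsRegularAway g fun _ => x :=
  fun l => (regularAway g).algebraMap_mem (l x)

theorem IsRegularAway.linearMap_comp {φ : F → E} (hφ : IsRegularAway g φ) (f : E →ₗ[k] E') :
    IsRegularAway g fun t => f (φ t) :=
  fun l => hφ (l ∘ₗ f)

theorem IsRegularAway.add {φ ψ : F → E} (hφ : IsRegularAway g φ) (hψ : IsRegularAway g ψ) :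
    IsRegularAway g fun t => φ t + ψ t := fun l => by
  simp only [map_add]
  exact add_mem (hφ l) (hψ l)

theorem IsRegularAway.smul {φ : F → E} (hφ : IsRegularAway g φ) {f : F → k}
    (hf : f ∈ regularAway g) : IsRegularAway g fun t => f t • φ t := fun l => by
  simp only [map_smul, smul_eq_mul]
  exact mul_mem hf (hφ l)

theorem IsRegularAway.prodMk {φ : F → E} {ψ : F → E'} (hφ : IsRegularAway g φ)
    (hψ : IsRegularAway g ψ) : IsRegularAway g fun t => (φ t, ψ t) := fun l => by
  have : ∀ t, l (φ t, ψ t) = l.comp (LinearMap.inl k E E') (φ t) +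
      l.comp (LinearMap.inr k E E') (ψ t) := fun t => by
    simp [← map_add]
  simp only [this]
  exact add_mem (hφ _) (hψ _)

theorem isRegularAway_matrix_iff [Fintype m] [Fintype n] {M : F → Matrix m n k} :
    IsRegularAway g M ↔ ∀ i j, (fun t => M t i j) ∈ regularAway g := by
  classical
  refine ⟨fun h i j => h (Matrix.entryLinearMap k k i j), fun h l => ?_⟩
  have : ∀ t, l (M t) = ∑ i, ∑ j, M t i j * l (Matrix.single i j 1) := fun t => by
    conv_lhs => rw [Matrix.matrix_eq_sum_single (M t)]
    simp only [map_sum]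
    refine Finset.sum_congr rfl fun i _ => Finset.sum_congr rfl fun j _ => ?_
    rw [← smul_eq_mul, ← map_smul, Matrix.smul_single, smul_eq_mul, mul_one]
  have h2 : (fun t => l (M t)) =
      ∑ i, ∑ j, (fun t => M t i j) * fun _ => l (Matrix.single i j 1) := by
    funext t
    simp [this]
  rw [h2]
  exact sum_mem fun i _ => sum_mem fun j _ => mul_mem (h i j) ((regularAway g).algebraMap_mem _)

theorem IsRegularAway.matrix_mul [Fintype l] [Fintype m] [Fintype n] {M : F → Matrix l m k}
    {N : F → Matrix m n k} (hM : IsRegularAway g M) (hN : IsRegularAway g N) :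
    IsRegularAway g fun t => M t * N t := by
  rw [isRegularAway_matrix_iff] at *
  intro i j
  have : (fun t => (M t * N t) i j) = ∑ a, (fun t => M t i a) * fun t => N t a j := by
    funext t
    simp [Matrix.mul_apply]
  rw [this]
  exact sum_mem fun a _ => mul_mem (hM i a) (hN a j)

/-- The determinant of a matrix with entries in an algebra of functions is in that algebra. -/
theorem det_mem_of_entries {X : Type*} [Fintype n] [DecidableEq n] (S : Subalgebra k (X → k))
    {M : X → Matrix n n k} (hM : ∀ i j, (fun t => M t i j) ∈ S) : (fun t => (M t).det) ∈ S := by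
  have : (fun t => (M t).det) = ∑ σ : Equiv.Perm n, ((Equiv.Perm.sign σ : ℤ) : k) •
      ∏ i, fun t => M t (σ i) i := by
    funext t
    simp [Matrix.det_apply', Finset.prod_apply]
  rw [this]
  exact sum_mem fun σ _ => S.smul_mem (prod_mem fun i _ => hM _ _) _

theorem det_mem_polyFun [Fintype n] [DecidableEq n] (f : E →ₗ[k] Matrix n n k) :
    (fun t => (f t).det) ∈ polyFun k E :=
  det_mem_of_entries _ fun i j => linearForm_mem_polyFun (Matrix.entryLinearMap k k i j ∘ₗ f)

theorem IsRegularAway.matrix_inv [Fintype n] [DecidableEq n] {M : F → Matrix n n k}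
    (hM : IsRegularAway g M) {f : F → k} (hf : f ∈ polyFun k F)
    (h : ∀ t, g.1 t = (M t).det * f t) : IsRegularAway g fun t => (M t)⁻¹ := by
  have hdet : (fun t => (M t).det⁻¹) ∈ regularAway g :=
    mem_regularAway_of_mul_eq g hf fun t ht => by
      rw [h t] at ht ⊢
      rw [inv_mul_cancel_left₀ (left_ne_zero_of_mul ht)]
  rw [isRegularAway_matrix_iff] at hM
  rw [isRegularAway_matrix_iff]
  intro i j
  have : (fun t => (M t)⁻¹ i j) = (fun t => (M t).det⁻¹) * fun t => (M t).adjugate i j := by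
    funext t
    simp [Matrix.inv_def]
  rw [this]
  refine mul_mem hdet ?_
  simp only [Matrix.adjugate_apply]
  refine det_mem_of_entries _ fun a b => ?_
  by_cases ha : a = j
  · subst ha
    simp only [Matrix.updateRow_self]
    exact (regularAway g).algebraMap_mem ((Pi.single i 1 : n → k) b)
  · simpa [Matrix.updateRow_ne ha] using hM a b

end Regular

/-! ### Three by three block matrices -/

section Blocks

variable {k l₁ l₂ l₃ m₁ m₂ m₃ n₁ n₂ n₃ : Type*}

/-- The `3 × 3` block matrix with the given blocks. -/
def blk3 (a : Matrix l₁ m₁ k) (b : Matrix l₁ m₂ k) (c : Matrix l₁ m₃ k)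
    (d : Matrix l₂ m₁ k) (e : Matrix l₂ m₂ k) (f : Matrix l₂ m₃ k)
    (g : Matrix l₃ m₁ k) (h : Matrix l₃ m₂ k) (i : Matrix l₃ m₃ k) :
    Matrix (l₁ ⊕ l₂ ⊕ l₃) (m₁ ⊕ m₂ ⊕ m₃) k :=
  Matrix.of fun
    | .inl x, .inl y => a x y
    | .inl x, .inr (.inl y) => b x y
    | .inl x, .inr (.inr y) => c x y
    | .inr (.inl x), .inl y => d x y
    | .inr (.inl x), .inr (.inl y) => e x y
    | .inr (.inl x), .inr (.inr y) => f x y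
    | .inr (.inr x), .inl y => g x y
    | .inr (.inr x), .inr (.inl y) => h x y
    | .inr (.inr x), .inr (.inr y) => i x y

theorem exists_eq_blk3 (M : Matrix (l₁ ⊕ l₂ ⊕ l₃) (m₁ ⊕ m₂ ⊕ m₃) k) :
    ∃ a b c d e f g h i, M = blk3 a b c d e f g h i := by
  refine ⟨M.submatrix .inl .inl, M.submatrix .inl (.inr ∘ .inl), M.submatrix .inl (.inr ∘ .inr),
    M.submatrix (.inr ∘ .inl) .inl, M.submatrix (.inr ∘ .inl) (.inr ∘ .inl),
    M.submatrix (.inr ∘ .inl) (.inr ∘ .inr), M.submatrix (.inr ∘ .inr) .inl,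
    M.submatrix (.inr ∘ .inr) (.inr ∘ .inl), M.submatrix (.inr ∘ .inr) (.inr ∘ .inr), ?_⟩
  ext (x | x | x) (y | y | y) <;> rfl

theorem blk3_inj {a b c d e f g h i} {a' b' c' d' e' f' g' h' i'} :
    (blk3 a b c d e f g h i : Matrix (l₁ ⊕ l₂ ⊕ l₃) (m₁ ⊕ m₂ ⊕ m₃) k) =
      blk3 a' b' c' d' e' f' g' h' i' ↔ a = a' ∧ b = b' ∧ c = c' ∧ d = d' ∧ e = e' ∧ f = f' ∧
        g = g' ∧ h = h' ∧ i = i' := by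
  refine ⟨fun H => ?_, ?_⟩
  · refine ⟨?_, ?_, ?_, ?_, ?_, ?_, ?_, ?_, ?_⟩ <;> ext x y
    · exact congrFun (congrFun H (.inl x)) (.inl y)
    · exact congrFun (congrFun H (.inl x)) (.inr (.inl y))
    · exact congrFun (congrFun H (.inl x)) (.inr (.inr y))
    · exact congrFun (congrFun H (.inr (.inl x))) (.inl y)
    · exact congrFun (congrFun H (.inr (.inl x))) (.inr (.inl y))
    · exact congrFun (congrFun H (.inr (.inl x))) (.inr (.inr y))
    · exact congrFun (congrFun H (.inr (.inr x))) (.inl y)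
    · exact congrFun (congrFun H (.inr (.inr x))) (.inr (.inl y))
    · exact congrFun (congrFun H (.inr (.inr x))) (.inr (.inr y))
  · rintro ⟨rfl, rfl, rfl, rfl, rfl, rfl, rfl, rfl, rfl⟩
    rfl

theorem blk3_mul [Fintype m₁] [Fintype m₂] [Fintype m₃] [NonUnitalNonAssocSemiring k]
    {a b c d e f g h i} {a' b' c' d' e' f' g' h' i'} :
    (blk3 a b c d e f g h i : Matrix (l₁ ⊕ l₂ ⊕ l₃) (m₁ ⊕ m₂ ⊕ m₃) k) *
      (blk3 a' b' c' d' e' f' g' h' i' : Matrix (m₁ ⊕ m₂ ⊕ m₃) (n₁ ⊕ n₂ ⊕ n₃) k) =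
    blk3 (a * a' + b * d' + c * g') (a * b' + b * e' + c * h') (a * c' + b * f' + c * i')
      (d * a' + e * d' + f * g') (d * b' + e * e' + f * h') (d * c' + e * f' + f * i')
      (g * a' + h * d' + i * g') (g * b' + h * e' + i * h') (g * c' + h * f' + i * i') := by
  ext (x | x | x) (y | y | y) <;>
    simp [blk3, Matrix.mul_apply, Fintype.sum_sum_type, add_assoc]

theorem blk3_add [Add k] {a b c d e f g h i} {a' b' c' d' e' f' g' h' i'} :
    (blk3 a b c d e f g h i : Matrix (l₁ ⊕ l₂ ⊕ l₃) (m₁ ⊕ m₂ ⊕ m₃) k) +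
      blk3 a' b' c' d' e' f' g' h' i' = blk3 (a + a') (b + b') (c + c') (d + d') (e + e') (f + f')
        (g + g') (h + h') (i + i') := by
  ext (x | x | x) (y | y | y) <;> rfl

theorem blk3_smul {R : Type*} [SMul R k] {a b c d e f g h i} (r : R) :
    r • (blk3 a b c d e f g h i : Matrix (l₁ ⊕ l₂ ⊕ l₃) (m₁ ⊕ m₂ ⊕ m₃) k) =
      blk3 (r • a) (r • b) (r • c) (r • d) (r • e) (r • f) (r • g) (r • h) (r • i) := by
  ext (x | x | x) (y | y | y) <;> rfl

theorem blk3_zero [Zero k] :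
    (0 : Matrix (l₁ ⊕ l₂ ⊕ l₃) (m₁ ⊕ m₂ ⊕ m₃) k) = blk3 0 0 0 0 0 0 0 0 0 := by
  ext (x | x | x) (y | y | y) <;> rfl

theorem blk3_one [Zero k] [One k] [DecidableEq l₁] [DecidableEq l₂] [DecidableEq l₃] :
    (1 : Matrix (l₁ ⊕ l₂ ⊕ l₃) (l₁ ⊕ l₂ ⊕ l₃) k) = blk3 1 0 0 0 1 0 0 0 1 := by
  ext (x | x | x) (y | y | y) <;> simp [blk3, Matrix.one_apply]

theorem blk3_transpose {a b c d e f g h i} :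
    (blk3 a b c d e f g h i : Matrix (l₁ ⊕ l₂ ⊕ l₃) (m₁ ⊕ m₂ ⊕ m₃) k).transpose =
      blk3 a.transpose d.transpose g.transpose b.transpose e.transpose h.transpose
        c.transpose f.transpose i.transpose := by
  ext (x | x | x) (y | y | y) <;> rfl

theorem IsRegularAway.blk3 {F : Type*} [Field k] [AddCommGroup F] [Module k F]
    [Fintype l₁] [Fintype l₂] [Fintype l₃] [Fintype m₁] [Fintype m₂] [Fintype m₃]
    {φ : polyFun k F} {a : F → Matrix l₁ m₁ k} {b : F → Matrix l₁ m₂ k} {c : F → Matrix l₁ m₃ k}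
    {d : F → Matrix l₂ m₁ k} {e : F → Matrix l₂ m₂ k} {f : F → Matrix l₂ m₃ k}
    {g : F → Matrix l₃ m₁ k} {h : F → Matrix l₃ m₂ k} {i : F → Matrix l₃ m₃ k}
    (ha : IsRegularAway φ a) (hb : IsRegularAway φ b) (hc : IsRegularAway φ c)
    (hd : IsRegularAway φ d) (he : IsRegularAway φ e) (hf : IsRegularAway φ f)
    (hg : IsRegularAway φ g) (hh : IsRegularAway φ h) (hi : IsRegularAway φ i) :
    IsRegularAway φ fun t =>
      blk3 (a t) (b t) (c t) (d t) (e t) (f t) (g t) (h t) (i t) := by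
  rw [isRegularAway_matrix_iff] at *
  rintro (x | x | x) (y | y | y)
  exacts [ha x y, hb x y, hc x y, hd x y, he x y, hf x y, hg x y, hh x y, hi x y]

end Blocks

/-! ### The tuple model of the centralizer -/

/-- The Zariski topology on a vector space: the closed sets are the zero sets of families of
polynomial functions. -/
@[reducible]
def vectorZariskiTopology (k E : Type*) [Field k] [AddCommGroup E] [Module k E] :
    TopologicalSpace E :=
  TopologicalSpace.ofClosed
    {C | ∃ P : Set (E → k), P ⊆ polyFun k E ∧ C = {x | ∀ f ∈ P, f x = 0}}
    ⟨{1}, by simp [(polyFun k E).one_mem], by ext; simp⟩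
    (by
      intro A hA
      have hA' : ∀ C ∈ A, ∃ P : Set (E → k), P ⊆ polyFun k E ∧ C = {x | ∀ f ∈ P, f x = 0} :=
        fun C hC => hA hC
      choose! P hP hP' using hA'
      refine ⟨⋃ C ∈ A, P C, by simpa using hP, ?_⟩
      ext x
      simp only [Set.mem_sInter, Set.mem_iUnion, Set.mem_ofPred_eq]
      refine ⟨fun h f ⟨C, hC, hf⟩ => ?_, fun h C hC => ?_⟩
      · have := h C hC
        rw [hP' C hC] at this
        exact this f hf
      · rw [hP' C hC]
        exact fun f hf => h f ⟨C, hC, hf⟩)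
    (by
      rintro _ ⟨P, hP, rfl⟩ _ ⟨Q, hQ, rfl⟩
      refine ⟨Set.image2 (· * ·) P Q, ?_, ?_⟩
      · rintro _ ⟨p, hp, q, hq, rfl⟩
        exact mul_mem (hP hp) (hQ hq)
      · ext x
        refine ⟨?_, fun h => ?_⟩
        · rintro (h | h) _ ⟨p, hp, q, hq, rfl⟩
          · simp [h p hp]
          · simp [h q hq]
        · by_contra hcon
          simp only [Set.mem_union, Set.mem_ofPred_eq, not_or, not_forall] at hcon
          obtain ⟨⟨p, hp, hpx⟩, q, hq, hqx⟩ := hcon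
          exact mul_ne_zero hpx hqx (h _ ⟨p, hp, q, hq, rfl⟩))

/-- Five matrices describing an endomorphism of `U ⊕ W ⊕ U` that commutes with the map sending the
first copy of `U` identically to the last one: the first copy is mapped by `A`, `C`, `B` to the
three summands, `W` is mapped by `D`, `F` to the last two, and the last copy is mapped
by `A` to itself. -/
@[ext]
structure Tup (k : Type*) (U W : Type) where
  /-- The diagonal block on both copies of `U`. -/
  A : Matrix U U k
  /-- The block from the first to the last copy of `U`. -/
  B : Matrix U U k
  /-- The block from `U` to `W`. -/
  C : Matrix W U k
  /-- The diagonal block on `W`. -/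
  D : Matrix W W k
  /-- The block from `W` to `U`. -/
  F : Matrix U W k

namespace Tup

/-- A tuple as an element of a product. -/
def equivProd (k : Type*) (U W : Type) :
    Tup k U W ≃ Matrix U U k × Matrix U U k × Matrix W U k × Matrix W W k × Matrix U W k where
  toFun x := (x.A, x.B, x.C, x.D, x.F)
  invFun y := ⟨y.1, y.2.1, y.2.2.1, y.2.2.2.1, y.2.2.2.2⟩

variable {k : Type*} {U W U' W' U'' W'' : Type} [Field k]

instance : AddCommGroup (Tup k U W) := (equivProd k U W).addCommGroup

instance : Module k (Tup k U W) := (equivProd k U W).module k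

/-- A tuple as an element of a product, linearly. -/
def linearEquivProd (k : Type*) (U W : Type) [Field k] : Tup k U W ≃ₗ[k]
    Matrix U U k × Matrix U U k × Matrix W U k × Matrix W W k × Matrix U W k :=
  (equivProd k U W).linearEquiv k

instance : TopologicalSpace (Tup k U W) := vectorZariskiTopology k _

instance : IsZariski k (Tup k U W) := ⟨fun C => by
  rw [← isOpen_compl_iff]
  change Cᶜᶜ ∈ _ ↔ _
  rw [compl_compl]
  rfl⟩

instance [Finite U] [Finite W] : FiniteDimensional k (Tup k U W) :=
  Module.Finite.equiv (linearEquivProd k U W).symm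

theorem finrank_eq [Fintype U] [Fintype W] : Module.finrank k (Tup k U W) =
    2 * Fintype.card U ^ 2 + 2 * (Fintype.card U * Fintype.card W) + Fintype.card W ^ 2 := by
  rw [(linearEquivProd k U W).finrank_eq]
  simp only [Module.finrank_prod, Module.finrank_matrix, Module.finrank_self]
  ring

@[simp] theorem add_A (x y : Tup k U W) : (x + y).A = x.A + y.A := rfl
@[simp] theorem add_B (x y : Tup k U W) : (x + y).B = x.B + y.B := rfl
@[simp] theorem add_C (x y : Tup k U W) : (x + y).C = x.C + y.C := rfl
@[simp] theorem add_D (x y : Tup k U W) : (x + y).D = x.D + y.D := rfl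
@[simp] theorem add_F (x y : Tup k U W) : (x + y).F = x.F + y.F := rfl
@[simp] theorem smul_A (c : k) (x : Tup k U W) : (c • x).A = c • x.A := rfl
@[simp] theorem smul_B (c : k) (x : Tup k U W) : (c • x).B = c • x.B := rfl
@[simp] theorem smul_C (c : k) (x : Tup k U W) : (c • x).C = c • x.C := rfl
@[simp] theorem smul_D (c : k) (x : Tup k U W) : (c • x).D = c • x.D := rfl
@[simp] theorem smul_F (c : k) (x : Tup k U W) : (c • x).F = c • x.F := rfl

/-- The component `A` as a linear map. -/
def linA : Tup k U W →ₗ[k] Matrix U U k := ⟨⟨Tup.A, fun _ _ => rfl⟩, fun _ _ => rfl⟩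
/-- The component `B` as a linear map. -/
def linB : Tup k U W →ₗ[k] Matrix U U k := ⟨⟨Tup.B, fun _ _ => rfl⟩, fun _ _ => rfl⟩
/-- The component `C` as a linear map. -/
def linC : Tup k U W →ₗ[k] Matrix W U k := ⟨⟨Tup.C, fun _ _ => rfl⟩, fun _ _ => rfl⟩
/-- The component `D` as a linear map. -/
def linD : Tup k U W →ₗ[k] Matrix W W k := ⟨⟨Tup.D, fun _ _ => rfl⟩, fun _ _ => rfl⟩
/-- The component `F` as a linear map. -/
def linF : Tup k U W →ₗ[k] Matrix U W k := ⟨⟨Tup.F, fun _ _ => rfl⟩, fun _ _ => rfl⟩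

theorem isRegularAway_mk {V : Type*} [AddCommGroup V] [Module k V] {g : polyFun k V}
    {A B : V → Matrix U U k} {C : V → Matrix W U k} {D : V → Matrix W W k} {F : V → Matrix U W k}
    (hA : IsRegularAway g A) (hB : IsRegularAway g B) (hC : IsRegularAway g C)
    (hD : IsRegularAway g D) (hF : IsRegularAway g F) :
    IsRegularAway g fun t => (⟨A t, B t, C t, D t, F t⟩ : Tup k U W) :=
  (hA.prodMk (hB.prodMk (hC.prodMk (hD.prodMk hF)))).linearMap_comp
    (linearEquivProd k U W).symm.toLinearMap

/-- The tuples whose square is zero; the sign conventions are those of characteristic two. -/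
def sqZero (k : Type*) (U W : Type) [Field k] [Fintype U] [Fintype W] : Set (Tup k U W) :=
  {x | x.A * x.A = 0 ∧ x.A * x.B + x.B * x.A + x.F * x.C = 0 ∧ x.C * x.A + x.D * x.C = 0 ∧
    x.D * x.D = 0 ∧ x.A * x.F + x.F * x.D = 0}

variable [Fintype U] [Fintype W] [Fintype U'] [Fintype W'] [Fintype U''] [Fintype W'']

theorem isClosed_sqZero : IsClosed (sqZero k U W) := by
  have key : ∀ {m n : Type} (M : Tup k U W → Matrix m n k) [Fintype m] [Fintype n]
      (_ : IsRegularAway (1 : polyFun k (Tup k U W)) M), IsClosed {x | M x = 0} := by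
    intro m n M _ _ hM
    have : {x | M x = 0} = ⋂ i, ⋂ j, {x | M x i j = 0} := by
      ext x
      simp [← Matrix.ext_iff]
    rw [this]
    refine isClosed_iInter fun i => isClosed_iInter fun j => ?_
    obtain ⟨N, p, hp, h⟩ := isRegularAway_matrix_iff.1 hM i j
    have h' : (fun x => M x i j) = p := funext fun x => by simpa using h x (by simp)
    have : {x | M x i j = 0} = {x | p x = 0} := by rw [← h']
    rw [this]
    exact isClosed_zeroSet hp
  have hA := isRegularAway_linearMap (g := 1) (linA (k := k) (U := U) (W := W))
  have hB := isRegularAway_linearMap (g := 1) (linB (k := k) (U := U) (W := W))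
  have hC := isRegularAway_linearMap (g := 1) (linC (k := k) (U := U) (W := W))
  have hD := isRegularAway_linearMap (g := 1) (linD (k := k) (U := U) (W := W))
  have hF := isRegularAway_linearMap (g := 1) (linF (k := k) (U := U) (W := W))
  have := (key _ (hA.matrix_mul hA)).inter <|
    (key _ (((hA.matrix_mul hB).add (hB.matrix_mul hA)).add (hF.matrix_mul hC))).inter <|
    (key _ ((hC.matrix_mul hA).add (hD.matrix_mul hC))).inter <|
    (key _ (hD.matrix_mul hD)).inter (key _ ((hA.matrix_mul hF).add (hF.matrix_mul hD)))
  exact this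

/-- The action of a pair of (possibly rectangular) base changes on tuples. -/
def levi (p : Matrix U' U k) (p' : Matrix U U' k) (q : Matrix W' W k) (q' : Matrix W W' k) :
    Tup k U W →ₗ[k] Tup k U' W' where
  toFun x := ⟨p * x.A * p', p * x.B * p', q * x.C * p', q * x.D * q', p * x.F * q'⟩
  map_add' x y := by ext1 <;> simp [Matrix.mul_add, Matrix.add_mul]
  map_smul' c x := by ext1 <;> simp

theorem levi_apply (p : Matrix U' U k) (p' : Matrix U U' k) (q : Matrix W' W k)
    (q' : Matrix W W' k) (x : Tup k U W) : levi p p' q q' x =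
      ⟨p * x.A * p', p * x.B * p', q * x.C * p', q * x.D * q', p * x.F * q'⟩ := rfl

theorem levi_levi (p₁ : Matrix U'' U' k) (p₁' : Matrix U' U'' k) (q₁ : Matrix W'' W' k)
    (q₁' : Matrix W' W'' k) (p : Matrix U' U k) (p' : Matrix U U' k) (q : Matrix W' W k)
    (q' : Matrix W W' k) (x : Tup k U W) :
    levi p₁ p₁' q₁ q₁' (levi p p' q q' x) =
      levi (p₁ * p) (p' * p₁') (q₁ * q) (q' * q₁') x := by
  simp only [levi_apply, Matrix.mul_assoc]

theorem levi_one [DecidableEq U] [DecidableEq W] (x : Tup k U W) :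
    levi 1 1 1 1 x = x := by
  simp [levi_apply]

theorem levi_mem_sqZero [DecidableEq U] [DecidableEq W] {p : Matrix U' U k} {p' : Matrix U U' k}
    {q : Matrix W' W k} {q' : Matrix W W' k} (hp : p' * p = 1) (hq : q' * q = 1)
    {x : Tup k U W} (hx : x ∈ sqZero k U W) : levi p p' q q' x ∈ sqZero k U' W' := by
  have hp' : ∀ {V : Type} (M : Matrix U V k), p' * (p * M) = M := fun M => by
    rw [← Matrix.mul_assoc, hp, Matrix.one_mul]
  have hq' : ∀ {V : Type} (M : Matrix W V k), q' * (q * M) = M := fun M => by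
    rw [← Matrix.mul_assoc, hq, Matrix.one_mul]
  obtain ⟨h1, h2, h3, h4, h5⟩ := hx
  refine ⟨?_, ?_, ?_, ?_, ?_⟩ <;> simp only [levi_apply, Matrix.mul_assoc, hp', hq']
  · rw [← Matrix.mul_assoc x.A, h1, Matrix.zero_mul, Matrix.mul_zero]
  · rw [show p * (x.A * (x.B * p')) + p * (x.B * (x.A * p')) + p * (x.F * (x.C * p')) =
      p * ((x.A * x.B + x.B * x.A + x.F * x.C) * p') by
        simp only [Matrix.mul_assoc, Matrix.mul_add, Matrix.add_mul], h2, Matrix.zero_mul,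
        Matrix.mul_zero]
  · rw [show q * (x.C * (x.A * p')) + q * (x.D * (x.C * p')) = q * ((x.C * x.A + x.D * x.C) * p') by
        simp only [Matrix.mul_assoc, Matrix.mul_add, Matrix.add_mul], h3, Matrix.zero_mul,
        Matrix.mul_zero]
  · rw [← Matrix.mul_assoc x.D, h4, Matrix.zero_mul, Matrix.mul_zero]
  · rw [show p * (x.A * (x.F * q')) + p * (x.F * (x.D * q')) = p * ((x.A * x.F + x.F * x.D) * q') by
        simp only [Matrix.mul_assoc, Matrix.mul_add, Matrix.add_mul], h5, Matrix.zero_mul,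
        Matrix.mul_zero]

/-- Transposing all the blocks and exchanging `C` and `F`: the transposition of the whole matrix
with respect to its antidiagonal of blocks. -/
def tr : Tup k U W →ₗ[k] Tup k U W where
  toFun x := ⟨x.A.transpose, x.B.transpose, x.F.transpose, x.D.transpose, x.C.transpose⟩
  map_add' x y := by ext1 <;> simp
  map_smul' c x := by ext1 <;> simp

theorem tr_apply (x : Tup k U W) : tr x =
    ⟨x.A.transpose, x.B.transpose, x.F.transpose, x.D.transpose, x.C.transpose⟩ := rfl

theorem tr_tr (x : Tup k U W) : tr (tr x) = x := rfl

theorem tr_levi (p : Matrix U' U k) (p' : Matrix U U' k) (q : Matrix W' W k)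
    (q' : Matrix W W' k) (x : Tup k U W) :
    tr (levi p p' q q' x) = levi p'.transpose p.transpose q'.transpose q.transpose (tr x) := by
  simp [tr_apply, levi_apply, Matrix.mul_assoc]

theorem tr_mem_sqZero {x : Tup k U W} (hx : x ∈ sqZero k U W) : tr x ∈ sqZero k U W := by
  obtain ⟨h1, h2, h3, h4, h5⟩ := hx
  refine ⟨?_, ?_, ?_, ?_, ?_⟩ <;> simp only [tr_apply, ← Matrix.transpose_mul,
    ← Matrix.transpose_add]
  · rw [h1, Matrix.transpose_zero]
  · rw [add_comm (x.B * x.A), h2, Matrix.transpose_zero]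
  · rw [h5, Matrix.transpose_zero]
  · rw [h4, Matrix.transpose_zero]
  · rw [h3, Matrix.transpose_zero]

section Unipotent

/-- Conjugation by the unipotent element with the entry `h` in the position of `B`. In
characteristic two this is an involution, and no signs are needed. -/
def uniB (h : Matrix U U k) (x : Tup k U W) : Tup k U W :=
  ⟨x.A, x.B + x.A * h + h * x.A, x.C, x.D, x.F⟩

/-- Conjugation by the unipotent element with the entry `h` in the position of `C`. -/
def uniC (h : Matrix W U k) (x : Tup k U W) : Tup k U W :=
  ⟨x.A, x.B + x.F * h, x.C + h * x.A + x.D * h, x.D, x.F⟩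

/-- Conjugation by the unipotent element with the entry `h` in the position of `F`. -/
def uniF (h : Matrix U W k) (x : Tup k U W) : Tup k U W :=
  ⟨x.A, x.B + h * x.C, x.C, x.D, x.F + x.A * h + h * x.D⟩

theorem uniB_add_smul (h : Matrix U U k) (x y : Tup k U W) (c : k) :
    uniB h (x + c • y) = uniB h x + c • uniB h y := by
  ext1 <;> simp [uniB, Matrix.mul_add, Matrix.add_mul]
  abel

theorem uniC_add_smul (h : Matrix W U k) (x y : Tup k U W) (c : k) :
    uniC h (x + c • y) = uniC h x + c • uniC h y := by
  ext1 <;> simp [uniC, Matrix.mul_add, Matrix.add_mul] <;> abel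

theorem uniF_add_smul (h : Matrix U W k) (x y : Tup k U W) (c : k) :
    uniF h (x + c • y) = uniF h x + c • uniF h y := by
  ext1 <;> simp [uniF, Matrix.mul_add, Matrix.add_mul] <;> abel

variable [CharP k 2]

theorem matrix_add_self {m n : Type} (M : Matrix m n k) : M + M = 0 := by
  ext i j
  exact CharTwo.add_self_eq_zero (M i j)

theorem matrix_add_self_add {m n : Type} (M N : Matrix m n k) : M + (M + N) = N := by
  rw [← add_assoc, matrix_add_self, zero_add]

theorem uniB_uniB (h : Matrix U U k) (x : Tup k U W) : uniB h (uniB h x) = x := by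
  ext1 <;> simp only [uniB]
  rw [show x.B + x.A * h + h * x.A + x.A * h + h * x.A =
    x.B + ((x.A * h + x.A * h) + (h * x.A + h * x.A)) by abel]
  simp [matrix_add_self]

theorem uniC_uniC (h : Matrix W U k) (x : Tup k U W) : uniC h (uniC h x) = x := by
  ext1 <;> simp only [uniC]
  · rw [add_assoc, matrix_add_self, add_zero]
  · rw [show x.C + h * x.A + x.D * h + h * x.A + x.D * h =
      x.C + ((x.D * h + x.D * h) + (h * x.A + h * x.A)) by abel]
    simp [matrix_add_self]

theorem uniF_uniF (h : Matrix U W k) (x : Tup k U W) : uniF h (uniF h x) = x := by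
  ext1 <;> simp only [uniF]
  · rw [add_assoc, matrix_add_self, add_zero]
  · rw [show x.F + x.A * h + h * x.D + x.A * h + h * x.D =
      x.F + ((x.A * h + x.A * h) + (h * x.D + h * x.D)) by abel]
    simp [matrix_add_self]

theorem uniB_mem_sqZero (h : Matrix U U k) {x : Tup k U W} (hx : x ∈ sqZero k U W) :
    uniB h x ∈ sqZero k U W := by
  obtain ⟨h1, h2, h3, h4, h5⟩ := hx
  refine ⟨h1, ?_, h3, h4, h5⟩
  simp only [uniB, Matrix.mul_add, Matrix.add_mul]
  rw [show x.A * x.B + x.A * (x.A * h) + x.A * (h * x.A) +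
    (x.B * x.A + x.A * h * x.A + h * x.A * x.A) + x.F * x.C =
    (x.A * x.B + x.B * x.A + x.F * x.C) + x.A * x.A * h + h * (x.A * x.A) +
    (x.A * (h * x.A) + x.A * (h * x.A)) by simp only [Matrix.mul_assoc]; abel]
  simp [h1, h2, matrix_add_self]

theorem uniC_mem_sqZero (h : Matrix W U k) {x : Tup k U W} (hx : x ∈ sqZero k U W) :
    uniC h x ∈ sqZero k U W := by
  obtain ⟨h1, h2, h3, h4, h5⟩ := hx
  refine ⟨h1, ?_, ?_, h4, h5⟩ <;>
  simp only [uniC, Matrix.mul_add, Matrix.add_mul]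
  · rw [show x.A * x.B + x.A * (x.F * h) + (x.B * x.A + x.F * h * x.A) +
      (x.F * x.C + x.F * (h * x.A) + x.F * (x.D * h)) =
      (x.A * x.B + x.B * x.A + x.F * x.C) + (x.A * x.F + x.F * x.D) * h +
      (x.F * (h * x.A) + x.F * (h * x.A)) by
        simp only [Matrix.mul_assoc, Matrix.add_mul]; abel]
    simp [h5, h2, matrix_add_self]
  · rw [show x.C * x.A + h * x.A * x.A + x.D * h * x.A +
      (x.D * x.C + x.D * (h * x.A) + x.D * (x.D * h)) =
      (x.C * x.A + x.D * x.C) + h * (x.A * x.A) + x.D * x.D * h +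
      (x.D * (h * x.A) + x.D * (h * x.A)) by
        simp only [Matrix.mul_assoc]; abel]
    simp [h1, h3, h4, matrix_add_self]

theorem uniF_mem_sqZero (h : Matrix U W k) {x : Tup k U W} (hx : x ∈ sqZero k U W) :
    uniF h x ∈ sqZero k U W := by
  obtain ⟨h1, h2, h3, h4, h5⟩ := hx
  refine ⟨h1, ?_, h3, h4, ?_⟩ <;>
  simp only [uniF, Matrix.mul_add, Matrix.add_mul]
  · rw [show x.A * x.B + x.A * (h * x.C) + (x.B * x.A + h * x.C * x.A) +
      (x.F * x.C + x.A * h * x.C + h * x.D * x.C) =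
      (x.A * x.B + x.B * x.A + x.F * x.C) + h * (x.C * x.A + x.D * x.C) +
      (x.A * (h * x.C) + x.A * (h * x.C)) by
        simp only [Matrix.mul_assoc, Matrix.mul_add]; abel]
    simp [h3, h2, matrix_add_self]
  · rw [show x.A * x.F + x.A * (x.A * h) + x.A * (h * x.D) +
      (x.F * x.D + x.A * h * x.D + h * x.D * x.D) =
      (x.A * x.F + x.F * x.D) + x.A * x.A * h + h * (x.D * x.D) +
      (x.A * (h * x.D) + x.A * (h * x.D)) by
        simp only [Matrix.mul_assoc]; abel]
    simp [h1, h5, h4, matrix_add_self]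

/-- If `x` and `y` have square zero and commute, then so has every element of the line
through `x` in the direction `y`. -/
theorem add_smul_mem_sqZero {x y : Tup k U W} (hx : x ∈ sqZero k U W) (hy : y ∈ sqZero k U W)
    (hA : x.A * y.A + y.A * x.A = 0)
    (hB : x.A * y.B + x.B * y.A + x.F * y.C + (y.A * x.B + y.B * x.A + y.F * x.C) = 0)
    (hC : x.C * y.A + x.D * y.C + (y.C * x.A + y.D * x.C) = 0)
    (hD : x.D * y.D + y.D * x.D = 0)
    (hF : x.A * y.F + x.F * y.D + (y.A * x.F + y.F * x.D) = 0) (c : k) :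
    x + c • y ∈ sqZero k U W := by
  obtain ⟨h1, h2, h3, h4, h5⟩ := hx
  obtain ⟨g1, g2, g3, g4, g5⟩ := hy
  have key : ∀ {l m n : Type} [Fintype m] (M M' : Matrix l m k) (N N' : Matrix m n k),
      (M + c • M') * (N + c • N') = M * N + c • (M * N' + M' * N) + (c * c) • (M' * N') := by
    intro l m n _ M M' N N'
    simp [Matrix.mul_add, Matrix.add_mul, smul_smul]
    abel
  refine ⟨?_, ?_, ?_, ?_, ?_⟩ <;>
  simp only [add_A, add_B, add_C, add_D, add_F, smul_A, smul_B, smul_C, smul_D, smul_F, key]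
  · simp [h1, g1, hA]
  · trans (x.A * x.B + x.B * x.A + x.F * x.C) + c • (x.A * y.B + x.B * y.A + x.F * y.C +
      (y.A * x.B + y.B * x.A + y.F * x.C)) + (c * c) • (y.A * y.B + y.B * y.A + y.F * y.C)
    · simp only [smul_add]
      abel
    · simp [h2, g2, hB]
  · trans (x.C * x.A + x.D * x.C) + c • (x.C * y.A + x.D * y.C + (y.C * x.A + y.D * x.C)) +
      (c * c) • (y.C * y.A + y.D * y.C)
    · simp only [smul_add]
      abel
    · simp [h3, g3, hC]
  · simp [h4, g4, hD]
  · trans (x.A * x.F + x.F * x.D) + c • (x.A * y.F + x.F * y.D + (y.A * x.F + y.F * x.D)) +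
      (c * c) • (y.A * y.F + y.F * y.D)
    · simp only [smul_add]
      abel
    · simp [h5, g5, hF]

end Unipotent

end Tup

/-! ### Normal form of matrices of square zero -/

/-- The square-zero matrix with `r` Jordan blocks of size two and `a` blocks of size one, the basis
being ordered as: vectors in the image, their preimages, remaining kernel vectors. -/
def sqNormal (k : Type*) [Field k] (r a : ℕ) :
    Matrix (Fin r ⊕ Fin r ⊕ Fin a) (Fin r ⊕ Fin r ⊕ Fin a) k :=
  blk3 0 1 0 0 0 0 0 0 0

section NormalForm

variable {k : Type*} {U : Type} [Field k]

theorem sqNormal_mul_self (r a : ℕ) : sqNormal k r a * sqNormal k r a = 0 := by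
  simp [sqNormal, blk3_mul, blk3_zero]

/-- A basis in which `f` has its Jordan normal form is obtained from a complement of the kernel, its
image, and a complement of the range within the kernel. -/
theorem exists_basis_of_sq_zero {V : Type*} [AddCommGroup V] [Module k V] [FiniteDimensional k V]
    (f : V →ₗ[k] V) (hf : ∀ v, f (f v) = 0) :
    ∃ (r a : ℕ) (b : Module.Basis (Fin r ⊕ Fin r ⊕ Fin a) k V), (∀ j, f (b (.inl j)) = 0) ∧
      (∀ j, f (b (.inr (.inl j))) = b (.inl j)) ∧ ∀ j, f (b (.inr (.inr j))) = 0 := by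
  obtain ⟨C, hC⟩ := Submodule.exists_isCompl (LinearMap.ker f)
  obtain ⟨H₀, hH₀⟩ := Submodule.exists_isCompl (LinearMap.range f)
  have hle : LinearMap.range f ≤ LinearMap.ker f := by
    rintro _ ⟨v, rfl⟩
    exact hf v
  let H := H₀ ⊓ LinearMap.ker f
  have hsup : LinearMap.range f ⊔ H = LinearMap.ker f := by
    rw [← sup_inf_assoc_of_le _ hle, hH₀.sup_eq_top, top_inf_eq]
  let e : (C × C × H) →ₗ[k] V := (f ∘ₗ C.subtype).coprod (C.subtype.coprod H.subtype)
  have he : ∀ x, e x = f x.1 + (x.2.1 + x.2.2) := fun x => rfl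
  have hCker : ∀ c : C, f c = 0 → c = 0 := fun c hc => by
    have : (c : V) ∈ LinearMap.ker f ⊓ C := ⟨hc, c.2⟩
    rw [hC.inf_eq_bot] at this
    exact Subtype.ext this
  have hinj : Function.Injective e := by
    rw [injective_iff_map_eq_zero]
    rintro ⟨c₁, c₂, h⟩ h0
    rw [he] at h0
    have hh : f (h : V) = 0 := h.2.2
    have hc₂ : c₂ = 0 := hCker _ (by simpa [hf, hh] using congrArg f h0)
    subst hc₂
    have hmem : (h : V) ∈ LinearMap.range f ⊓ H₀ := by
      refine ⟨⟨-c₁, ?_⟩, h.2.1⟩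
      rw [map_neg, neg_eq_iff_add_eq_zero]
      simpa using h0
    rw [hH₀.inf_eq_bot] at hmem
    have hh0 : h = 0 := Subtype.ext hmem
    subst hh0
    have hc₁ : c₁ = 0 := hCker _ (by simpa using h0)
    subst hc₁
    rfl
  have hsurj : Function.Surjective e := fun v => by
    obtain ⟨x, hx, c, hc, rfl⟩ := Submodule.mem_sup.1 (hC.sup_eq_top ▸ Submodule.mem_top (x := v))
    rw [← hsup] at hx
    obtain ⟨_, ⟨w, rfl⟩, h, hh, rfl⟩ := Submodule.mem_sup.1 hx
    obtain ⟨x', hx', c', hc', rfl⟩ :=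
      Submodule.mem_sup.1 (hC.sup_eq_top ▸ Submodule.mem_top (x := w))
    refine ⟨(⟨c', hc'⟩, ⟨c, hc⟩, ⟨h, hh⟩), ?_⟩
    rw [he, map_add, show f x' = 0 from hx']
    simp only
    abel
  let E := LinearEquiv.ofBijective e ⟨hinj, hsurj⟩
  have hE : ∀ x, E x = f x.1 + (x.2.1 + x.2.2) := fun x => rfl
  refine ⟨_, _, ((Module.finBasis k C).prod ((Module.finBasis k C).prod
    (Module.finBasis k H))).map E, fun j => ?_, fun j => ?_, fun j => ?_⟩
  · simp [hE, hf]
  · simp [hE]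
  · simpa [hE] using (Module.finBasis k H j).2.2

theorem exists_eq_sqNormal [Fintype U] [DecidableEq U] (A : Matrix U U k) (hA : A * A = 0) :
    ∃ (r a : ℕ) (p : Matrix U (Fin r ⊕ Fin r ⊕ Fin a) k)
      (p' : Matrix (Fin r ⊕ Fin r ⊕ Fin a) U k), p * p' = 1 ∧ p' * p = 1 ∧
      A = p * sqNormal k r a * p' ∧ Fintype.card U = 2 * r + a := by
  obtain ⟨r, a, b, h1, h2, h3⟩ := exists_basis_of_sq_zero (Matrix.mulVecLin A) fun v => by
    simp [hA]
  have hpp : (Pi.basisFun k U).toMatrix b * b.toMatrix (Pi.basisFun k U) = 1 :=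
    Module.Basis.toMatrix_mul_toMatrix_flip ..
  refine ⟨r, a, (Pi.basisFun k U).toMatrix b, b.toMatrix (Pi.basisFun k U), hpp,
    Module.Basis.toMatrix_mul_toMatrix_flip .., ?_, ?_⟩
  · have : A * (Pi.basisFun k U).toMatrix b = (Pi.basisFun k U).toMatrix b * sqNormal k r a := by
      ext i j
      have hl : (A * (Pi.basisFun k U).toMatrix b) i j = Matrix.mulVecLin A (b j) i := by
        simp [Matrix.mul_apply, Matrix.mulVec, dotProduct, Module.Basis.toMatrix_apply]
      rw [hl]
      rcases j with j | j | j
      · simp [h1, sqNormal, blk3, Matrix.mul_apply]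
      · simp [h2, sqNormal, blk3, Matrix.mul_apply, Module.Basis.toMatrix_apply,
          Matrix.one_apply]
      · simp [h3, sqNormal, blk3, Matrix.mul_apply]
    rw [← this, Matrix.mul_assoc, hpp, Matrix.mul_one]
  · have := Module.finrank_eq_card_basis b
    simp only [Module.finrank_fintype_fun_eq_card, Fintype.card_sum, Fintype.card_fin] at this
    omega

variable [CharP k 2] {r a s b : ℕ}

theorem matrix_eq_of_add_eq_zero {m n : Type*} {M N : Matrix m n k} (h : M + N = 0) : M = N := by
  ext i j
  exact CharTwo.add_eq_zero.1 (congrFun (congrFun h i) j)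

/-- The shape of the matrices intertwining two normal forms. -/
theorem exists_eq_of_intertwine {K : Matrix (Fin s ⊕ Fin s ⊕ Fin b) (Fin r ⊕ Fin r ⊕ Fin a) k}
    (h : sqNormal k s b * K + K * sqNormal k r a = 0) :
    ∃ k₁₁ k₁₂ k₁₃ k₃₂ k₃₃, K = blk3 k₁₁ k₁₂ k₁₃ 0 k₁₁ 0 0 k₃₂ k₃₃ := by
  obtain ⟨k₁₁, k₁₂, k₁₃, k₂₁, k₂₂, k₂₃, k₃₁, k₃₂, k₃₃, rfl⟩ := exists_eq_blk3 K
  simp only [sqNormal, blk3_mul, Matrix.zero_mul, Matrix.mul_zero, Matrix.one_mul, Matrix.mul_one,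
    add_zero, zero_add, blk3_add, blk3_zero, blk3_inj, true_and, and_true] at h
  obtain ⟨h1, h2, h3, h4, h5⟩ := h
  have h2 := matrix_eq_of_add_eq_zero h2
  exact ⟨k₁₁, k₁₂, k₁₃, k₃₂, k₃₃, by rw [h1, h2, h3, h5]⟩

theorem intertwine_blk3 (k₁₁ : Matrix (Fin s) (Fin r) k) (k₁₂ : Matrix (Fin s) (Fin r) k)
    (k₁₃ : Matrix (Fin s) (Fin a) k) (k₃₂ : Matrix (Fin b) (Fin r) k)
    (k₃₃ : Matrix (Fin b) (Fin a) k) :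
    sqNormal k s b * blk3 k₁₁ k₁₂ k₁₃ 0 k₁₁ 0 0 k₃₂ k₃₃ +
      blk3 k₁₁ k₁₂ k₁₃ 0 k₁₁ 0 0 k₃₂ k₃₃ * sqNormal k r a = 0 := by
  simp [sqNormal, blk3_mul, blk3_zero, Tup.matrix_add_self]

/-- Regard square-zero matrices as differentials. In characteristic two the intertwining matrices
are then the chain maps, and each of them is homotopic to its block on homology, the third of the
three summands. -/
theorem exists_homotopy {K : Matrix (Fin s ⊕ Fin s ⊕ Fin b) (Fin r ⊕ Fin r ⊕ Fin a) k}
    (h : sqNormal k s b * K + K * sqNormal k r a = 0) :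
    ∃ (L : Matrix (Fin s ⊕ Fin s ⊕ Fin b) (Fin r ⊕ Fin r ⊕ Fin a) k)
      (k₃₃ : Matrix (Fin b) (Fin a) k),
      K + sqNormal k s b * L + L * sqNormal k r a = blk3 0 0 0 0 0 0 0 0 k₃₃ := by
  obtain ⟨k₁₁, k₁₂, k₁₃, k₃₂, k₃₃, rfl⟩ := exists_eq_of_intertwine h
  refine ⟨blk3 0 0 0 k₁₁ k₁₂ k₁₃ k₃₂ 0 0, k₃₃, ?_⟩
  simp [sqNormal, blk3_mul, blk3_add, Tup.matrix_add_self]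

end NormalForm

/-! ### Deforming points whose `D`-component has small rank -/

section Krylov

variable {k V W : Type*} [Field k] [AddCommGroup V] [Module k V] [AddCommGroup W] [Module k W]
  {β : V →ₗ[k] V} {f : W →ₗ[k] V}

/-- The span of the images of `f`, `β f`, …, `β ^ (m - 1) f`, called Krylov space in control
theory. -/
def krylov (β : V →ₗ[k] V) (f : W →ₗ[k] V) (m : ℕ) : Submodule k V :=
  (Finset.range m).sup fun l => LinearMap.range ((β ^ l) ∘ₗ f)

theorem krylov_succ (m : ℕ) :
    krylov β f (m + 1) = krylov β f m ⊔ LinearMap.range ((β ^ m) ∘ₗ f) := by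
  rw [krylov, Finset.range_add_one, Finset.sup_insert, sup_comm, krylov]

theorem range_le_krylov {l m : ℕ} (h : l < m) : LinearMap.range ((β ^ l) ∘ₗ f) ≤ krylov β f m :=
  Finset.le_sup (f := fun l => LinearMap.range ((β ^ l) ∘ₗ f)) (Finset.mem_range.2 h)

/-- If `β ^ m v` lies in the `m`-th Krylov space, then `v` can be driven to zero in `m` steps of
the control system `u ↦ β u + f w`. -/
theorem exists_control_of_mem_krylov (m : ℕ) (v : V) (h : (β ^ m) v ∈ krylov β f m) :
    ∃ (u : ℕ → V) (w : ℕ → W), u 0 = v ∧ (∀ l < m, u (l + 1) = β (u l) + f (w l)) ∧ u m = 0 := by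
  induction m generalizing v with
  | zero => exact ⟨fun _ => v, fun _ => 0, rfl, by simp, by simpa [krylov] using h⟩
  | succ m ih =>
    rw [krylov_succ] at h
    obtain ⟨y, hy, _, ⟨w, rfl⟩, h⟩ := Submodule.mem_sup.1 h
    obtain ⟨u', w', h0, hs, he⟩ := ih (β v - f w) (by
      rw [map_sub, ← Module.End.mul_apply, ← pow_succ, ← h]
      simpa using hy)
    refine ⟨fun l => l.casesOn v u', fun l => l.casesOn (-w) w', rfl, ?_, he⟩
    rintro (_ | l) hl
    · simp [h0, sub_eq_add_neg]
    · exact hs l (by omega)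

variable [FiniteDimensional k V]

/-- A chain of vectors `u l`, driven by controls `w l`, which starts and ends at zero, together
with a chain of linear forms `τ l` on which `β` acts as a shift. The linear form `τ j` vanishes on a
Krylov space but not on the next one, where `j` is the step at which the Krylov spaces become
stationary; the chain of vectors exists because they are stationary from then on. -/
theorem exists_chains (hf : f ≠ 0) (hW : 2 ≤ Module.finrank k W) :
    ∃ (j : ℕ) (u : ℕ → V) (w : ℕ → W) (τ : ℕ → Module.Dual k V),
      u 0 = 0 ∧ (∀ l ≤ j, u (l + 1) = β (u l) + f (w l)) ∧ u (j + 1) = 0 ∧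
      (∀ l < j, τ (l + 1) ∘ₗ β = τ l) ∧ (∀ l, 1 ≤ l → l < j → τ (l + 1) ∘ₗ f = 0) ∧
      1 ≤ j ∧ τ 1 ∘ₗ f ≠ 0 ∧ w 0 ≠ 0 ∧ τ 1 (f (w 0)) = 0 := by
  classical
  have hmono : Monotone (krylov β f) := monotone_nat_of_le_succ fun m => by
    rw [krylov_succ]; exact le_sup_left
  have hex : ∃ j, krylov β f (j + 1) = krylov β f j := by
    obtain ⟨n, hn⟩ := monotone_stabilizes_iff_noetherian.2
      (inferInstance : IsNoetherian k V) ⟨krylov β f, hmono⟩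
    exact ⟨n, (hn (n + 1) n.le_succ).symm⟩
  have hj := Nat.find_spec hex
  rcases hj' : Nat.find hex with _ | i
  · rw [hj', krylov_succ] at hj
    simp [krylov, Module.End.one_eq_id] at hj
    exact absurd (LinearMap.range_eq_bot.1 hj) hf
  rw [hj'] at hj
  have hi : krylov β f (i + 1) ≠ krylov β f i := Nat.find_min hex (by omega)
  obtain ⟨v, hv, hv'⟩ := Set.exists_of_ssubset ((hmono i.le_succ).lt_of_ne hi.symm)
  obtain ⟨σ, hσv, hσ⟩ := Submodule.exists_le_ker_of_notMem hv'
  have hκ : σ ∘ₗ (β ^ i) ∘ₗ f ≠ 0 := fun h0 => hσv <| by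
    have hle : krylov β f (i + 1) ≤ LinearMap.ker σ := by
      rw [krylov_succ]
      refine sup_le hσ ?_
      rintro _ ⟨w, rfl⟩
      exact LinearMap.congr_fun h0 w
    exact hle hv
  have hker : LinearMap.ker (σ ∘ₗ (β ^ i) ∘ₗ f) ≠ ⊥ := fun h => by
    have := LinearMap.finrank_le_finrank_of_injective (LinearMap.ker_eq_bot.1 h)
    rw [Module.finrank_self] at this
    omega
  obtain ⟨w₀, hw₀, hw₀'⟩ := Submodule.exists_mem_ne_zero_of_ne_bot hker
  obtain ⟨u, w, h0, hs, he⟩ := exists_control_of_mem_krylov (β := β) (f := f) (i + 1) (f w₀) (by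
    rw [← hj]
    exact range_le_krylov (Nat.lt_succ_self _) ⟨w₀, rfl⟩)
  refine ⟨i + 1, fun l => l.casesOn 0 u, fun l => l.casesOn w₀ w, fun l => σ ∘ₗ (β ^ (i + 1 - l)),
    rfl, ?_, he, ?_, ?_, by omega, by simpa [LinearMap.comp_assoc] using hκ, hw₀',
    by simpa using hw₀⟩
  · rintro (_ | l) hl
    · simp [h0]
    · exact hs l (by omega)
  · intro l hl
    rw [LinearMap.comp_assoc, ← Module.End.mul_eq_comp (β ^ _), ← pow_succ]
    congr 2
    omega
  · intro l h1 hl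
    ext w
    exact hσ (range_le_krylov (show i + 1 - (l + 1) < i by omega) ⟨w, rfl⟩)

/-- On `V ⊕ W` there is a square-zero map with blocks `A'`, `C'`, `D'` that intertwines `f` strictly
and commutes with `β` up to the term `f C'`, and whose block `D'` is not zero. Its blocks are sums
of the rank one maps made of a chain of vectors and a chain of linear forms. -/
theorem exists_square_zero_endomorphism [CharP k 2] (hf : f ≠ 0) (hW : 2 ≤ Module.finrank k W) :
    ∃ (A' : V →ₗ[k] V) (C' : V →ₗ[k] W) (D' : W →ₗ[k] W), A' ∘ₗ A' = 0 ∧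
      C' ∘ₗ A' + D' ∘ₗ C' = 0 ∧ D' ∘ₗ D' = 0 ∧ f ∘ₗ D' + A' ∘ₗ f = 0 ∧
      A' ∘ₗ β + β ∘ₗ A' + f ∘ₗ C' = 0 ∧ D' ≠ 0 := by
  obtain ⟨j, u, w, τ, hu0, hu, huj, hτ, hτf, hj, hκ, hw0, hκw⟩ :=
    exists_chains (β := β) hf hW
  have hτβ : ∀ l < j, ∀ v, τ (l + 1) (β v) = τ l v := fun l hl v => LinearMap.congr_fun (hτ l hl) v
  have hτf' : ∀ l, 1 ≤ l → l < j → ∀ v, τ (l + 1) (f v) = 0 := fun l h1 hl v =>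
    LinearMap.congr_fun (hτf l h1 hl) v
  have two : ∀ v : V, v + v = 0 := fun v => by
    rw [← two_smul k, CharTwo.two_eq_zero, zero_smul]
  -- The pairing of the two chains vanishes along each diagonal.
  have ha : ∀ m l, m ≤ l → 1 ≤ l → l ≤ j → τ l (u m) = 0 := by
    intro m
    induction m with
    | zero => intros; rw [hu0, map_zero]
    | succ m ih =>
      rintro (_ | _ | l) hml h1 hl
      · omega
      · obtain rfl : m = 0 := by omega
        rw [hu 0 (by omega), hu0, map_zero]
        simpa using hκw
      · rw [hu m (by omega), map_add, hτβ _ (by omega), hτf' _ (by omega) (by omega),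
          ih (l + 1) (by omega) (by omega) (by omega), zero_add]
  have hb : ∀ d m l, m + d = j + 1 → l < m → 1 ≤ l → τ l (u m) = 0 := by
    intro d
    induction d with
    | zero => rintro m l rfl - -; rw [huj, map_zero]
    | succ d ih =>
      intro m l hm hl h1
      have := ih (m + 1) (l + 1) (by omega) (by omega) (by omega)
      rwa [hu m (by omega), map_add, hτβ _ (by omega), hτf' _ h1 (by omega), add_zero] at this
  have hpair : ∀ m ≤ j + 1, ∀ l, 1 ≤ l → l ≤ j → τ l (u m) = 0 := fun m hm l h1 hl => by
    rcases le_or_gt m l with h | h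
    · exact ha m l h h1 hl
    · exact hb (j + 1 - m) m l (by omega) h h1
  have hpair0 : ∀ m ≤ j, τ 0 (u m) + τ 1 (f (w m)) = 0 := fun m hm => by
    rw [← hτβ 0 (by omega), ← map_add, ← hu m hm]
    exact hpair _ (by omega) _ (by omega) (by omega)
  let A' : V →ₗ[k] V := ∑ l ∈ Finset.range (j + 1), (τ l).smulRight (u l)
  let C' : V →ₗ[k] W := ∑ l ∈ Finset.range (j + 1), (τ l).smulRight (w l)
  let D' : W →ₗ[k] W := (τ 1 ∘ₗ f).smulRight (w 0)
  have hA' : ∀ v, A' v = ∑ l ∈ Finset.range (j + 1), τ l v • u l := fun v => by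
    simp [A', LinearMap.sum_apply]
  have hC' : ∀ v, C' v = ∑ l ∈ Finset.range (j + 1), τ l v • w l := fun v => by
    simp [C', LinearMap.sum_apply]
  have hD' : ∀ v, D' v = τ 1 (f v) • w 0 := fun v => rfl
  have hτA : ∀ v l, 1 ≤ l → l ≤ j → τ l (A' v) = 0 := fun v l h1 hl => by
    rw [hA', map_sum]
    refine Finset.sum_eq_zero fun m hm => ?_
    rw [map_smul, hpair m (by have := Finset.mem_range.1 hm; omega) l h1 hl, smul_zero]
  refine ⟨A', C', D', ?_, ?_, ?_, ?_, ?_, ?_⟩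
  · ext v
    simp only [LinearMap.comp_apply, LinearMap.zero_apply]
    rw [hA' (A' v), Finset.sum_range_succ', hu0, smul_zero, add_zero]
    refine Finset.sum_eq_zero fun l hl => ?_
    rw [hτA _ _ (by omega) (by have := Finset.mem_range.1 hl; omega), zero_smul]
  · ext v
    simp only [LinearMap.comp_apply, LinearMap.add_apply, LinearMap.zero_apply]
    rw [hC' (A' v), Finset.sum_range_succ', Finset.sum_eq_zero, zero_add, hD', ← add_smul, hC' v,
      hA' v, map_sum, map_sum, map_sum, ← Finset.sum_add_distrib, Finset.sum_eq_zero, zero_smul]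
    · intro m hm
      rw [map_smul, map_smul, map_smul, ← smul_add,
        hpair0 m (by have := Finset.mem_range.1 hm; omega), smul_zero]
    · intro l hl
      rw [hτA _ _ (by omega) (by have := Finset.mem_range.1 hl; omega), zero_smul]
  · ext v
    simp [hD', hκw]
  · ext v
    simp only [LinearMap.comp_apply, LinearMap.add_apply, LinearMap.zero_apply]
    obtain ⟨i, rfl⟩ : ∃ i, j = i + 1 := ⟨j - 1, by omega⟩
    rw [hA' (f v), Finset.sum_range_succ', hu0, smul_zero, add_zero, Finset.sum_range_succ',
      Finset.sum_eq_zero, zero_add, hD', map_smul, hu 0 (by omega), hu0, map_zero]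
    · simp [two]
    intro l hl
    rw [hτf' _ (by omega) (by have := Finset.mem_range.1 hl; omega), zero_smul]
  · ext v
    simp only [LinearMap.comp_apply, LinearMap.add_apply, LinearMap.zero_apply]
    rw [hA' v, hC' v, map_sum, map_sum, add_assoc, ← Finset.sum_add_distrib,
      Finset.sum_range_succ, hA' (β v), Finset.sum_range_succ', hu0, smul_zero, add_zero,
      map_smul, map_smul, ← smul_add, ← hu j le_rfl, huj, smul_zero, add_zero,
      ← Finset.sum_add_distrib]
    refine Finset.sum_eq_zero fun l hl => ?_
    have hl := Finset.mem_range.1 hl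
    rw [hτβ l hl, map_smul, map_smul, ← smul_add, ← hu l hl.le, two]
  · intro h
    obtain ⟨v, hv⟩ : ∃ v, τ 1 (f v) ≠ 0 := by
      by_contra! hcon
      exact hκ (LinearMap.ext hcon)
    exact smul_ne_zero hv hw0 (LinearMap.congr_fun h v)

end Krylov

section Deformation

variable {k : Type*} [Field k] [CharP k 2]

theorem exists_square_zero_endomorphism_matrix {a b : ℕ} (hb : 2 ≤ b)
    (β : Matrix (Fin a) (Fin a) k) (f : Matrix (Fin a) (Fin b) k) (hf : f ≠ 0) :
    ∃ (A' : Matrix (Fin a) (Fin a) k) (C' : Matrix (Fin b) (Fin a) k)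
      (D' : Matrix (Fin b) (Fin b) k), A' * A' = 0 ∧ C' * A' + D' * C' = 0 ∧ D' * D' = 0 ∧
      f * D' + A' * f = 0 ∧ A' * β + β * A' + f * C' = 0 ∧ D' ≠ 0 := by
  obtain ⟨A', C', D', h1, h2, h3, h4, h5, h6⟩ := exists_square_zero_endomorphism
    (β := Matrix.toLin' β) (f := Matrix.toLin' f) (by simpa using hf) (by simpa using hb)
  have e := fun {m n : ℕ} {g : (Fin m → k) →ₗ[k] (Fin n → k)} (h : g = 0) =>
    congrArg LinearMap.toMatrix' h
  refine ⟨LinearMap.toMatrix' A', LinearMap.toMatrix' C', LinearMap.toMatrix' D',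
    by simpa [LinearMap.toMatrix'_comp] using e h1, by simpa [LinearMap.toMatrix'_comp] using e h2,
    by simpa [LinearMap.toMatrix'_comp] using e h3, by simpa [LinearMap.toMatrix'_comp] using e h4,
    by simpa [LinearMap.toMatrix'_comp] using e h5, by simpa using h6⟩

/-- The case `A = 0`, `D = 0` of the deformation: for all `β`, `c`, `f` with `f c = 0` on spaces of
dimension `a` and `b ≥ 2` there is a square-zero tuple commuting with `(0, β, c, 0, f)` whose
`D`-component is not zero. The cases `c = 0` and `f = 0` are dual to each other. -/
theorem exists_commuting_square_zero {a b : ℕ} (hb : 2 ≤ b) (β : Matrix (Fin a) (Fin a) k)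
    (c : Matrix (Fin b) (Fin a) k) (f : Matrix (Fin a) (Fin b) k) (hfc : f * c = 0) :
    ∃ (A' : Matrix (Fin a) (Fin a) k) (C' : Matrix (Fin b) (Fin a) k)
      (D' : Matrix (Fin b) (Fin b) k) (F' : Matrix (Fin a) (Fin b) k),
      A' * A' = 0 ∧ C' * A' + D' * C' = 0 ∧ D' * D' = 0 ∧ A' * F' + F' * D' = 0 ∧ F' * C' = 0 ∧
      c * A' + D' * c = 0 ∧ f * D' + A' * f = 0 ∧ A' * β + β * A' + f * C' + F' * c = 0 ∧
      D' ≠ 0 := by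
  by_cases hc : c = 0
  · subst hc
    by_cases hf : f = 0
    · subst hf
      refine ⟨0, 0, Matrix.single ⟨0, by omega⟩ ⟨1, by omega⟩ 1, 0, by simp, by simp, ?_, by simp,
        by simp, by simp, by simp, by simp, ?_⟩
      · rw [Matrix.single_mul_single_of_ne]
        simp
      · intro h
        simpa using congrFun (congrFun h ⟨0, by omega⟩) ⟨1, by omega⟩
    · obtain ⟨A', C', D', h1, h2, h3, h4, h5, h6⟩ :=
        exists_square_zero_endomorphism_matrix hb β f hf
      exact ⟨A', C', D', 0, h1, h2, h3, by simp, by simp, by simp, h4, by simpa using h5, h6⟩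
  · by_cases hf : f = 0
    · subst hf
      obtain ⟨A', C', D', h1, h2, h3, h4, h5, h6⟩ :=
        exists_square_zero_endomorphism_matrix hb β.transpose c.transpose (by simpa using hc)
      have t := fun {m n : ℕ} {M : Matrix (Fin m) (Fin n) k} (h : M = 0) =>
        congrArg Matrix.transpose h
      refine ⟨A'.transpose, 0, D'.transpose, C'.transpose, by simpa using t h1, by simp,
        by simpa using t h3, by simpa using t h2, by simp, ?_, by simp, ?_, by simpa using h6⟩
      · simpa [add_comm] using t h4
      · simpa [add_comm, add_left_comm] using t h5
    · obtain ⟨p, j, hpj⟩ : ∃ p j, c p j ≠ 0 := by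
        by_contra! h
        exact hc (Matrix.ext h)
      obtain ⟨i, q, hiq⟩ : ∃ i q, f i q ≠ 0 := by
        by_contra! h
        exact hf (Matrix.ext h)
      -- A rank one matrix with image in that of `c` and kernel containing that of `f`.
      refine ⟨0, 0, c * Matrix.single j i (1 : k) * f, 0, by simp, by simp, ?_, by simp, by simp,
        ?_, ?_, by simp, fun h => ?_⟩
      · rw [Matrix.mul_assoc, ← Matrix.mul_assoc f, ← Matrix.mul_assoc f, hfc]
        simp
      · rw [Matrix.mul_assoc _ f, hfc]
        simp
      · rw [← Matrix.mul_assoc, ← Matrix.mul_assoc, hfc]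
        simp
      · have := congrFun (congrFun h p) q
        simp [Matrix.mul_apply, Matrix.single_apply, ite_and, hpj, hiq] at this

theorem rank_sqNormal_lt {s b : ℕ} {D' : Matrix (Fin b) (Fin b) k} (hD' : D' ≠ 0) {c : k}
    (hc : c ≠ 0) : (sqNormal k s b).rank <
      (sqNormal k s b + c • blk3 0 0 0 0 0 0 0 0 D').rank := by
  set M := sqNormal k s b + c • blk3 0 0 0 0 0 0 0 0 D' with hM
  have hP : blk3 1 0 0 0 1 0 0 0 0 * M = sqNormal k s b := by
    simp [hM, sqNormal, blk3_smul, blk3_add, blk3_mul]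
  have hlt : LinearMap.ker M.mulVecLin < LinearMap.ker (sqNormal k s b).mulVecLin := by
    refine lt_of_le_of_ne ?_ fun heq => ?_
    · rw [← hP, Matrix.mulVecLin_mul]
      exact LinearMap.ker_le_ker_comp _ _
    · have hzero : ∀ v, M.mulVec (Sum.elim (fun _ => (0 : k))
          (Sum.elim (fun _ => (0 : k)) v)) = 0 := fun v => by
        have : Sum.elim (fun _ => (0 : k)) (Sum.elim (fun _ => (0 : k)) v) ∈
            LinearMap.ker (sqNormal k s b).mulVecLin := by
          ext (i | i | i) <;> simp [sqNormal, blk3, Matrix.mulVec, dotProduct]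
        rwa [← heq] at this
      refine hD' ?_
      ext i j
      have := congrFun (hzero (Pi.single j 1)) (.inr (.inr i))
      simpa [hM, sqNormal, blk3, Matrix.mulVec, dotProduct, hc, Pi.single_apply] using this
  have h1 := Submodule.finrank_lt_finrank_of_lt hlt
  have h2 := LinearMap.finrank_range_add_finrank_ker M.mulVecLin
  have h3 := LinearMap.finrank_range_add_finrank_ker (sqNormal k s b).mulVecLin
  rw [Matrix.rank, Matrix.rank]
  omega

/-- A square-zero tuple with components `A` and `D` in normal form, the homology of `D` having
dimension at least two, lies on a line of square-zero tuples at all other points of which the rank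
of `D` is larger. -/
theorem exists_line_of_normal {r a s b : ℕ} (hb : 2 ≤ b)
    {x : Tup k (Fin r ⊕ Fin r ⊕ Fin a) (Fin s ⊕ Fin s ⊕ Fin b)} (hx : x ∈ Tup.sqZero k _ _)
    (hA : x.A = sqNormal k r a) (hD : x.D = sqNormal k s b) :
    ∃ y, (∀ c : k, x + c • y ∈ Tup.sqZero k _ _) ∧
      ∀ c : k, c ≠ 0 → x.D.rank < (x + c • y).D.rank := by
  -- Unipotent conjugations reduce `C`, `F` and `B` to their homology blocks.
  obtain ⟨L₁, c, hc⟩ := exists_homotopy (K := x.C) (s := s) (b := b) (r := r) (a := a) (by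
    rw [add_comm, ← hA, ← hD]; exact hx.2.2.1)
  set x₁ := Tup.uniC L₁ x with hx₁
  have hx₁m : x₁ ∈ Tup.sqZero k _ _ := Tup.uniC_mem_sqZero _ hx
  have hx₁C : x₁.C = blk3 0 0 0 0 0 0 0 0 c := by
    rw [← hc, hx₁, ← hA, ← hD]
    simp only [Tup.uniC]
    abel
  obtain ⟨L₂, f, hf⟩ := exists_homotopy (K := x.F) (s := r) (b := a) (r := s) (a := b) (by
    rw [← hA, ← hD]; exact hx.2.2.2.2)
  set x₂ := Tup.uniF L₂ x₁ with hx₂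
  have hx₂m : x₂ ∈ Tup.sqZero k _ _ := Tup.uniF_mem_sqZero _ hx₁m
  have hx₂A : x₂.A = sqNormal k r a := hA
  have hx₂D : x₂.D = sqNormal k s b := hD
  have hx₂C : x₂.C = blk3 0 0 0 0 0 0 0 0 c := hx₁C
  have hx₂F : x₂.F = blk3 0 0 0 0 0 0 0 0 f := by
    rw [← hf, ← hA, ← hD]
    rfl
  have hFC := hx₂m.2.1
  obtain ⟨b₁₁, b₁₂, b₁₃, b₂₁, b₂₂, b₂₃, b₃₁, b₃₂, b₃₃, hB⟩ := exists_eq_blk3 x₂.B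
  have hfc : f * c = 0 := by
    rw [hx₂A, hx₂C, hx₂F, hB] at hFC
    simp only [sqNormal, blk3_mul, blk3_add, blk3_zero, blk3_inj] at hFC
    simpa using hFC.2.2.2.2.2.2.2.2
  obtain ⟨L₃, β, hβ⟩ := exists_homotopy (K := x₂.B) (s := r) (b := a) (r := r) (a := a) (by
    rw [hx₂C, hx₂F, hx₂A] at hFC
    simpa [blk3_mul, hfc, ← blk3_zero] using hFC)
  set x₃ := Tup.uniB L₃ x₂ with hx₃
  have hx₃m : x₃ ∈ Tup.sqZero k _ _ := Tup.uniB_mem_sqZero _ hx₂m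
  have hx₃A : x₃.A = sqNormal k r a := hA
  have hx₃D : x₃.D = sqNormal k s b := hD
  have hx₃C : x₃.C = blk3 0 0 0 0 0 0 0 0 c := hx₂C
  have hx₃F : x₃.F = blk3 0 0 0 0 0 0 0 0 f := hx₂F
  have hx₃B : x₃.B = blk3 0 0 0 0 0 0 0 0 β := by
    rw [← hβ, ← hx₂A]
    rfl
  obtain ⟨A', C', D', F', h1, h2, h3, h4, h5, h6, h7, h8, h9⟩ :=
    exists_commuting_square_zero hb β c f hfc
  let y₃ : Tup k (Fin r ⊕ Fin r ⊕ Fin a) (Fin s ⊕ Fin s ⊕ Fin b) :=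
    ⟨blk3 0 0 0 0 0 0 0 0 A', 0, blk3 0 0 0 0 0 0 0 0 C', blk3 0 0 0 0 0 0 0 0 D',
      blk3 0 0 0 0 0 0 0 0 F'⟩
  have hy₃ : y₃ ∈ Tup.sqZero k _ _ := by
    refine ⟨?_, ?_, ?_, ?_, ?_⟩ <;>
      simp [y₃, blk3_mul, blk3_add, h1, h2, h3, h4, h5] <;> exact blk3_zero.symm
  have hline : ∀ t : k, x₃ + t • y₃ ∈ Tup.sqZero k _ _ := by
    refine Tup.add_smul_mem_sqZero hx₃m hy₃ ?_ ?_ ?_ ?_ ?_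
    all_goals
      simp only [hx₃A, hx₃B, hx₃C, hx₃D, hx₃F, y₃, sqNormal, blk3_mul, blk3_add, Matrix.mul_zero,
        Matrix.zero_mul, add_zero, zero_add]
      rw [blk3_zero]
    · congr 1
      rw [← h8]
      abel
    · rw [h6]
    · rw [← h7, add_comm]
  have hback : ∀ t : k, x + t • Tup.uniC L₁ (Tup.uniF L₂ (Tup.uniB L₃ y₃)) =
      Tup.uniC L₁ (Tup.uniF L₂ (Tup.uniB L₃ (x₃ + t • y₃))) := fun t => by
    rw [Tup.uniB_add_smul, Tup.uniF_add_smul, Tup.uniC_add_smul, hx₃, Tup.uniB_uniB, hx₂,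
      Tup.uniF_uniF, hx₁, Tup.uniC_uniC]
  refine ⟨Tup.uniC L₁ (Tup.uniF L₂ (Tup.uniB L₃ y₃)), fun t => ?_, fun t ht => ?_⟩
  · rw [hback]
    exact Tup.uniC_mem_sqZero _ (Tup.uniF_mem_sqZero _ (Tup.uniB_mem_sqZero _ (hline t)))
  · have : (x + t • Tup.uniC L₁ (Tup.uniF L₂ (Tup.uniB L₃ y₃))).D =
        sqNormal k s b + t • blk3 0 0 0 0 0 0 0 0 D' := by
      rw [← hD]
      rfl
    rw [this, hD]
    exact rank_sqNormal_lt h9 ht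

end Deformation

-- The parameter space of the chart is a product of many spaces of matrices, for which
-- instances are found only with these bounds.
set_option synthInstance.maxHeartbeats 400000
set_option synthInstance.maxSize 4096

/-! ### A rational chart on the strata -/

section RegularExtra

variable {k E E' F m n m' n' : Type*} [Field k] [AddCommGroup E] [Module k E] [AddCommGroup E']
  [Module k E'] [AddCommGroup F] [Module k F] {g : polyFun k F}

theorem IsRegularAway.fst {φ : F → E × E'} (hφ : IsRegularAway g φ) :
    IsRegularAway g fun t => (φ t).1 := hφ.linearMap_comp (LinearMap.fst k E E')

theorem IsRegularAway.snd {φ : F → E × E'} (hφ : IsRegularAway g φ) :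
    IsRegularAway g fun t => (φ t).2 := hφ.linearMap_comp (LinearMap.snd k E E')

theorem IsRegularAway.submatrix [Fintype m] [Fintype n] [Fintype m'] [Fintype n']
    {M : F → Matrix m n k} (hM : IsRegularAway g M) (i : m' → m) (j : n' → n) :
    IsRegularAway g fun t => (M t).submatrix i j := by
  rw [isRegularAway_matrix_iff] at *
  exact fun a b => hM (i a) (j b)

end RegularExtra

section Chart

variable (k : Type*) [Field k] (r a s b : ℕ)

/-- The embedding of the second of three summands. -/
abbrev emb₂ {α β γ : Type*} : β → α ⊕ β ⊕ γ := fun x => .inr (.inl x)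

/-- The embedding of the third of three summands. -/
abbrev emb₃ {α β γ : Type*} : γ → α ⊕ β ⊕ γ := fun x => .inr (.inr x)

/-- Parameters for the conjugates of the normal form `sqNormal k r a`: the matrices
`p₁₁`, `p₂₁`, `p₃₁`, `p₂₃` of `sliceMat`. -/
abbrev SliceParam : Type _ :=
  Matrix (Fin r) (Fin r) k × Matrix (Fin r) (Fin r) k × Matrix (Fin a) (Fin r) k ×
    Matrix (Fin r) (Fin a) k

/-- Parameters of the component `C`. -/
abbrev CParam : Type _ :=
  Matrix (Fin s) (Fin r) k × Matrix (Fin s) (Fin r) k × Matrix (Fin s) (Fin a) k ×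
    Matrix (Fin b) (Fin r) k × Matrix (Fin b) (Fin a) k

/-- Parameters of the component `F`. -/
abbrev FParam : Type _ :=
  Matrix (Fin r) (Fin s) k × Matrix (Fin r) (Fin s) k × Matrix (Fin r) (Fin b) k ×
    Matrix (Fin a) (Fin s) k

/-- Parameters of the component `B`. -/
abbrev BParam : Type _ :=
  Matrix (Fin r) (Fin r) k × Matrix (Fin r) (Fin r) k × Matrix (Fin r) (Fin a) k ×
    Matrix (Fin a) (Fin r) k × Matrix (Fin a) (Fin a) k

/-- The parameter space of the chart. -/
abbrev ChartParam : Type _ :=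
  SliceParam k r a × SliceParam k s b × CParam k r a s b × FParam k r a s b × BParam k r a

theorem finrank_chartParam : Module.finrank k (ChartParam k r a s b) =
    4 * r ^ 2 + 4 * r * a + a ^ 2 + 2 * s ^ 2 + 2 * s * b + 2 * r * b + a * b + 4 * r * s +
      2 * a * s := by
  simp only [Module.finrank_prod, Module.finrank_matrix, Module.finrank_self, Fintype.card_fin]
  ring

variable {k r a s b}

/-- The base change with the given slice parameters. Up to the centralizer of `sqNormal k r a`,
the general base change has this form. -/
def sliceMat (v : SliceParam k r a) :
    Matrix (Fin r ⊕ Fin r ⊕ Fin a) (Fin r ⊕ Fin r ⊕ Fin a) k :=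
  blk3 v.1 0 0 v.2.1 1 v.2.2.2 v.2.2.1 0 1

/-- The inverse of `sliceMat v`, in characteristic two. -/
noncomputable def sliceInv (v : SliceParam k r a) :
    Matrix (Fin r ⊕ Fin r ⊕ Fin a) (Fin r ⊕ Fin r ⊕ Fin a) k :=
  blk3 v.1⁻¹ 0 0 ((v.2.2.2 * v.2.2.1 + v.2.1) * v.1⁻¹) 1 v.2.2.2 (v.2.2.1 * v.1⁻¹) 0 1

/-- The slice parameters of a conjugate of `sqNormal k r a`. -/
noncomputable def sliceRead (A : Matrix (Fin r ⊕ Fin r ⊕ Fin a) (Fin r ⊕ Fin r ⊕ Fin a) k) :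
    SliceParam k r a :=
  (A.submatrix .inl emb₂, A.submatrix emb₂ emb₂, A.submatrix emb₃ emb₂,
    (A.submatrix .inl emb₂)⁻¹ * A.submatrix .inl emb₃)

section Slice

variable [CharP k 2]

theorem sliceMat_mul_sliceInv {v : SliceParam k r a} (hv : v.1.det ≠ 0) :
    sliceMat v * sliceInv v = 1 := by
  have h1 : v.1 * v.1⁻¹ = 1 := Matrix.mul_nonsing_inv _ (isUnit_iff_ne_zero.2 hv)
  simp only [sliceMat, sliceInv, blk3_mul, h1, Matrix.mul_zero, Matrix.zero_mul, Matrix.mul_one,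
    Matrix.one_mul, add_zero, zero_add, Matrix.add_mul, Tup.matrix_add_self, blk3_one, blk3_inj,
    true_and, and_true]
  rw [add_comm (v.2.2.2 * v.2.2.1 * v.1⁻¹), ← add_assoc, Tup.matrix_add_self, zero_add,
    Matrix.mul_assoc, Tup.matrix_add_self]

theorem sliceInv_mul_sliceMat {v : SliceParam k r a} (hv : v.1.det ≠ 0) :
    sliceInv v * sliceMat v = 1 := mul_eq_one_comm.1 (sliceMat_mul_sliceInv hv)

theorem slice_conj_eq {v : SliceParam k r a} : sliceMat v * sqNormal k r a * sliceInv v =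
    blk3 (v.1 * ((v.2.2.2 * v.2.2.1 + v.2.1) * v.1⁻¹)) v.1 (v.1 * v.2.2.2)
      (v.2.1 * ((v.2.2.2 * v.2.2.1 + v.2.1) * v.1⁻¹)) v.2.1 (v.2.1 * v.2.2.2)
      (v.2.2.1 * ((v.2.2.2 * v.2.2.1 + v.2.1) * v.1⁻¹)) v.2.2.1 (v.2.2.1 * v.2.2.2) := by
  simp [sliceMat, sliceInv, sqNormal, blk3_mul]

theorem sliceRead_conj {v : SliceParam k r a} (hv : v.1.det ≠ 0) :
    sliceRead (sliceMat v * sqNormal k r a * sliceInv v) = v := by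
  rw [slice_conj_eq]
  refine Prod.ext rfl (Prod.ext rfl (Prod.ext rfl ?_))
  change v.1⁻¹ * (v.1 * v.2.2.2) = v.2.2.2
  rw [← Matrix.mul_assoc, Matrix.nonsing_inv_mul _ (isUnit_iff_ne_zero.2 hv), Matrix.one_mul]

/-- A conjugate of the normal form in the domain of the chart is conjugated to it by the slice
element read off from its entries. -/
theorem mul_sliceMat_sliceRead {A p p' : Matrix (Fin r ⊕ Fin r ⊕ Fin a) (Fin r ⊕ Fin r ⊕ Fin a) k}
    (hp : p' * p = 1) (hA : A = p * sqNormal k r a * p')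
    (hdet : (A.submatrix Sum.inl emb₂).det ≠ 0) :
    A * sliceMat (sliceRead A) = sliceMat (sliceRead A) * sqNormal k r a := by
  have hAA : A * A = 0 := by
    rw [hA, show p * sqNormal k r a * p' * (p * sqNormal k r a * p') =
      p * sqNormal k r a * (p' * p) * sqNormal k r a * p' by simp only [Matrix.mul_assoc], hp,
      Matrix.mul_one, Matrix.mul_assoc p, sqNormal_mul_self, Matrix.mul_zero, Matrix.zero_mul]
  obtain ⟨a₁₁, a₁₂, a₁₃, a₂₁, a₂₂, a₂₃, a₃₁, a₃₂, a₃₃, hA'⟩ := exists_eq_blk3 A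
  obtain ⟨p₁₁, p₁₂, p₁₃, p₂₁, p₂₂, p₂₃, p₃₁, p₃₂, p₃₃, rfl⟩ := exists_eq_blk3 p
  obtain ⟨q₁₁, q₁₂, q₁₃, q₂₁, q₂₂, q₂₃, q₃₁, q₃₂, q₃₃, rfl⟩ := exists_eq_blk3 p'
  have hdet' : a₁₂.det ≠ 0 := by rw [hA'] at hdet; exact hdet
  have hread : sliceRead A = (a₁₂, a₂₂, a₃₂, a₁₂⁻¹ * a₁₃) := by rw [hA']; rfl
  rw [hA'] at hAA
  have hA2 := hA
  rw [hA'] at hA2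
  simp only [sqNormal, blk3_mul, Matrix.mul_zero, Matrix.zero_mul, Matrix.mul_one, add_zero,
    zero_add, blk3_inj] at hA2
  obtain ⟨-, h12, h13, -, h22, h23, -, h32, h33⟩ := hA2
  have hdets : p₁₁.det ≠ 0 ∧ q₂₂.det ≠ 0 := by
    rw [h12, Matrix.det_mul] at hdet'
    exact ⟨left_ne_zero_of_mul hdet', right_ne_zero_of_mul hdet'⟩
  have hT : q₂₂ * (a₁₂⁻¹ * a₁₃) = q₂₃ := by
    rw [h12, h13, Matrix.mul_inv_rev, ← Matrix.mul_assoc, ← Matrix.mul_assoc,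
      ← Matrix.mul_assoc q₂₂, Matrix.mul_nonsing_inv _ (isUnit_iff_ne_zero.2 hdets.2), Matrix.one_mul,
      Matrix.nonsing_inv_mul _ (isUnit_iff_ne_zero.2 hdets.1), Matrix.one_mul]
  rw [hread, hA']
  simp only [blk3_mul, blk3_zero, blk3_inj] at hAA
  obtain ⟨-, e1, -, -, e2, -, -, e3, -⟩ := hAA
  simp only [sliceMat, sqNormal, blk3_mul, Matrix.mul_zero, Matrix.mul_one,
    add_zero, zero_add, blk3_inj, true_and]
  refine ⟨e1, ?_, e2, ?_, e3, ?_⟩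
  · rw [h12, Matrix.mul_assoc, ← h12, hT, h13, Tup.matrix_add_self]
  · rw [h22, Matrix.mul_assoc, hT, h23, Tup.matrix_add_self]
  · rw [h32, Matrix.mul_assoc, hT, h33, Tup.matrix_add_self]

/-- Base changes commuting with the normal forms preserve the vanishing of the homology block. -/
theorem homology_block_eq_zero {μ : Matrix (Fin r ⊕ Fin r ⊕ Fin a) (Fin r ⊕ Fin r ⊕ Fin a) k}
    {ν : Matrix (Fin s ⊕ Fin s ⊕ Fin b) (Fin s ⊕ Fin s ⊕ Fin b) k}
    {F : Matrix (Fin r ⊕ Fin r ⊕ Fin a) (Fin s ⊕ Fin s ⊕ Fin b) k}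
    (hμ : sqNormal k r a * μ + μ * sqNormal k r a = 0)
    (hν : sqNormal k s b * ν + ν * sqNormal k s b = 0)
    (hF : sqNormal k r a * F + F * sqNormal k s b = 0)
    (hF0 : F.submatrix emb₃ emb₃ = 0) : (μ * F * ν).submatrix emb₃ emb₃ = 0 := by
  obtain ⟨m₁₁, m₁₂, m₁₃, m₃₂, m₃₃, rfl⟩ := exists_eq_of_intertwine hμ
  obtain ⟨n₁₁, n₁₂, n₁₃, n₃₂, n₃₃, rfl⟩ := exists_eq_of_intertwine hν
  obtain ⟨f₁₁, f₁₂, f₁₃, f₃₂, f₃₃, rfl⟩ := exists_eq_of_intertwine hF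
  have hf : f₃₃ = 0 := hF0
  subst hf
  simp only [blk3_mul, Matrix.mul_zero, Matrix.zero_mul, add_zero, zero_add]
  rfl

end Slice

/-- The tuple in normal form with the given parameters. -/
def stdTup (v : ChartParam k r a s b) :
    Tup k (Fin r ⊕ Fin r ⊕ Fin a) (Fin s ⊕ Fin s ⊕ Fin b) :=
  match v with
  | (_, _, (c₁₁, c₁₂, c₁₃, c₃₂, c₃₃), (f₁₁, f₁₂, f₁₃, f₃₂), (b₂₂, b₁₂, b₁₃, b₃₂, b₃₃)) =>
    { A := sqNormal k r a
      B := blk3 (b₂₂ + (f₁₁ * c₁₂ + f₁₂ * c₁₁ + f₁₃ * c₃₂)) b₁₂ b₁₃ (f₁₁ * c₁₁) b₂₂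
        (f₁₁ * c₁₃ + f₁₃ * c₃₃) (f₃₂ * c₁₁) b₃₂ b₃₃
      C := blk3 c₁₁ c₁₂ c₁₃ 0 c₁₁ 0 0 c₃₂ c₃₃
      D := sqNormal k s b
      F := blk3 f₁₁ f₁₂ f₁₃ 0 f₁₁ 0 0 f₃₂ 0 }

/-- The remaining parameters of a tuple in normal form. -/
def stdRead (x : Tup k (Fin r ⊕ Fin r ⊕ Fin a) (Fin s ⊕ Fin s ⊕ Fin b)) :
    CParam k r a s b × FParam k r a s b × BParam k r a :=
  ((x.C.submatrix .inl .inl, x.C.submatrix .inl emb₂, x.C.submatrix .inl emb₃,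
      x.C.submatrix emb₃ emb₂, x.C.submatrix emb₃ emb₃),
    (x.F.submatrix .inl .inl, x.F.submatrix .inl emb₂, x.F.submatrix .inl emb₃,
      x.F.submatrix emb₃ emb₂),
    (x.B.submatrix emb₂ emb₂, x.B.submatrix .inl emb₂, x.B.submatrix .inl emb₃,
      x.B.submatrix emb₃ emb₂, x.B.submatrix emb₃ emb₃))

/-- The square-zero tuples with `A` and `D` in normal form for which the map induced by `F` on
homology vanishes. This map is the lower right block, the homology of `sqNormal k r a` being
represented by the last of the three summands. -/
def stdSet (k : Type*) [Field k] (r a s b : ℕ) :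
    Set (Tup k (Fin r ⊕ Fin r ⊕ Fin a) (Fin s ⊕ Fin s ⊕ Fin b)) :=
  {x | x ∈ Tup.sqZero k _ _ ∧ x.A = sqNormal k r a ∧ x.D = sqNormal k s b ∧
    x.F.submatrix emb₃ emb₃ = 0}

theorem stdRead_stdTup (v : ChartParam k r a s b) : stdRead (stdTup v) = v.2.2 := rfl

section Std

variable [CharP k 2]

theorem stdTup_mem_stdSet (v : ChartParam k r a s b) : stdTup v ∈ stdSet k r a s b := by
  obtain ⟨_, _, ⟨c₁₁, c₁₂, c₁₃, c₃₂, c₃₃⟩, ⟨f₁₁, f₁₂, f₁₃, f₃₂⟩, b₂₂, b₁₂, b₁₃, b₃₂, b₃₃⟩ := v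
  refine ⟨⟨sqNormal_mul_self r a, ?_, ?_, sqNormal_mul_self s b, intertwine_blk3 ..⟩, rfl, rfl,
    rfl⟩
  · simp only [stdTup, sqNormal, blk3_mul, blk3_add, Matrix.mul_zero, Matrix.zero_mul,
      Matrix.mul_one, Matrix.one_mul, add_zero, zero_add, Tup.matrix_add_self, blk3_zero, blk3_inj,
      true_and, and_true]
    rw [Tup.matrix_add_self_add, add_assoc _ _ (f₁₃ * c₃₂), Tup.matrix_add_self]
  · rw [add_comm]
    exact intertwine_blk3 ..

theorem stdTup_stdRead {x : Tup k (Fin r ⊕ Fin r ⊕ Fin a) (Fin s ⊕ Fin s ⊕ Fin b)}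
    (hx : x ∈ stdSet k r a s b) (v : SliceParam k r a) (w : SliceParam k s b) :
    stdTup (v, w, stdRead x) = x := by
  obtain ⟨⟨h1, h2, h3, h4, h5⟩, hA, hD, hF⟩ := hx
  obtain ⟨A, B, C, D, F⟩ := x
  simp only at hA hD
  subst hA hD
  rw [add_comm] at h3
  obtain ⟨c₁₁, c₁₂, c₁₃, c₃₂, c₃₃, rfl⟩ := exists_eq_of_intertwine h3
  obtain ⟨f₁₁, f₁₂, f₁₃, f₃₂, f₃₃, rfl⟩ := exists_eq_of_intertwine h5
  obtain ⟨b₁₁, b₁₂, b₁₃, b₂₁, b₂₂, b₂₃, b₃₁, b₃₂, b₃₃, rfl⟩ := exists_eq_blk3 B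
  have hf : f₃₃ = 0 := hF
  subst hf
  simp only [sqNormal, blk3_mul, blk3_add, Matrix.mul_zero, Matrix.zero_mul,
    Matrix.mul_one, Matrix.one_mul, add_zero, zero_add, blk3_zero, blk3_inj] at h2
  obtain ⟨e1, e2, e3, -, e4, -, -, e5, -⟩ := h2
  have e1 := matrix_eq_of_add_eq_zero e1
  have e3 := matrix_eq_of_add_eq_zero e3
  have e5 := matrix_eq_of_add_eq_zero e5
  have e2 : b₂₂ + (f₁₁ * c₁₂ + f₁₂ * c₁₁ + f₁₃ * c₃₂) = b₁₁ := by
    refine matrix_eq_of_add_eq_zero ?_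
    rw [← e2]
    abel
  subst e1 e3 e5 e2
  rfl

end Std

/-- The chart: the tuples in normal form, moved by the slice elements. -/
noncomputable def chart (v : ChartParam k r a s b) :
    Tup k (Fin r ⊕ Fin r ⊕ Fin a) (Fin s ⊕ Fin s ⊕ Fin b) :=
  Tup.levi (sliceMat v.1) (sliceInv v.1) (sliceMat v.2.1) (sliceInv v.2.1) (stdTup v)

/-- The tuple conjugated by the inverses of the slice elements of its components `A` and `D`. -/
noncomputable def toStd (x : Tup k (Fin r ⊕ Fin r ⊕ Fin a) (Fin s ⊕ Fin s ⊕ Fin b)) :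
    Tup k (Fin r ⊕ Fin r ⊕ Fin a) (Fin s ⊕ Fin s ⊕ Fin b) :=
  Tup.levi (sliceInv (sliceRead x.A)) (sliceMat (sliceRead x.A)) (sliceInv (sliceRead x.D))
    (sliceMat (sliceRead x.D)) x

/-- The coordinates of a tuple in the chart. -/
noncomputable def chartRead (x : Tup k (Fin r ⊕ Fin r ⊕ Fin a) (Fin s ⊕ Fin s ⊕ Fin b)) :
    ChartParam k r a s b :=
  (sliceRead x.A, sliceRead x.D, stdRead (toStd x))

variable (k r a s b) in
/-- The chart is defined where this polynomial does not vanish. -/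
def chartDet : polyFun k (ChartParam k r a s b) :=
  ⟨fun v => v.1.1.det * v.2.1.1.det, mul_mem
    (det_mem_polyFun (E := ChartParam k r a s b) (LinearMap.fst k (Matrix (Fin r) (Fin r) k) _ ∘ₗ
      LinearMap.fst k (SliceParam k r a) _))
    (det_mem_polyFun (E := ChartParam k r a s b) (LinearMap.fst k (Matrix (Fin s) (Fin s) k) _ ∘ₗ
      LinearMap.fst k (SliceParam k s b) _ ∘ₗ LinearMap.snd k (SliceParam k r a) _))⟩

variable (k r a s b) in
/-- The chart covers the part of the stratum where this polynomial does not vanish. -/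
def coverDet : polyFun k (Tup k (Fin r ⊕ Fin r ⊕ Fin a) (Fin s ⊕ Fin s ⊕ Fin b)) :=
  ⟨fun x => (x.A.submatrix Sum.inl emb₂).det * (x.D.submatrix Sum.inl emb₂).det, mul_mem
    (det_mem_of_entries _ fun i j =>
      linearForm_mem_polyFun (Matrix.entryLinearMap k k (.inl i) (emb₂ j) ∘ₗ Tup.linA))
    (det_mem_of_entries _ fun i j =>
      linearForm_mem_polyFun (Matrix.entryLinearMap k k (.inl i) (emb₂ j) ∘ₗ Tup.linD))⟩

section Regularity

theorem isRegularAway_id {F : Type*} [AddCommGroup F] [Module k F] {g : polyFun k F} :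
    IsRegularAway g fun t : F => t := isRegularAway_linearMap LinearMap.id

theorem isRegularAway_sliceMat {F : Type*} [AddCommGroup F] [Module k F] {g : polyFun k F}
    {v : F → SliceParam k r a} (hv : IsRegularAway g v) :
    IsRegularAway g fun t => sliceMat (v t) :=
  .blk3 hv.fst (isRegularAway_const 0) (isRegularAway_const 0) hv.snd.fst (isRegularAway_const 1)
    hv.snd.snd.snd hv.snd.snd.fst (isRegularAway_const 0) (isRegularAway_const 1)

theorem isRegularAway_sliceInv {F : Type*} [AddCommGroup F] [Module k F] {g : polyFun k F}
    {v : F → SliceParam k r a} (hv : IsRegularAway g v)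
    (hv' : IsRegularAway g fun t => (v t).1⁻¹) :
    IsRegularAway g fun t => sliceInv (v t) :=
  .blk3 hv' (isRegularAway_const 0) (isRegularAway_const 0)
    (((hv.snd.snd.snd.matrix_mul hv.snd.snd.fst).add hv.snd.fst).matrix_mul hv')
    (isRegularAway_const 1) hv.snd.snd.snd (hv.snd.snd.fst.matrix_mul hv') (isRegularAway_const 0)
    (isRegularAway_const 1)

theorem isRegularAway_levi {F : Type*} [AddCommGroup F] [Module k F] {g : polyFun k F}
    {U W U' W' : Type} [Fintype U] [Fintype W] [Fintype U'] [Fintype W']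
    {p : F → Matrix U' U k} {p' : F → Matrix U U' k} {q : F → Matrix W' W k}
    {q' : F → Matrix W W' k} {x : F → Tup k U W} (hp : IsRegularAway g p)
    (hp' : IsRegularAway g p') (hq : IsRegularAway g q) (hq' : IsRegularAway g q')
    (hx : IsRegularAway g x) :
    IsRegularAway g fun t => Tup.levi (p t) (p' t) (q t) (q' t) (x t) :=
  Tup.isRegularAway_mk ((hp.matrix_mul (hx.linearMap_comp Tup.linA)).matrix_mul hp')
    ((hp.matrix_mul (hx.linearMap_comp Tup.linB)).matrix_mul hp')
    ((hq.matrix_mul (hx.linearMap_comp Tup.linC)).matrix_mul hp')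
    ((hq.matrix_mul (hx.linearMap_comp Tup.linD)).matrix_mul hq')
    ((hp.matrix_mul (hx.linearMap_comp Tup.linF)).matrix_mul hq')

theorem isRegularAway_stdTup {g : polyFun k (ChartParam k r a s b)} :
    IsRegularAway g (stdTup : ChartParam k r a s b → _) := by
  have hv : IsRegularAway g fun v : ChartParam k r a s b => v := isRegularAway_id
  have hc := hv.snd.snd.fst
  have hf := hv.snd.snd.snd.fst
  have hb := hv.snd.snd.snd.snd
  have h0 := fun {m n : ℕ} => isRegularAway_const (g := g) (0 : Matrix (Fin m) (Fin n) k)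
  exact Tup.isRegularAway_mk (isRegularAway_const _)
    (.blk3 (hb.fst.add (((hf.fst.matrix_mul hc.snd.fst).add (hf.snd.fst.matrix_mul hc.fst)).add
      (hf.snd.snd.fst.matrix_mul hc.snd.snd.snd.fst))) hb.snd.fst hb.snd.snd.fst
      (hf.fst.matrix_mul hc.fst) hb.fst ((hf.fst.matrix_mul hc.snd.snd.fst).add
      (hf.snd.snd.fst.matrix_mul hc.snd.snd.snd.snd)) (hf.snd.snd.snd.matrix_mul hc.fst)
      hb.snd.snd.snd.fst hb.snd.snd.snd.snd)
    (.blk3 hc.fst hc.snd.fst hc.snd.snd.fst h0 hc.fst h0 h0 hc.snd.snd.snd.fst hc.snd.snd.snd.snd)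
    (isRegularAway_const _)
    (.blk3 hf.fst hf.snd.fst hf.snd.snd.fst h0 hf.fst h0 h0 hf.snd.snd.snd h0)

theorem isRegularAway_chart : IsRegularAway (chartDet k r a s b) chart := by
  have hv : IsRegularAway (chartDet k r a s b) fun v : ChartParam k r a s b => v :=
    isRegularAway_id
  exact isRegularAway_levi (isRegularAway_sliceMat hv.fst)
    (isRegularAway_sliceInv hv.fst (hv.fst.fst.matrix_inv
      (det_mem_polyFun (LinearMap.fst k _ _ ∘ₗ LinearMap.fst k _ _ ∘ₗ LinearMap.snd k _ _))
      fun v => rfl))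
    (isRegularAway_sliceMat hv.snd.fst)
    (isRegularAway_sliceInv hv.snd.fst (hv.snd.fst.fst.matrix_inv
      (det_mem_polyFun (E := ChartParam k r a s b) (LinearMap.fst k (Matrix (Fin r) (Fin r) k) _ ∘ₗ
      LinearMap.fst k (SliceParam k r a) _))
      fun v => mul_comm _ _)) isRegularAway_stdTup

theorem isRegularAway_stdRead {F : Type*} [AddCommGroup F] [Module k F] {g : polyFun k F}
    {x : F → Tup k (Fin r ⊕ Fin r ⊕ Fin a) (Fin s ⊕ Fin s ⊕ Fin b)} (hx : IsRegularAway g x) :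
    IsRegularAway g fun t => stdRead (x t) := by
  have hB := hx.linearMap_comp Tup.linB
  have hC := hx.linearMap_comp Tup.linC
  have hF := hx.linearMap_comp Tup.linF
  exact ((hC.submatrix _ _).prodMk <| (hC.submatrix _ _).prodMk <| (hC.submatrix _ _).prodMk <|
    (hC.submatrix _ _).prodMk (hC.submatrix _ _)).prodMk <|
    ((hF.submatrix _ _).prodMk <| (hF.submatrix _ _).prodMk <| (hF.submatrix _ _).prodMk
      (hF.submatrix _ _)).prodMk <|
    (hB.submatrix _ _).prodMk <| (hB.submatrix _ _).prodMk <| (hB.submatrix _ _).prodMk <|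
    (hB.submatrix _ _).prodMk (hB.submatrix _ _)

theorem isRegularAway_sliceRead_toStd :
    IsRegularAway (coverDet k r a s b) (fun x => sliceRead x.A) ∧
    IsRegularAway (coverDet k r a s b) (fun x => sliceRead x.D) ∧
    IsRegularAway (coverDet k r a s b) (toStd (k := k) (r := r) (a := a) (s := s) (b := b)) := by
  have hA := isRegularAway_linearMap (g := coverDet k r a s b) Tup.linA
  have hD := isRegularAway_linearMap (g := coverDet k r a s b) Tup.linD
  have hAi := (hA.submatrix Sum.inl emb₂).matrix_inv (f := fun x =>
    (x.D.submatrix Sum.inl emb₂).det) (det_mem_of_entries _ fun i j =>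
      linearForm_mem_polyFun (Matrix.entryLinearMap k k (.inl i) (emb₂ j) ∘ₗ Tup.linD))
    fun x => rfl
  have hDi := (hD.submatrix Sum.inl emb₂).matrix_inv (f := fun x =>
    (x.A.submatrix Sum.inl emb₂).det) (det_mem_of_entries _ fun i j =>
      linearForm_mem_polyFun (Matrix.entryLinearMap k k (.inl i) (emb₂ j) ∘ₗ Tup.linA))
    fun x => mul_comm _ _
  have hv : IsRegularAway (coverDet k r a s b) fun x => sliceRead (Tup.linA x) :=
    (hA.submatrix _ _).prodMk <| (hA.submatrix _ _).prodMk <| (hA.submatrix _ _).prodMk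
      (hAi.matrix_mul (hA.submatrix _ _))
  have hw : IsRegularAway (coverDet k r a s b) fun x => sliceRead (Tup.linD x) :=
    (hD.submatrix _ _).prodMk <| (hD.submatrix _ _).prodMk <| (hD.submatrix _ _).prodMk
      (hDi.matrix_mul (hD.submatrix _ _))
  exact ⟨hv, hw, isRegularAway_levi (isRegularAway_sliceInv hv hAi) (isRegularAway_sliceMat hv)
      (isRegularAway_sliceInv hw hDi) (isRegularAway_sliceMat hw) isRegularAway_id⟩

theorem isRegularAway_chartRead : IsRegularAway (coverDet k r a s b) chartRead :=
  isRegularAway_sliceRead_toStd.1.prodMk <| isRegularAway_sliceRead_toStd.2.1.prodMk <|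
    isRegularAway_stdRead isRegularAway_sliceRead_toStd.2.2

end Regularity

section Inverse

variable [CharP k 2]

theorem det_ne_zero_of_chartDet {v : ChartParam k r a s b} (hv : (chartDet k r a s b).1 v ≠ 0) :
    v.1.1.det ≠ 0 ∧ v.2.1.1.det ≠ 0 :=
  ⟨left_ne_zero_of_mul hv, right_ne_zero_of_mul hv⟩

theorem coverDet_chart (v : ChartParam k r a s b) :
    (coverDet k r a s b).1 (chart v) = (chartDet k r a s b).1 v := by
  change ((sliceMat v.1 * sqNormal k r a * sliceInv v.1).submatrix Sum.inl emb₂).det *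
    ((sliceMat v.2.1 * sqNormal k s b * sliceInv v.2.1).submatrix Sum.inl emb₂).det = _
  rw [slice_conj_eq, slice_conj_eq]
  rfl

theorem chartRead_chart {v : ChartParam k r a s b} (hv : (chartDet k r a s b).1 v ≠ 0) :
    chartRead (chart v) = v := by
  obtain ⟨h1, h2⟩ := det_ne_zero_of_chartDet hv
  have hA : sliceRead (chart v).A = v.1 := sliceRead_conj h1
  have hD : sliceRead (chart v).D = v.2.1 := sliceRead_conj h2
  rw [chartRead, toStd, hA, hD, chart, Tup.levi_levi, sliceInv_mul_sliceMat h1, sliceInv_mul_sliceMat h2,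
    Tup.levi_one, stdRead_stdTup]

/-- The slice elements read off from a conjugate of a tuple in normal form bring it back into
normal form, although they need not undo the given conjugation. -/
theorem toStd_mem_stdSet
    {x₀ : Tup k (Fin r ⊕ Fin r ⊕ Fin a) (Fin s ⊕ Fin s ⊕ Fin b)}
    (hx₀ : x₀ ∈ stdSet k r a s b) {p p' q q'} (hp : p * p' = 1) (hq : q * q' = 1)
    {x : Tup k (Fin r ⊕ Fin r ⊕ Fin a) (Fin s ⊕ Fin s ⊕ Fin b)} (hx : x = Tup.levi p p' q q' x₀)
    (hdet : (coverDet k r a s b).1 x ≠ 0) :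
    toStd x ∈ stdSet k r a s b := by
  obtain ⟨hx₀s, hA₀, hD₀, hF₀⟩ := hx₀
  have hp' := mul_eq_one_comm.1 hp
  have hq' := mul_eq_one_comm.1 hq
  have hdA : (x.A.submatrix Sum.inl emb₂).det ≠ 0 := left_ne_zero_of_mul hdet
  have hdD : (x.D.submatrix Sum.inl emb₂).det ≠ 0 := right_ne_zero_of_mul hdet
  have hA : x.A = p * sqNormal k r a * p' := by rw [← hA₀, hx]; rfl
  have hD : x.D = q * sqNormal k s b * q' := by rw [← hD₀, hx]; rfl
  have hmA := mul_sliceMat_sliceRead hp' hA hdA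
  have hmD := mul_sliceMat_sliceRead hq' hD hdD
  set m := sliceMat (sliceRead x.A) with hm
  set m' := sliceInv (sliceRead x.A) with hm'
  set n := sliceMat (sliceRead x.D) with hn
  set n' := sliceInv (sliceRead x.D) with hn'
  have hmm : m * m' = 1 := sliceMat_mul_sliceInv hdA
  have hmm' : m' * m = 1 := sliceInv_mul_sliceMat hdA
  have hnn : n * n' = 1 := sliceMat_mul_sliceInv hdD
  have hnn' : n' * n = 1 := sliceInv_mul_sliceMat hdD
  have hxs : x ∈ Tup.sqZero k _ _ := hx ▸ Tup.levi_mem_sqZero hp' hq' hx₀s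
  refine ⟨Tup.levi_mem_sqZero hmm hnn hxs, ?_, ?_, ?_⟩
  · change m' * x.A * m = _
    rw [Matrix.mul_assoc, hmA, ← Matrix.mul_assoc, hmm', Matrix.one_mul]
  · change n' * x.D * n = _
    rw [Matrix.mul_assoc, hmD, ← Matrix.mul_assoc, hnn', Matrix.one_mul]
  · have hF : (toStd x).F = (m' * p) * x₀.F * (q' * n) := by
      change m' * x.F * n = _
      simp only [hx, Tup.levi_apply, Matrix.mul_assoc]
    have hm'A : m' * x.A = sqNormal k r a * m' := by
      rw [← Matrix.mul_one (m' * x.A), ← hmm, ← Matrix.mul_assoc, Matrix.mul_assoc m', hmA,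
        ← Matrix.mul_assoc, hmm', Matrix.one_mul]
    rw [hF]
    refine homology_block_eq_zero ?_ ?_ ?_ hF₀
    · rw [← Matrix.mul_assoc, ← hm'A, hA, Matrix.mul_assoc m', Matrix.mul_assoc _ p', hp',
        Matrix.mul_one, Matrix.mul_assoc m', Tup.matrix_add_self]
    · rw [Matrix.mul_assoc q', ← hmD, hD,
        show q' * (q * sqNormal k s b * q' * n) = (q' * q) * (sqNormal k s b * (q' * n)) by
          simp only [Matrix.mul_assoc], hq', Matrix.one_mul, Tup.matrix_add_self]
    · rw [← hA₀, ← hD₀]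
      exact hx₀s.2.2.2.2

theorem chart_chartRead {x₀ : Tup k (Fin r ⊕ Fin r ⊕ Fin a) (Fin s ⊕ Fin s ⊕ Fin b)}
    (hx₀ : x₀ ∈ stdSet k r a s b) {p p' q q'} (hp : p * p' = 1) (hq : q * q' = 1)
    {x : Tup k (Fin r ⊕ Fin r ⊕ Fin a) (Fin s ⊕ Fin s ⊕ Fin b)} (hx : x = Tup.levi p p' q q' x₀)
    (hdet : (coverDet k r a s b).1 x ≠ 0) :
    chart (chartRead x) = x ∧ (chartDet k r a s b).1 (chartRead x) ≠ 0 := by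
  have hdA : (x.A.submatrix Sum.inl emb₂).det ≠ 0 := left_ne_zero_of_mul hdet
  have hdD : (x.D.submatrix Sum.inl emb₂).det ≠ 0 := right_ne_zero_of_mul hdet
  refine ⟨?_, mul_ne_zero hdA hdD⟩
  change Tup.levi (sliceMat (sliceRead x.A)) (sliceInv (sliceRead x.A))
    (sliceMat (sliceRead x.D)) (sliceInv (sliceRead x.D))
    (stdTup (sliceRead x.A, sliceRead x.D, stdRead (toStd x))) = x
  rw [stdTup_stdRead (toStd_mem_stdSet hx₀ hp hq hx hdet), toStd, Tup.levi_levi,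
    sliceMat_mul_sliceInv hdA, sliceMat_mul_sliceInv hdD, Tup.levi_one]

end Inverse

end Chart

/-! ### Irreducible components from a covering family -/

section Components

variable {X Y : Type*} [TopologicalSpace X] [TopologicalSpace Y]

/-- A closed irreducible subset of the same finite dimension is everything. -/
theorem eq_of_subset_of_topologicalKrullDim_eq {Z Z' : Set X} (hZ : IsClosed Z)
    (hi : IsIrreducible Z') (h : Z ⊆ Z') {d : ℕ}
    (hd : topologicalKrullDim Z = d) (hd' : topologicalKrullDim Z' = d) : Z = Z' := by
  by_contra hne
  obtain ⟨x, hx, hxZ⟩ := Set.exists_of_ssubset (h.ssubset_of_ne hne)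
  obtain ⟨p, hp⟩ := (Order.le_krullDim_iff (n := d)).1 hd.ge
  have hind : Topology.IsInducing (Set.inclusion h) :=
    (Topology.IsEmbedding.inclusion h).isInducing
  let q := p.map _ (TopologicalSpace.IrreducibleCloseds.map_strictMono_of_isInducing hind)
  let T : TopologicalSpace.IrreducibleCloseds Z' := ⟨Set.univ, by
    simpa using hi.preimage_of_isInducing (f := (Subtype.val : Z' → X)) .subtypeVal (by simp),
    isClosed_univ⟩
  have hqT : q.last < T := by
    refine lt_of_le_of_ne (fun _ _ => trivial) fun heq => hxZ ?_
    have hcl : (q.last : Set Z') ⊆ Subtype.val ⁻¹' Z := by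
      change closure _ ⊆ _
      refine closure_minimal ?_ (hZ.preimage continuous_subtype_val)
      rintro _ ⟨y, -, rfl⟩
      exact y.2
    have : (⟨x, hx⟩ : Z') ∈ q.last := by
      rw [heq]
      trivial
    exact hcl this
  have hle := Order.LTSeries.length_le_krullDim (q.snoc T hqT)
  change _ ≤ topologicalKrullDim Z' at hle
  rw [hd'] at hle
  have : q.length + 1 ≤ d := by exact_mod_cast hle
  have : q.length = d := hp
  omega

/-- A finite family of irreducible closed sets covering the image of a space embedded by `f`, none
of them contained in another one, consists of the irreducible components. -/
theorem irreducibleComponents_eq_range {ι : Type*} [Finite ι] {f : Y → X}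
    (hf : Topology.IsInducing f) {Z : ι → Set X} (hc : ∀ j, IsClosed (Z j))
    (hi : ∀ j, IsIrreducible (Z j)) (hZ : ∀ j, Z j ⊆ Set.range f)
    (hcov : ∀ y, ∃ j, f y ∈ Z j) (hsub : ∀ j j', Z j ⊆ Z j' → j = j') :
    irreducibleComponents Y = Set.range fun j => f ⁻¹' Z j := by
  have hirr : ∀ j, IsIrreducible (f ⁻¹' Z j) := fun j => (hi j).preimage_of_isInducing hf (hZ j)
  have key : ∀ T : Set Y, IsIrreducible T → ∃ j, T ⊆ f ⁻¹' Z j := fun T hT => by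
    have hfin := Set.finite_range fun j => f ⁻¹' Z j
    have := (isIrreducible_iff_sUnion_isClosed.1 hT) hfin.toFinset (by
      simp only [Set.Finite.mem_toFinset, Set.mem_range, forall_exists_index,
        forall_apply_eq_imp_iff]
      exact fun j => (hc j).preimage hf.continuous) (fun y _ => by
      obtain ⟨j, hj⟩ := hcov y
      exact ⟨f ⁻¹' Z j, by simp, hj⟩)
    obtain ⟨_, hz, hTz⟩ := this
    simp only [Set.Finite.mem_toFinset, Set.mem_range] at hz
    obtain ⟨j, rfl⟩ := hz
    exact ⟨j, hTz⟩
  ext T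
  refine ⟨fun hT => ?_, ?_⟩
  · obtain ⟨j, hj⟩ := key T hT.1
    exact ⟨j, (hT.2 (hirr j) hj).antisymm hj⟩
  · rintro ⟨j, rfl⟩
    refine ⟨hirr j, fun T hT hjT => ?_⟩
    obtain ⟨j', hj'⟩ := key T hT
    have : Z j ⊆ Z j' := fun x hx => by
      obtain ⟨y, rfl⟩ := hZ j hx
      exact hj' (hjT hx)
    rw [hsub j j' this]
    exact hj'

/-- The number and the dimension of the irreducible components of an embedded space, from a
covering family of closed irreducible sets of the same dimension. -/
theorem ncard_irreducibleComponents {ι : Type*} [Finite ι] {f : Y → X}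
    (hf : Topology.IsInducing f) (hinj : Function.Injective f) {Z : ι → Set X}
    (hc : ∀ j, IsClosed (Z j)) (hi : ∀ j, IsIrreducible (Z j)) (hZ : ∀ j, Z j ⊆ Set.range f)
    (hcov : ∀ y, ∃ j, f y ∈ Z j) {d : ℕ} (hd : ∀ j, topologicalKrullDim (Z j) = d)
    (hZinj : Function.Injective Z) :
    (irreducibleComponents Y).ncard = Nat.card ι ∧
      ∀ T ∈ irreducibleComponents Y, topologicalKrullDim T = d := by
  rw [irreducibleComponents_eq_range hf hc hi hZ hcov fun j j' h =>
    hZinj (eq_of_subset_of_topologicalKrullDim_eq (hc j) (hi j') h (hd j) (hd j'))]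
  refine ⟨?_, ?_⟩
  · rw [← Set.image_univ, Set.ncard_image_of_injective, Set.ncard_univ]
    intro j j' h
    refine hZinj ?_
    rw [← Set.image_preimage_eq_of_subset (hZ j), ← Set.image_preimage_eq_of_subset (hZ j')]
    exact congrArg _ h
  · rintro _ ⟨j, rfl⟩
    rw [← hd j]
    have hbij : Set.BijOn f (f ⁻¹' Z j) (Z j) :=
      ⟨fun _ h => h, hinj.injOn, fun x hx => by
        obtain ⟨y, rfl⟩ := hZ j hx
        exact ⟨y, hx, rfl⟩⟩
    have hind : Topology.IsInducing (hbij.mapsTo.restrict f _ _) :=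
      (hf.comp .subtypeVal).codRestrict _
    have hb : Function.Bijective (hbij.mapsTo.restrict f _ _) := hbij.bijective
    refine le_antisymm hind.topologicalKrullDim_le ?_
    exact ((Equiv.ofBijective _ hb).toHomeomorphOfIsInducing hind).symm.isInducing
      |>.topologicalKrullDim_le

end Components

/-! ### The strata and their closures -/

section Strata

universe u

/-- Two matrices that are inverse to each other; the index types may differ. -/
structure IsInvPair {k : Type*} [Field k] {U V : Type*} [Fintype U] [Fintype V] [DecidableEq U]
    [DecidableEq V] (p : Matrix U V k) (p' : Matrix V U k) : Prop where
  /-- `p'` is a right inverse. -/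
  mul_eq : p * p' = 1
  /-- `p'` is a left inverse. -/
  mul_eq' : p' * p = 1

namespace IsInvPair

variable {k : Type*} [Field k] {U V T : Type*} [Fintype U] [Fintype V] [Fintype T] [DecidableEq U]
    [DecidableEq V] [DecidableEq T] {p : Matrix U V k} {p' : Matrix V U k}

theorem symm (h : IsInvPair p p') : IsInvPair p' p := ⟨h.2, h.1⟩

theorem mul (h : IsInvPair p p') {q : Matrix V T k} {q' : Matrix T V k} (hq : IsInvPair q q') :
    IsInvPair (p * q) (q' * p') :=
  ⟨by rw [Matrix.mul_assoc, ← Matrix.mul_assoc q, hq.1, Matrix.one_mul, h.1],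
    by rw [Matrix.mul_assoc, ← Matrix.mul_assoc p', h.2, Matrix.one_mul, hq.2]⟩

theorem transpose (h : IsInvPair p p') : IsInvPair p'.transpose p.transpose :=
  ⟨by rw [← Matrix.transpose_mul, h.1, Matrix.transpose_one],
    by rw [← Matrix.transpose_mul, h.2, Matrix.transpose_one]⟩

theorem exists_of_card_eq (h : Fintype.card U = Fintype.card V) :
    ∃ (p : Matrix U V k) (p' : Matrix V U k), IsInvPair p p' := by
  let e := Fintype.equivOfCardEq h
  refine ⟨(1 : Matrix V V k).submatrix e id, (1 : Matrix V V k).submatrix id e, ?_, ?_⟩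
  · rw [← Matrix.submatrix_mul _ _ e id e Function.bijective_id, Matrix.one_mul,
      Matrix.submatrix_one_equiv]
  · rw [← Matrix.submatrix_mul _ _ id e id e.bijective, Matrix.one_mul, Matrix.submatrix_id_id]

end IsInvPair

variable {k : Type u} [Field k] {U W U' W' : Type} [Fintype U] [Fintype W] [DecidableEq U]
  [DecidableEq W] [Fintype U'] [Fintype W'] [DecidableEq U'] [DecidableEq W'] {r a s b : ℕ}

theorem Tup.levi_levi_of_isInvPair {p : Matrix U' U k} {p' : Matrix U U' k} {q : Matrix W' W k}
    {q' : Matrix W W' k} (hp : IsInvPair p p') (hq : IsInvPair q q') (x : Tup k U W) :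
    Tup.levi p' p q' q (Tup.levi p p' q q' x) = x := by
  rw [Tup.levi_levi, hp.2, hq.2, Tup.levi_one]

variable (k U W r a s b) in
/-- The square-zero tuples for which `A` has `r` Jordan blocks of size two, `D` has `s` of them,
and the map from the homology of `D` to the homology of `A` induced by `F` vanishes. -/
def stratum : Set (Tup k U W) :=
  {x | ∃ p p' q q', IsInvPair p p' ∧ IsInvPair q q' ∧
    ∃ x₀ ∈ stdSet k r a s b, Tup.levi p p' q q' x₀ = x}

theorem levi_mem_stratum {p : Matrix U' U k} {p' : Matrix U U' k} {q : Matrix W' W k}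
    {q' : Matrix W W' k} (hp : IsInvPair p p') (hq : IsInvPair q q') {x : Tup k U W}
    (hx : x ∈ stratum k U W r a s b) : Tup.levi p p' q q' x ∈ stratum k U' W' r a s b := by
  obtain ⟨m, m', n, n', hm, hn, x₀, hx₀, rfl⟩ := hx
  exact ⟨_, _, _, _, hp.mul hm, hq.mul hn, x₀, hx₀, (Tup.levi_levi ..).symm⟩

theorem stdSet_subset_stratum : stdSet k r a s b ⊆ stratum k _ _ r a s b := fun x hx =>
  ⟨1, 1, 1, 1, ⟨by simp, by simp⟩, ⟨by simp, by simp⟩, x, hx, Tup.levi_one x⟩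

theorem stratum_subset_sqZero : stratum k U W r a s b ⊆ Tup.sqZero k U W := by
  rintro _ ⟨p, p', q, q', hp, hq, x₀, hx₀, rfl⟩
  exact Tup.levi_mem_sqZero hp.2 hq.2 hx₀.1

theorem coverDet_eq_one {x : Tup k (Fin r ⊕ Fin r ⊕ Fin a) (Fin s ⊕ Fin s ⊕ Fin b)}
    (hA : x.A = sqNormal k r a) (hD : x.D = sqNormal k s b) : (coverDet k r a s b).1 x = 1 := by
  have h : ∀ r a, (sqNormal k r a).submatrix Sum.inl emb₂ = 1 := fun r a => rfl
  simp only [coverDet, hA, hD, h, Matrix.det_one, mul_one]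

section Closure

theorem id_mem_polyFun : (fun t : k => t) ∈ polyFun k k :=
  linearForm_mem_polyFun (LinearMap.id : k →ₗ[k] k)

variable [CharP k 2]

/-- Every base change is joined to the identity by a line, and the chart covers the points of the
resulting curve near the identity. -/
theorem stratum_subset_closure_chart [Infinite k] :
    stratum k (Fin r ⊕ Fin r ⊕ Fin a) (Fin s ⊕ Fin s ⊕ Fin b) r a s b ⊆
      closure (chart '' {v | (chartDet k r a s b).1 v ≠ 0}) := by
  rintro _ ⟨p, p', q, q', hp, hq, x₀, hx₀, rfl⟩
  have hline : ∀ {V : Type} [Fintype V] [DecidableEq V] (p : Matrix V V k),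
      (fun t : k => (1 + t • (p - 1)).det) ∈ polyFun k k := fun p =>
    det_mem_of_entries _ fun i j => add_mem (const_mem_polyFun ((1 : Matrix _ _ k) i j))
      (mul_mem id_mem_polyFun (const_mem_polyFun ((p - 1) i j)))
  let g : polyFun k k := ⟨fun t => (1 + t • (p - 1)).det * (1 + t • (q - 1)).det,
    mul_mem (hline p) (hline q)⟩
  have hreg : ∀ {V : Type} [Fintype V] [DecidableEq V] (p : Matrix V V k),
      IsRegularAway g fun t : k => 1 + t • (p - 1) := fun p =>
    (isRegularAway_const 1).add ((isRegularAway_const (p - 1)).smul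
      (polyFun_le_regularAway g id_mem_polyFun))
  have hψ : IsRegularAway g fun t : k => Tup.levi (1 + t • (p - 1)) (1 + t • (p - 1))⁻¹
      (1 + t • (q - 1)) (1 + t • (q - 1))⁻¹ x₀ :=
    isRegularAway_levi (hreg p) ((hreg p).matrix_inv (hline q) fun _ => rfl) (hreg q)
      ((hreg q).matrix_inv (hline p) fun _ => mul_comm _ _) (isRegularAway_const x₀)
  have hp1 : (1 : Matrix _ _ k) + (1 : k) • (p - 1) = p := by simp
  have hq1 : (1 : Matrix _ _ k) + (1 : k) • (q - 1) = q := by simp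
  have hg1 : g.1 1 ≠ 0 := by
    simp only [g, hp1, hq1]
    exact mul_ne_zero (Matrix.det_ne_zero_of_right_inverse hp.1)
      (Matrix.det_ne_zero_of_right_inverse hq.1)
  have := hψ.mem_of_isClosed
    (isClosed_closure (s := chart '' {v | (chartDet k r a s b).1 v ≠ 0})) (hψ.comp (coverDet k r a s b).2) (t₀ := 0)
    (by simp [g]) (by
      simp only [zero_smul, add_zero, inv_one, Tup.levi_one]
      rw [coverDet_eq_one hx₀.2.1 hx₀.2.2.1]
      exact one_ne_zero) (fun t ht hht => by
      obtain ⟨h1, h2⟩ := chart_chartRead hx₀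
        (Matrix.mul_nonsing_inv _ (isUnit_iff_ne_zero.2 (left_ne_zero_of_mul ht)))
        (Matrix.mul_nonsing_inv _ (isUnit_iff_ne_zero.2 (right_ne_zero_of_mul ht))) rfl hht
      exact subset_closure ⟨_, h2, h1⟩) hg1
  simpa only [hp1, hq1, Matrix.inv_eq_right_inv hp.1, Matrix.inv_eq_right_inv hq.1] using this

theorem chart_mem_stratum {v : ChartParam k r a s b} (hv : (chartDet k r a s b).1 v ≠ 0) :
    chart v ∈ stratum k (Fin r ⊕ Fin r ⊕ Fin a) (Fin s ⊕ Fin s ⊕ Fin b) r a s b := by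
  obtain ⟨h1, h2⟩ := det_ne_zero_of_chartDet hv
  exact ⟨_, _, _, _, ⟨sliceMat_mul_sliceInv h1, sliceInv_mul_sliceMat h1⟩,
    ⟨sliceMat_mul_sliceInv h2, sliceInv_mul_sliceMat h2⟩, _, stdTup_mem_stdSet v, rfl⟩

theorem closure_stratum_eq [Infinite k] {p : Matrix U (Fin r ⊕ Fin r ⊕ Fin a) k} {p'}
    {q : Matrix W (Fin s ⊕ Fin s ⊕ Fin b) k} {q'} (hp : IsInvPair p p') (hq : IsInvPair q q') :
    closure (stratum k U W r a s b) = closure ((fun v => Tup.levi p p' q q' (chart v)) ''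
      {v | (chartDet k r a s b).1 v ≠ 0}) := by
  refine (closure_minimal ?_ isClosed_closure).antisymm (closure_mono ?_)
  · intro x hx
    have h := stratum_subset_closure_chart (levi_mem_stratum hp.symm hq.symm hx)
    have := image_closure_subset_closure_image (continuous_linearMap (Tup.levi p p' q q'))
      ⟨_, h, Tup.levi_levi_of_isInvPair hp.symm hq.symm x⟩
    rwa [Set.image_image] at this
  · rintro _ ⟨v, hv, rfl⟩
    exact levi_mem_stratum hp hq (chart_mem_stratum hv)

theorem exists_chartDet_ne_zero : ∃ v, (chartDet k r a s b).1 v ≠ 0 :=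
  ⟨((1, 0), (1, 0), 0), by simp [chartDet]⟩

theorem isIrreducible_closure_stratum [Infinite k] (hU : Fintype.card U = 2 * r + a)
    (hW : Fintype.card W = 2 * s + b) : IsIrreducible (closure (stratum k U W r a s b)) := by
  obtain ⟨p, p', hp⟩ := IsInvPair.exists_of_card_eq (k := k) (U := U)
    (V := Fin r ⊕ Fin r ⊕ Fin a) (by simp [hU]; ring)
  obtain ⟨q, q', hq⟩ := IsInvPair.exists_of_card_eq (k := k) (U := W)
    (V := Fin s ⊕ Fin s ⊕ Fin b) (by simp [hW]; ring)
  rw [closure_stratum_eq hp hq]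
  obtain ⟨v, hv⟩ := exists_chartDet_ne_zero (k := k) (r := r) (a := a) (s := s) (b := b)
  exact (isRegularAway_chart.linearMap_comp (Tup.levi p p' q q')).isIrreducible_closure ⊤ v
    (by simp) hv

theorem topologicalKrullDim_closure_stratum [Infinite k] (hU : Fintype.card U = 2 * r + a)
    (hW : Fintype.card W = 2 * s + b) : topologicalKrullDim (closure (stratum k U W r a s b)) =
      Module.finrank k (ChartParam k r a s b) := by
  obtain ⟨p, p', hp⟩ := IsInvPair.exists_of_card_eq (k := k) (U := U)
    (V := Fin r ⊕ Fin r ⊕ Fin a) (by simp [hU]; ring)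
  obtain ⟨q, q', hq⟩ := IsInvPair.exists_of_card_eq (k := k) (U := W)
    (V := Fin s ⊕ Fin s ⊕ Fin b) (by simp [hW]; ring)
  rw [closure_stratum_eq hp hq]
  obtain ⟨v, hv⟩ := exists_chartDet_ne_zero (k := k) (r := r) (a := a) (s := s) (b := b)
  let g' : polyFun k (Tup k U W) := ⟨_, comp_linearMap_mem_polyFun (Tup.levi p' p q' q)
    (coverDet k r a s b).2⟩
  have hρ : IsRegularAway g' fun x => chartRead (Tup.levi p' p q' q x) := fun l => by
    obtain ⟨N, f, hf, h⟩ :=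
      (isRegularAway_chartRead : IsRegularAway (coverDet k r a s b) chartRead) l
    exact ⟨N, _, comp_linearMap_mem_polyFun _ hf, fun t ht => h _ ht⟩
  refine topologicalKrullDim_closure_image (g' := g')
    (isRegularAway_chart.linearMap_comp (Tup.levi p p' q q')) hρ (fun t ht => ?_) (fun t ht => ?_)
    hv
  · change (coverDet k r a s b).1 (Tup.levi p' p q' q _) ≠ 0
    rwa [Tup.levi_levi_of_isInvPair hp hq, coverDet_chart]
  · rw [Tup.levi_levi_of_isInvPair hp hq, chartRead_chart ht]

end Closure

/-! ### Transposition -/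

/-- The permutation matrix exchanging the first two blocks. -/
def swapMat (k : Type*) [Field k] (r a : ℕ) :
    Matrix (Fin r ⊕ Fin r ⊕ Fin a) (Fin r ⊕ Fin r ⊕ Fin a) k :=
  blk3 0 1 0 1 0 0 0 0 1

theorem isInvPair_swapMat : IsInvPair (swapMat k r a) (swapMat k r a) := by
  constructor <;> simp [swapMat, blk3_mul, blk3_one]

theorem swapMat_mul_transpose_sqNormal :
    swapMat k r a * (sqNormal k r a).transpose * swapMat k r a = sqNormal k r a := by
  simp [swapMat, sqNormal, blk3_mul, blk3_transpose]

/-- Tuples for which `C`, in place of `F`, vanishes on homology are the transposes of those in the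
stratum: the normal forms are conjugate to their transposes. -/
theorem tr_levi_mem_stratum {p : Matrix U (Fin r ⊕ Fin r ⊕ Fin a) k} {p'}
    {q : Matrix W (Fin s ⊕ Fin s ⊕ Fin b) k} {q'} (hp : IsInvPair p p') (hq : IsInvPair q q')
    {y : Tup k (Fin r ⊕ Fin r ⊕ Fin a) (Fin s ⊕ Fin s ⊕ Fin b)} (hy : y ∈ Tup.sqZero k _ _)
    (hA : y.A = sqNormal k r a) (hD : y.D = sqNormal k s b)
    (hC : y.C.submatrix emb₃ emb₃ = 0) :
    Tup.tr (Tup.levi p p' q q' y) ∈ stratum k U W r a s b := by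
  rw [Tup.tr_levi]
  refine levi_mem_stratum hp.transpose hq.transpose ?_
  have hstd : Tup.levi (swapMat k r a) (swapMat k r a) (swapMat k s b) (swapMat k s b)
      (Tup.tr y) ∈ stdSet k r a s b := by
    refine ⟨Tup.levi_mem_sqZero isInvPair_swapMat.1 isInvPair_swapMat.1 (Tup.tr_mem_sqZero hy),
      ?_, ?_, ?_⟩
    · simp only [Tup.levi_apply, Tup.tr_apply, hA, swapMat_mul_transpose_sqNormal]
    · simp only [Tup.levi_apply, Tup.tr_apply, hD, swapMat_mul_transpose_sqNormal]
    · change (swapMat k r a * y.C.transpose * swapMat k s b).submatrix emb₃ emb₃ = 0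
      obtain ⟨c₁₁, c₁₂, c₁₃, c₂₁, c₂₂, c₂₃, c₃₁, c₃₂, c₃₃, hCeq⟩ := exists_eq_blk3 y.C
      rw [hCeq] at hC ⊢
      have hc : c₃₃ = 0 := hC
      subst hc
      simp only [swapMat, blk3_transpose, blk3_mul, Matrix.zero_mul, Matrix.mul_zero, add_zero,
        zero_add, Matrix.one_mul, Matrix.mul_one, Matrix.transpose_zero]
      rfl
  have := levi_mem_stratum isInvPair_swapMat isInvPair_swapMat (stdSet_subset_stratum hstd)
  rwa [Tup.levi_levi_of_isInvPair isInvPair_swapMat isInvPair_swapMat] at this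

/-- If `A` has no homology, then neither `C` nor `F` induce anything on homology. -/
theorem tr_mem_stratum_zero {x : Tup k U W} (hx : x ∈ stratum k U W r 0 s b) :
    Tup.tr x ∈ stratum k U W r 0 s b := by
  obtain ⟨p, p', q, q', hp, hq, y, hy, rfl⟩ := hx
  exact tr_levi_mem_stratum hp hq hy.1 hy.2.1 hy.2.2.1 (by ext _ j; exact j.elim0)

theorem isHomeomorph_tr : IsHomeomorph (Tup.tr (k := k) (U := U) (W := W)) :=
  (⟨⟨Tup.tr, Tup.tr, Tup.tr_tr, Tup.tr_tr⟩, continuous_linearMap _, continuous_linearMap _⟩ :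
    Tup k U W ≃ₜ Tup k U W).isHomeomorph

/-! ### The strata are dense -/

theorem rank_levi_D {p : Matrix U' U k} {p' : Matrix U U' k} {q : Matrix W' W k}
    {q' : Matrix W W' k} (hq : IsInvPair q q') (x : Tup k U W) :
    (Tup.levi p p' q q' x).D.rank = x.D.rank := by
  have h : ∀ {W W' : Type} [Fintype W] [Fintype W'] (q : Matrix W' W k) (q' : Matrix W W' k)
      (D : Matrix W W k), (q * D * q').rank ≤ D.rank := fun q q' D =>
    (Matrix.rank_mul_le_left _ _).trans (Matrix.rank_mul_le_right _ _)
  refine (h q q' x.D).antisymm ?_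
  have := h q' q (q * x.D * q')
  rwa [show q' * (q * x.D * q') * q = (q' * q) * x.D * (q' * q) by simp only [Matrix.mul_assoc],
    hq.2, Matrix.one_mul, Matrix.mul_one] at this

/-- A closed set containing all the strata for which the homology of `D` has dimension at
most one, and their transposes if this dimension is one, contains all tuples of square zero. -/
theorem sqZero_subset_of_isClosed [CharP k 2] [IsAlgClosed k] {δ : ℕ} (hδ : δ ≤ 1)
    (hW : Fintype.card W = 2 * s + δ) {C : Set (Tup k U W)} (hC : IsClosed C)
    (h : ∀ r a, Fintype.card U = 2 * r + a → stratum k U W r a s δ ⊆ C)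
    (h' : δ = 1 → ∀ r a, Fintype.card U = 2 * r + a → Tup.tr ⁻¹' stratum k U W r a s δ ⊆ C) :
    Tup.sqZero k U W ⊆ C := by
  suffices H : ∀ N, ∀ x ∈ Tup.sqZero k U W, Fintype.card W - x.D.rank = N → x ∈ C from
    fun x hx => H _ x hx rfl
  -- Induction on the corank of `D`: as long as its homology has dimension at least two, the point
  -- lies on a line all other points of which have larger rank.
  intro N
  induction N using Nat.strong_induction_on with
  | _ N ih =>
  intro x hx hN
  obtain ⟨r, a, p, p', hp1, hp2, hA, hcU⟩ := exists_eq_sqNormal x.A hx.1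
  obtain ⟨s', b, q, q', hq1, hq2, hD, hcW⟩ := exists_eq_sqNormal x.D hx.2.2.2.1
  have hp : IsInvPair p p' := ⟨hp1, hp2⟩
  have hq : IsInvPair q q' := ⟨hq1, hq2⟩
  set y := Tup.levi p' p q' q x with hy
  have hxy : Tup.levi p p' q q' y = x := Tup.levi_levi_of_isInvPair hp.symm hq.symm x
  have hys : y ∈ Tup.sqZero k _ _ := Tup.levi_mem_sqZero hp1 hq1 hx
  have hyA : y.A = sqNormal k r a := by
    change p' * x.A * p = _
    rw [hA, show p' * (p * sqNormal k r a * p') * p = (p' * p) * sqNormal k r a * (p' * p) by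
      simp only [Matrix.mul_assoc], hp2, Matrix.one_mul, Matrix.mul_one]
  have hyD : y.D = sqNormal k s' b := by
    change q' * x.D * q = _
    rw [hD, show q' * (q * sqNormal k s' b * q') * q = (q' * q) * sqNormal k s' b * (q' * q) by
      simp only [Matrix.mul_assoc], hq2, Matrix.one_mul, Matrix.mul_one]
  rcases Nat.lt_or_ge b 2 with hb | hb
  · obtain ⟨rfl, rfl⟩ : s' = s ∧ b = δ := by omega
    by_cases hF : y.F.submatrix emb₃ emb₃ = 0
    · exact h r a hcU ⟨p, p', q, q', hp, hq, y, ⟨hys, hyA, hyD, hF⟩, hxy⟩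
    obtain rfl | rfl : b = 0 ∨ b = 1 := by omega
    · exact absurd (by ext _ j; exact j.elim0) hF
    refine h' rfl r a hcU ?_
    rw [Set.mem_preimage, ← hxy]
    refine tr_levi_mem_stratum hp hq hys hyA hyD ?_
    obtain ⟨-, h2, h3, -, h5⟩ := hys
    rw [hyA, hyD] at h3 h5
    rw [hyA] at h2
    rw [add_comm] at h3
    obtain ⟨c₁₁, c₁₂, c₁₃, c₃₂, c₃₃, hCeq⟩ := exists_eq_of_intertwine h3
    obtain ⟨f₁₁, f₁₂, f₁₃, f₃₂, f₃₃, hFeq⟩ := exists_eq_of_intertwine h5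
    obtain ⟨b₁₁, b₁₂, b₁₃, b₂₁, b₂₂, b₂₃, b₃₁, b₃₂, b₃₃, hBeq⟩ := exists_eq_blk3 y.B
    rw [hCeq, hFeq, hBeq] at h2
    simp only [sqNormal, blk3_mul, blk3_add, Matrix.mul_zero, Matrix.zero_mul,
      Matrix.mul_one, Matrix.one_mul, add_zero, zero_add, blk3_zero, blk3_inj] at h2
    have hfc : f₃₃ * c₃₃ = 0 := h2.2.2.2.2.2.2.2.2
    rw [hCeq]
    rw [hFeq] at hF
    change c₃₃ = 0
    change f₃₃ ≠ 0 at hF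
    -- The product of the column `f₃₃` and the row `c₃₃` vanishes.
    obtain ⟨i, hi⟩ : ∃ i, f₃₃ i 0 ≠ 0 := by
      by_contra! hcon
      refine hF ?_
      ext i j
      rw [Subsingleton.elim j 0]
      exact hcon i
    ext j l
    have := congrFun (congrFun hfc i) l
    rw [Matrix.mul_apply, Fin.sum_univ_one] at this
    rw [Subsingleton.elim j 0]
    exact (mul_eq_zero.1 this).resolve_left hi
  · obtain ⟨z, hz, hrank⟩ := exists_line_of_normal hb hys hyA hyD
    have hreg : IsRegularAway (1 : polyFun k k) fun c : k => y + c • z :=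
      (isRegularAway_const y).add ((isRegularAway_const z).smul
        (polyFun_le_regularAway _ id_mem_polyFun))
    have := (hreg.linearMap_comp (Tup.levi p p' q q')).mem_of_isClosed hC (h := fun c => c)
      (polyFun_le_regularAway _ id_mem_polyFun) (t₀ := 1) (by simp)
      one_ne_zero (fun c _ hc => by
        refine ih _ ?_ _ (Tup.levi_mem_sqZero hp2 hq2 (hz c)) rfl
        have h1 := hrank c hc
        have h2 : x.D.rank = y.D.rank := by rw [← hxy, rank_levi_D hq]
        have h3 := (Tup.levi p p' q q' (y + c • z)).D.rank_le_card_height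
        rw [rank_levi_D hq] at h3 ⊢
        omega) (t := 0) (by simp)
    rwa [zero_smul, add_zero, hxy] at this

/-! ### The closures of the strata are different -/

variable (k U W) in
/-- The tuples for which all minors of order `r` of `A` vanish. -/
def minorsVanish (r : ℕ) : Set (Tup k U W) :=
  {x | ∀ (P : Matrix (Fin r) U k) (Q : Matrix U (Fin r) k), (P * x.A * Q).det = 0}

theorem isClosed_minorsVanish : IsClosed (minorsVanish k U W r) := by
  simp only [minorsVanish, Set.ofPred_forall]
  refine isClosed_iInter fun P => isClosed_iInter fun Q => ?_
  let f : Tup k U W →ₗ[k] Matrix (Fin r) (Fin r) k :=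
    ⟨⟨fun x => P * x.A * Q, fun x y => by simp [Matrix.mul_add, Matrix.add_mul]⟩,
      fun c x => by simp⟩
  exact isClosed_zeroSet (k := k) (det_mem_polyFun f)

theorem tr_mem_minorsVanish {x : Tup k U W} (hx : x ∈ minorsVanish k U W r) :
    Tup.tr x ∈ minorsVanish k U W r := fun P Q => by
  rw [← hx Q.transpose P.transpose, ← Matrix.det_transpose]
  simp [Tup.tr_apply, Matrix.mul_assoc]

theorem exists_mul_eq_sqNormal : ∃ (X : Matrix (Fin r ⊕ Fin r ⊕ Fin a) (Fin r) k)
    (Y : Matrix (Fin r) (Fin r ⊕ Fin r ⊕ Fin a) k), X * Y = sqNormal k r a := by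
  refine ⟨(1 : Matrix (Fin r ⊕ Fin r ⊕ Fin a) (Fin r ⊕ Fin r ⊕ Fin a) k).submatrix id Sum.inl,
    (1 : Matrix (Fin r ⊕ Fin r ⊕ Fin a) (Fin r ⊕ Fin r ⊕ Fin a) k).submatrix emb₂ id, ?_⟩
  ext (i | i | i) (j | j | j) <;>
    simp [sqNormal, blk3, Matrix.mul_apply, Matrix.one_apply]

theorem exists_mul_sqNormal_mul_eq_one : ∃ (X : Matrix (Fin r) (Fin r ⊕ Fin r ⊕ Fin a) k)
    (Y : Matrix (Fin r ⊕ Fin r ⊕ Fin a) (Fin r) k), X * sqNormal k r a * Y = 1 := by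
  refine ⟨(1 : Matrix (Fin r ⊕ Fin r ⊕ Fin a) (Fin r ⊕ Fin r ⊕ Fin a) k).submatrix Sum.inl id,
    (1 : Matrix (Fin r ⊕ Fin r ⊕ Fin a) (Fin r ⊕ Fin r ⊕ Fin a) k).submatrix id emb₂, ?_⟩
  ext i j
  simp [Matrix.mul_apply, Matrix.one_apply, sqNormal, blk3]

theorem stratum_subset_minorsVanish {r' : ℕ} (h : r < r') :
    stratum k U W r a s b ⊆ minorsVanish k U W r' := by
  rintro _ ⟨p, p', q, q', hp, hq, x₀, hx₀, rfl⟩ P Q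
  obtain ⟨X, Y, hXY⟩ := exists_mul_eq_sqNormal (k := k) (r := r) (a := a)
  by_contra hdet
  have hrank := Matrix.rank_of_isUnit _
    ((Matrix.isUnit_iff_isUnit_det _).2 (isUnit_iff_ne_zero.2 hdet))
  have heq : P * (Tup.levi p p' q q' x₀).A * Q = (P * p * X) * (Y * p' * Q) := by
    rw [Tup.levi_apply, hx₀.2.1, ← hXY]
    simp only [Matrix.mul_assoc]
  have h1 := Matrix.rank_mul_le_left (P * p * X) (Y * p' * Q)
  rw [← heq, hrank, Fintype.card_fin] at h1
  have h2 := (P * p * X).rank_le_card_width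
  rw [Fintype.card_fin] at h2
  omega

theorem notMem_minorsVanish_of_mem_stratum {x : Tup k U W} (hx : x ∈ stratum k U W r a s b) :
    x ∉ minorsVanish k U W r := by
  obtain ⟨p, p', q, q', hp, hq, x₀, hx₀, rfl⟩ := hx
  intro h
  obtain ⟨X, Y, hXY⟩ := exists_mul_sqNormal_mul_eq_one (k := k) (r := r) (a := a)
  have := h (X * p') (p * Y)
  rw [Tup.levi_apply, hx₀.2.1, show X * p' * (p * sqNormal k r a * p') * (p * Y) =
    X * ((p' * p) * sqNormal k r a * (p' * p)) * Y by simp only [Matrix.mul_assoc], hp.2,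
    Matrix.one_mul, Matrix.mul_one, hXY, Matrix.det_one] at this
  exact one_ne_zero this

/-- The map induced by `F` on homology is a regular function near the tuples in normal form, so its
vanishing persists in the closure of a stratum. -/
theorem homology_F_eq_zero_of_mem_closure [CharP k 2] [Infinite k]
    {x : Tup k (Fin r ⊕ Fin r ⊕ Fin a) (Fin s ⊕ Fin s ⊕ Fin b)}
    (hx : x ∈ closure (stratum k _ _ r a s b)) (hA : x.A = sqNormal k r a)
    (hD : x.D = sqNormal k s b) : x.F.submatrix emb₃ emb₃ = 0 := by
  have h1 : ∀ r a, sliceRead (sqNormal k r a) = (1, 0, 0, 0) := fun r a => by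
    simp only [sliceRead, Prod.mk.injEq]
    refine ⟨rfl, rfl, rfl, ?_⟩
    exact Matrix.mul_zero _
  have h2 : ∀ r a, sliceMat ((1, 0, 0, 0) : SliceParam k r a) = 1 :=
    fun r a => blk3_one.symm
  have h3 : ∀ r a, sliceInv ((1, 0, 0, 0) : SliceParam k r a) = 1 := fun r a => by
    simp [sliceInv, blk3_one]
  have hstd : toStd x = x := by
    rw [toStd, hA, hD, h1, h1, h2, h2, h3, h3, Tup.levi_one]
  have hreg := ((isRegularAway_sliceRead_toStd (k := k) (r := r) (a := a) (s := s)
    (b := b)).2.2.linearMap_comp Tup.linF)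
  rw [isRegularAway_matrix_iff] at hreg
  ext i j
  have := regularAway_eq_zero_of_mem_closure (hreg (emb₃ i) (emb₃ j))
    (S := stratum k _ _ r a s b) (by
      rintro _ ⟨p, p', q, q', hp, hq, x₀, hx₀, rfl⟩ hy
      exact congrFun (congrFun (toStd_mem_stdSet hx₀ hp.1 hq.1 rfl hy).2.2.2 i) j) hx
    (by rw [coverDet_eq_one hA hD]; exact one_ne_zero)
  rw [hstd] at this
  exact this

/-- A tuple with `C = 0` for which `F` does not vanish on homology is in the transpose of the
stratum, but not in its closure. -/
theorem closure_stratum_ne_preimage_tr [CharP k 2] [Infinite k]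
    (hU : Fintype.card U = 2 * r + a) (hW : Fintype.card W = 2 * s + b) (ha : a ≠ 0)
    (hb : b ≠ 0) :
    closure (stratum k U W r a s b) ≠ Tup.tr ⁻¹' closure (stratum k U W r a s b) := by
  obtain ⟨p, p', hp⟩ := IsInvPair.exists_of_card_eq (k := k) (U := U)
    (V := Fin r ⊕ Fin r ⊕ Fin a) (by simp [hU]; ring)
  obtain ⟨q, q', hq⟩ := IsInvPair.exists_of_card_eq (k := k) (U := W)
    (V := Fin s ⊕ Fin s ⊕ Fin b) (by simp [hW]; ring)
  let z : Tup k (Fin r ⊕ Fin r ⊕ Fin a) (Fin s ⊕ Fin s ⊕ Fin b) :=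
    ⟨sqNormal k r a, 0, 0, sqNormal k s b, blk3 0 0 0 0 0 0 0 0 (Matrix.of fun _ _ => 1)⟩
  have hz : z ∈ Tup.sqZero k _ _ := by
    refine ⟨sqNormal_mul_self r a, ?_, ?_, sqNormal_mul_self s b, intertwine_blk3 ..⟩ <;> simp [z]
  intro heq
  have hmem : Tup.levi p p' q q' z ∈ closure (stratum k U W r a s b) := by
    rw [heq]
    exact subset_closure (tr_levi_mem_stratum hp hq hz rfl rfl rfl)
  have hmem' : z ∈ closure (stratum k _ _ r a s b) := by
    have := image_closure_subset_closure_image (continuous_linearMap (Tup.levi p' p q' q))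
      ⟨_, hmem, Tup.levi_levi_of_isInvPair hp hq z⟩
    refine closure_mono ?_ this
    rintro _ ⟨x, hx, rfl⟩
    exact levi_mem_stratum hp.symm hq.symm hx
  have := homology_F_eq_zero_of_mem_closure hmem' rfl rfl
  exact one_ne_zero (congrFun (congrFun this ⟨0, Nat.pos_of_ne_zero ha⟩)
    ⟨0, Nat.pos_of_ne_zero hb⟩)

end Strata

/-! ### The irreducible components of the square-zero tuples -/

section TupComponents

universe u

variable {k : Type u} [Field k] [CharP k 2] [IsAlgClosed k] {U W : Type} [Fintype U] [Fintype W]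
  [DecidableEq U] [DecidableEq W] {i s b r r' a a' : ℕ}

theorem closure_stratum_subset_sqZero :
    closure (stratum k U W r a s b) ⊆ Tup.sqZero k U W :=
  closure_minimal stratum_subset_sqZero Tup.isClosed_sqZero

theorem preimage_tr_closure_stratum_subset_sqZero :
    Tup.tr ⁻¹' closure (stratum k U W r a s b) ⊆ Tup.sqZero k U W := fun _ hx =>
  Tup.tr_mem_sqZero (closure_stratum_subset_sqZero hx)

theorem isClosed_preimage_tr {C : Set (Tup k U W)} (hC : IsClosed C) :
    IsClosed (Tup.tr ⁻¹' C) := hC.preimage (continuous_linearMap Tup.tr)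

theorem isIrreducible_preimage_tr {C : Set (Tup k U W)} (hC : IsIrreducible C) :
    IsIrreducible (Tup.tr ⁻¹' C) :=
  hC.preimage_of_isInducing isHomeomorph_tr.isInducing
    (by rw [isHomeomorph_tr.surjective.range_eq]; exact Set.subset_univ _)

theorem topologicalKrullDim_preimage_tr (C : Set (Tup k U W)) :
    topologicalKrullDim (Tup.tr ⁻¹' C : Set (Tup k U W)) = topologicalKrullDim C := by
  have h : ∀ C : Set (Tup k U W), topologicalKrullDim (Tup.tr ⁻¹' C : Set (Tup k U W)) ≤
      topologicalKrullDim C := fun C =>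
    ((isHomeomorph_tr.isInducing.comp .subtypeVal).codRestrict (s := C) fun x => x.2 :
      Topology.IsInducing fun x : (Tup.tr ⁻¹' C : Set (Tup k U W)) =>
        (⟨Tup.tr x.1, x.2⟩ : C)).topologicalKrullDim_le
  exact (h C).antisymm (h (Tup.tr ⁻¹' C))

/-- A stratum is not contained in a closed set on which smaller minors vanish. -/
theorem not_subset_minorsVanish (hU : Fintype.card U = 2 * r + a)
    (hW : Fintype.card W = 2 * s + b) :
    ¬ closure (stratum k U W r a s b) ⊆ minorsVanish k U W r := fun h => by
  obtain ⟨x, hx⟩ := (isIrreducible_closure_stratum (k := k) hU hW).nonempty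
  obtain ⟨y, hy⟩ := closure_nonempty_iff.1 ⟨x, hx⟩
  exact notMem_minorsVanish_of_mem_stratum hy (h (subset_closure hy))

theorem closure_stratum_subset_minorsVanish (h : r < r') :
    closure (stratum k U W r a s b) ⊆ minorsVanish k U W r' :=
  closure_minimal (stratum_subset_minorsVanish h) isClosed_minorsVanish

/-- The number of Jordan blocks of size two of `A` is determined by the closure of a stratum, even
up to transposition. -/
theorem eq_of_closure_stratum_eq (hU : Fintype.card U = 2 * r + a)
    (hU' : Fintype.card U = 2 * r' + a') (hW : Fintype.card W = 2 * s + b)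
    (h : closure (stratum k U W r a s b) = closure (stratum k U W r' a' s b) ∨
      closure (stratum k U W r a s b) = Tup.tr ⁻¹' closure (stratum k U W r' a' s b)) :
    r = r' := by
  by_contra hne
  rcases Nat.lt_or_gt_of_ne hne with hlt | hlt
  · refine not_subset_minorsVanish (k := k) hU' hW ?_
    rcases h with h | h
    · rw [← h]
      exact closure_stratum_subset_minorsVanish hlt
    · intro x hx
      have hx' : Tup.tr x ∈ closure (stratum k U W r a s b) := by
        rw [h]
        exact hx
      have := tr_mem_minorsVanish (closure_stratum_subset_minorsVanish hlt hx')
      rwa [Tup.tr_tr] at this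
  · refine not_subset_minorsVanish (k := k) hU hW ?_
    rcases h with h | h
    · rw [h]
      exact closure_stratum_subset_minorsVanish hlt
    · rw [h]
      intro x hx
      have := tr_mem_minorsVanish (closure_stratum_subset_minorsVanish hlt hx)
      rwa [Tup.tr_tr] at this

/-- For `W` of even dimension the components are the closures of the strata with `D` exact, one for
each rank of `A`. -/
theorem exists_components_even (hU : Fintype.card U = i) (hW : Fintype.card W = 2 * s) :
    ∃ Z : Fin (i / 2 + 1) → Set (Tup k U W), (∀ j, IsClosed (Z j)) ∧
      (∀ j, IsIrreducible (Z j)) ∧ (∀ j, Z j ⊆ Tup.sqZero k U W) ∧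
      (∀ x ∈ Tup.sqZero k U W, ∃ j, x ∈ Z j) ∧
      (∀ j, topologicalKrullDim (Z j) = (i ^ 2 + 2 * s ^ 2 + 2 * s * i : ℕ)) ∧
      Function.Injective Z := by
  have hcard : ∀ j : Fin (i / 2 + 1), Fintype.card U = 2 * (j : ℕ) + (i - 2 * j) := fun j => by
    have := j.2
    omega
  refine ⟨fun j => closure (stratum k U W j (i - 2 * j) s 0), fun j => isClosed_closure,
    fun j => isIrreducible_closure_stratum (hcard j) hW, fun j => closure_stratum_subset_sqZero,
    fun x hx => ?_, fun j => ?_, fun j j' h => ?_⟩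
  · have := sqZero_subset_of_isClosed (δ := 0) zero_le_one hW
      (C := ⋃ j : Fin (i / 2 + 1), closure (stratum k U W j (i - 2 * j) s 0))
      (isClosed_iUnion_of_finite fun j => isClosed_closure) (fun r a hra => by
        obtain rfl : a = i - 2 * r := by omega
        exact subset_closure.trans (Set.subset_iUnion (fun j : Fin (i / 2 + 1) =>
          closure (stratum k U W j (i - 2 * j) s 0)) ⟨r, by omega⟩))
      (fun h => absurd h zero_ne_one) hx
    simpa using this
  · rw [topologicalKrullDim_closure_stratum (hcard j) hW, finrank_chartParam]
    have := hcard j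
    rw [hU] at this
    generalize i - 2 * (j : ℕ) = a at this ⊢
    generalize (j : ℕ) = t at this ⊢
    congr 1
    rw [this]
    ring
  · exact Fin.ext (eq_of_closure_stratum_eq (hcard j) (hcard j') hW (.inl h))

/-- For `W` of odd dimension the components are the closures of the strata for which the homology
of `D` is one-dimensional, and their transposes; the two coincide if `A` is exact. -/
theorem exists_components_odd (hU : Fintype.card U = i) (hW : Fintype.card W = 2 * s + 1) :
    ∃ Z : Fin (i / 2 + 1) ⊕ Fin ((i + 1) / 2) → Set (Tup k U W), (∀ j, IsClosed (Z j)) ∧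
      (∀ j, IsIrreducible (Z j)) ∧ (∀ j, Z j ⊆ Tup.sqZero k U W) ∧
      (∀ x ∈ Tup.sqZero k U W, ∃ j, x ∈ Z j) ∧
      (∀ j, topologicalKrullDim (Z j) = (i ^ 2 + 2 * s ^ 2 + 2 * s + i + 2 * s * i : ℕ)) ∧
      Function.Injective Z := by
  have hcard : ∀ j, 2 * j ≤ i → Fintype.card U = 2 * j + (i - 2 * j) := fun j hj => by omega
  have hl : ∀ j : Fin (i / 2 + 1), 2 * (j : ℕ) ≤ i := fun j => by
    have := j.2
    omega
  have hr : ∀ j : Fin ((i + 1) / 2), 2 * (j : ℕ) < i := fun j => by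
    have := j.2
    omega
  have hdim : ∀ j, 2 * j ≤ i → topologicalKrullDim (closure (stratum k U W j (i - 2 * j) s 1)) =
      (i ^ 2 + 2 * s ^ 2 + 2 * s + i + 2 * s * i : ℕ) := fun j hj => by
    rw [topologicalKrullDim_closure_stratum (hcard j hj) hW, finrank_chartParam]
    have := hcard j hj
    rw [hU] at this
    generalize i - 2 * j = a at this ⊢
    congr 1
    rw [this]
    ring
  let Z : Fin (i / 2 + 1) ⊕ Fin ((i + 1) / 2) → Set (Tup k U W) :=
    Sum.elim (fun j => closure (stratum k U W j (i - 2 * j) s 1))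
      fun j => Tup.tr ⁻¹' closure (stratum k U W j (i - 2 * j) s 1)
  have hZc : ∀ j, IsClosed (Z j) := by
    rintro (j | j)
    · exact isClosed_closure
    · exact isClosed_preimage_tr isClosed_closure
  refine ⟨Z, hZc, ?_, ?_, fun x hx => ?_, ?_, ?_⟩
  · rintro (j | j)
    · exact isIrreducible_closure_stratum (hcard j (hl j)) hW
    · exact isIrreducible_preimage_tr (isIrreducible_closure_stratum (hcard j (hr j).le) hW)
  · rintro (j | j)
    · exact closure_stratum_subset_sqZero
    · exact preimage_tr_closure_stratum_subset_sqZero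
  · have := sqZero_subset_of_isClosed (δ := 1) le_rfl hW (C := ⋃ j, Z j)
      (isClosed_iUnion_of_finite hZc) (fun r a hra => by
        obtain rfl : a = i - 2 * r := by omega
        exact subset_closure.trans (Set.subset_iUnion Z (.inl ⟨r, by omega⟩)))
      (fun _ r a hra => by
        obtain rfl : a = i - 2 * r := by omega
        by_cases hri : 2 * r < i
        · exact (Set.preimage_mono subset_closure).trans
            (Set.subset_iUnion Z (.inr ⟨r, by omega⟩))
        · have h0 : i - 2 * r = 0 := by omega
          refine Set.Subset.trans (fun x hx => ?_) (Set.subset_iUnion Z (.inl ⟨r, by omega⟩))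
          refine subset_closure ?_
          change x ∈ stratum k U W r (i - 2 * r) s 1
          rw [Set.mem_preimage] at hx
          rw [h0] at hx ⊢
          simpa only [Tup.tr_tr] using tr_mem_stratum_zero hx) hx
    simpa only [Set.mem_iUnion] using this
  · rintro (j | j)
    · exact hdim j (hl j)
    · exact (topologicalKrullDim_preimage_tr _).trans (hdim j (hr j).le)
  · have hne : ∀ (j : Fin (i / 2 + 1)) (j' : Fin ((i + 1) / 2)), Z (.inl j) ≠ Z (.inr j') := by
      intro j j' h
      have hjj : (j : ℕ) = j' :=
        eq_of_closure_stratum_eq (hcard j (hl j)) (hcard j' (hr j').le) hW (.inr h)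
      change closure (stratum k U W j (i - 2 * j) s 1) =
        Tup.tr ⁻¹' closure (stratum k U W j' (i - 2 * j') s 1) at h
      rw [hjj] at h
      exact closure_stratum_ne_preimage_tr (hcard j' (hr j').le) hW
        (by have := hr j'; omega) one_ne_zero h
    rintro (j | j) (j' | j') h
    · exact congrArg _ (Fin.ext (eq_of_closure_stratum_eq (hcard j (hl j)) (hcard j' (hl j')) hW
        (.inl h)))
    · exact absurd h (hne j j')
    · exact absurd h.symm (hne j' j)
    · have h' := isHomeomorph_tr.surjective.preimage_injective h
      exact congrArg _ (Fin.ext (eq_of_closure_stratum_eq (hcard j (hr j).le)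
        (hcard j' (hr j').le) hW (.inl h')))

end TupComponents

/-! ### The centralizer of a matrix with Jordan blocks of size at most two -/

section Centralizer

theorem stdBasis_repr_apply {k : Type*} [Field k] {n : ℕ} (x : Matrix (Fin n) (Fin n) k)
    (p : Fin n × Fin n) : (Matrix.stdBasis k (Fin n) (Fin n)).repr x p = x p.1 p.2 := by
  have : (Matrix.stdBasis k (Fin n) (Fin n)).coord p = Matrix.entryLinearMap k k p.1 p.2 := by
    refine (Matrix.stdBasis k (Fin n) (Fin n)).ext fun q => ?_
    rw [Module.Basis.coord_apply, Module.Basis.repr_self, ← Prod.mk.eta (p := q),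
      Matrix.stdBasis_eq_single]
    simp [Matrix.single_apply, Finsupp.single_apply, Prod.ext_iff]
  exact LinearMap.congr_fun this x

/-- The Zariski topology defined by the matrix entries is the intrinsic one. -/
instance isZariski_matrix {k : Type*} [Field k] {n : ℕ} : IsZariski k (Matrix (Fin n) (Fin n) k) :=
  ⟨fun C => by
    let b := Matrix.stdBasis k (Fin n) (Fin n)
    have hb : ∀ (f : MvPolynomial (Fin n × Fin n) k) (x : Matrix (Fin n) (Fin n) k),
        basisEval b f x = MvPolynomial.aeval (fun p : Fin n × Fin n => x p.1 p.2) f := fun f x => by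
      rw [basisEval_apply, MvPolynomial.aeval_eq_eval]
      simp only [b, stdBasis_repr_apply]
    let := zariskiTopology k (Fin n × Fin n)
    rw [isClosed_induced_iff]
    constructor
    · rintro ⟨D, hD, rfl⟩
      rw [← isOpen_compl_iff] at hD
      change Dᶜᶜ ∈ _ at hD
      rw [compl_compl] at hD
      obtain ⟨I, rfl⟩ := hD
      refine ⟨basisEval b '' I, ?_, ?_⟩
      · rintro _ ⟨f, -, rfl⟩
        rw [← range_basisEval b]
        exact ⟨f, rfl⟩
      · ext x
        simp only [Set.mem_preimage, MvPolynomial.mem_zeroLocus_iff, Set.mem_image,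
          Set.mem_ofPred_eq, forall_exists_index, and_imp, forall_apply_eq_imp_iff₂, hb]
        rfl
    · rintro ⟨P, hP, rfl⟩
      refine ⟨MvPolynomial.zeroLocus k (Ideal.span (basisEval b ⁻¹' P)), ?_, ?_⟩
      · rw [← isOpen_compl_iff]
        change _ᶜᶜ ∈ _
        rw [compl_compl]
        exact ⟨_, rfl⟩
      · ext x
        rw [MvPolynomial.zeroLocus_span]
        simp only [Set.mem_preimage, Set.mem_ofPred_eq, ← hb]
        refine ⟨fun h f hf => ?_, fun h f hf => h _ hf⟩
        have hf' := hP hf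
        rw [← range_basisEval b] at hf'
        obtain ⟨q, rfl⟩ := hf'
        exact h q hf⟩

/-- The square-zero matrix with Jordan blocks indexed by `U` (of size two) and `W` (of size one):
the first copy of `U` is mapped identically to the last one. -/
def blockNilpotent (k : Type*) [Field k] (U W : Type) [DecidableEq U] :
    Matrix (U ⊕ W ⊕ U) (U ⊕ W ⊕ U) k := blk3 0 0 0 0 0 0 1 0 0

/-- Sorting the Jordan blocks by their size. -/
theorem exists_conj_blockNilpotent {k : Type*} [Field k] {n i m : ℕ}
    {e : Matrix (Fin n) (Fin n) k}
    (he : HasPartitionType e (Multiset.replicate i 2 + Multiset.replicate m 1)) :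
    ∃ (U W : Type) (_ : Fintype U) (_ : Fintype W) (_ : DecidableEq U) (_ : DecidableEq W)
      (Q : Matrix (Fin n) (U ⊕ W ⊕ U) k) (Q' : Matrix (U ⊕ W ⊕ U) (Fin n) k),
      Fintype.card U = i ∧ Fintype.card W = m ∧ IsInvPair Q Q' ∧
        e = Q * blockNilpotent k U W * Q' := by
  obtain ⟨t, s, f, hs, c, hc⟩ := he
  have hcount : ∀ v, Fintype.card {x // s x = v} =
      (Multiset.replicate i 2 + Multiset.replicate m 1).count v := fun v => by
    rw [← hs, Multiset.count_map, Fintype.card_subtype]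
    simp [Finset.card_def, eq_comm]
  have hs12 : ∀ x, s x = 2 ∨ s x = 1 := fun x => by
    have : s x ∈ Multiset.replicate i 2 + Multiset.replicate m 1 := by
      rw [← hs]
      exact Multiset.mem_map_of_mem s (Finset.mem_univ x)
    rw [Multiset.mem_add] at this
    exact this.imp Multiset.eq_of_mem_replicate Multiset.eq_of_mem_replicate
  let U := {x // s x = 2}
  let W := {x // s x = 1}
  -- The vector with index `1` of a block of size two is mapped to the one with index `0`.
  let g₀ : U ⊕ W ⊕ U → Σ x, Fin (s x)
    | .inl u => ⟨u, ⟨1, by have := u.2; omega⟩⟩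
    | .inr (.inl w) => ⟨w, ⟨0, by have := w.2; omega⟩⟩
    | .inr (.inr u) => ⟨u, ⟨0, by have := u.2; omega⟩⟩
  have hval : ∀ (p q : Σ x, Fin (s x)), p = q ↔ p.1 = q.1 ∧ (p.2 : ℕ) = q.2 := by
    rintro ⟨a, x⟩ ⟨b, y⟩
    constructor
    · rintro ⟨⟩
      exact ⟨rfl, rfl⟩
    · rintro ⟨h1, h2⟩
      obtain rfl : a = b := h1
      obtain rfl : x = y := Fin.ext h2
      rfl
  have hg₀ : Function.Bijective g₀ := by
    constructor
    · rintro (u | u | u) (v | v | v) h <;> rw [hval] at h <;> obtain ⟨h1, h2⟩ := h <;>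
        simp only [g₀] at h1 h2
      · rw [Subtype.ext h1]
      · exact absurd h2 one_ne_zero
      · exact absurd h2 one_ne_zero
      · exact absurd h2.symm one_ne_zero
      · rw [Subtype.ext h1]
      · have hu := u.2
        have hv := v.2
        rw [h1] at hu
        omega
      · exact absurd h2.symm one_ne_zero
      · have hu := u.2
        have hv := v.2
        rw [h1] at hu
        omega
      · rw [Subtype.ext h1]
    · rintro ⟨a, x, hx⟩
      rcases hs12 a with h | h
      · have hx2 : x = 0 ∨ x = 1 := by omega
        rcases hx2 with rfl | rfl
        · exact ⟨.inr (.inr ⟨a, h⟩), rfl⟩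
        · exact ⟨.inl ⟨a, h⟩, rfl⟩
      · obtain rfl : x = 0 := by omega
        exact ⟨.inr (.inl ⟨a, h⟩), rfl⟩
  let g : U ⊕ W ⊕ U ≃ Fin n := (Equiv.ofBijective g₀ hg₀).trans f
  set J := Matrix.reindex f f (Matrix.blockDiagonal' fun a => nilpotentJordanBlock k (s a)) with hJ
  have hblock : ∀ p q : Σ x, Fin (s x),
      Matrix.blockDiagonal' (fun a => nilpotentJordanBlock k (s a)) p q =
        if p.1 = q.1 ∧ (p.2 : ℕ) + 1 = q.2 then 1 else 0 := by
    rintro ⟨a, x⟩ ⟨b, y⟩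
    by_cases h : a = b
    · subst h
      simp [Matrix.blockDiagonal'_apply_eq, nilpotentJordanBlock]
    · simp [Matrix.blockDiagonal'_apply_ne _ _ _ h, h]
  have hJg : J.submatrix g g = blockNilpotent k U W := by
    have : J.submatrix g g =
        (Matrix.blockDiagonal' fun a => nilpotentJordanBlock k (s a)).submatrix g₀ g₀ := by
      ext p q
      simp [hJ, g]
    rw [this]
    ext (u | u | u) (v | v | v) <;>
      simp [hblock, g₀, blockNilpotent, blk3, Matrix.one_apply, ← Subtype.ext_iff]
    · intro h
      have hu := u.2
      rw [h, v.2] at hu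
      exact absurd hu (by norm_num)
  have hJ' : J = (1 : Matrix (Fin n) (Fin n) k).submatrix id g * blockNilpotent k U W *
      (1 : Matrix (Fin n) (Fin n) k).submatrix g id := by
    rw [← hJg, ← Matrix.submatrix_mul _ _ _ _ _ g.bijective, Matrix.one_mul,
      ← Matrix.submatrix_mul _ _ _ _ _ g.bijective, Matrix.mul_one, Matrix.submatrix_id_id]
  refine ⟨U, W, inferInstance, inferInstance, inferInstance, inferInstance,
    (c⁻¹).1 * (1 : Matrix (Fin n) (Fin n) k).submatrix id g,
    (1 : Matrix (Fin n) (Fin n) k).submatrix g id * c.1, ?_, ?_, ⟨?_, ?_⟩, ?_⟩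
  · rw [hcount]
    simp [Multiset.count_replicate]
  · rw [hcount]
    simp [Multiset.count_replicate]
  · rw [Matrix.mul_assoc, ← Matrix.mul_assoc (Matrix.submatrix 1 id g),
      ← Matrix.submatrix_mul _ _ _ _ _ g.bijective, Matrix.one_mul, Matrix.submatrix_id_id,
      Matrix.one_mul, Units.inv_mul]
  · rw [Matrix.mul_assoc, ← Matrix.mul_assoc c.1, Units.mul_inv, Matrix.one_mul,
      ← Matrix.submatrix_mul _ _ _ _ _ Function.bijective_id, Matrix.one_mul,
      Matrix.submatrix_one_equiv]
  · have hc' : c.1 * e = J * c.1 := hc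
    calc e = (c⁻¹).1 * (c.1 * e) := by rw [← Matrix.mul_assoc, Units.inv_mul, Matrix.one_mul]
      _ = (c⁻¹).1 * (J * c.1) := by rw [hc']
      _ = _ := by
        rw [hJ']
        simp only [Matrix.mul_assoc]

variable {k : Type*} [Field k] {n : ℕ} {U W : Type} [Fintype U] [Fintype W] [DecidableEq U]
  [DecidableEq W]

/-- The matrix of the endomorphism described by a tuple. -/
def tupMat (x : Tup k U W) : Matrix (U ⊕ W ⊕ U) (U ⊕ W ⊕ U) k :=
  blk3 x.A 0 0 x.C x.D 0 x.B x.F x.A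

theorem tupMat_commute (x : Tup k U W) :
    blockNilpotent k U W * tupMat x = tupMat x * blockNilpotent k U W := by
  simp [blockNilpotent, tupMat, blk3_mul]

theorem exists_tupMat_eq {M : Matrix (U ⊕ W ⊕ U) (U ⊕ W ⊕ U) k}
    (hM : blockNilpotent k U W * M = M * blockNilpotent k U W) : ∃ x, tupMat x = M := by
  obtain ⟨a, b, c, d, e, f, g, h, i, rfl⟩ := exists_eq_blk3 M
  simp only [blockNilpotent, blk3_mul, Matrix.zero_mul, Matrix.mul_zero, Matrix.one_mul,
    Matrix.mul_one, add_zero, zero_add, blk3_inj, true_and] at hM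
  obtain ⟨hc, hf, hi, hb, hc'⟩ := hM
  subst hi hf hb hc
  exact ⟨⟨_, g, d, e, h⟩, rfl⟩

theorem tupMat_sq_eq_zero [CharP k 2] {x : Tup k U W} :
    tupMat x * tupMat x = 0 ↔ x ∈ Tup.sqZero k U W := by
  simp only [tupMat, blk3_mul, blk3_zero, blk3_inj, Matrix.zero_mul, Matrix.mul_zero, add_zero,
    zero_add, true_and, Tup.sqZero, Set.mem_ofPred_eq]
  constructor
  · rintro ⟨h1, h2, h3, h4, h5, -⟩
    refine ⟨h1, ?_, h2, h3, ?_⟩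
    · rw [← h4]
      abel
    · rw [add_comm]
      exact h5
  · rintro ⟨h1, h2, h3, h4, h5⟩
    refine ⟨h1, h3, h4, ?_, ?_, h1⟩
    · rw [← h2]
      abel
    · rw [add_comm]
      exact h5

/-- The parametrization of the centralizer of a conjugate of `blockNilpotent k U W` by tuples. -/
def tupConj (Q : Matrix (Fin n) (U ⊕ W ⊕ U) k) (Q' : Matrix (U ⊕ W ⊕ U) (Fin n) k) :
    Tup k U W →ₗ[k] Matrix (Fin n) (Fin n) k where
  toFun x := Q * tupMat x * Q'
  map_add' x y := by
    rw [← Matrix.add_mul, ← Matrix.mul_add]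
    simp [tupMat, blk3_add]
  map_smul' c x := by
    rw [RingHom.id_apply, ← Matrix.smul_mul, ← Matrix.mul_smul]
    simp [tupMat, blk3_smul]

/-- The tuple of a matrix in the centralizer, defined for all matrices. -/
def tupRead (Q : Matrix (Fin n) (U ⊕ W ⊕ U) k) (Q' : Matrix (U ⊕ W ⊕ U) (Fin n) k) :
    Matrix (Fin n) (Fin n) k →ₗ[k] Tup k U W where
  toFun y :=
    ⟨(Q' * y * Q).submatrix .inl .inl, (Q' * y * Q).submatrix emb₃ .inl,
      (Q' * y * Q).submatrix emb₂ .inl, (Q' * y * Q).submatrix emb₂ emb₂,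
      (Q' * y * Q).submatrix emb₃ emb₂⟩
  map_add' x y := by
    ext1 <;> simp [Matrix.mul_add, Matrix.add_mul, Matrix.submatrix_add]
  map_smul' c x := by
    ext1 <;> simp [Matrix.submatrix_smul]

section Conj

variable {Q : Matrix (Fin n) (U ⊕ W ⊕ U) k} {Q' : Matrix (U ⊕ W ⊕ U) (Fin n) k}

theorem tupRead_tupConj (hQ : IsInvPair Q Q') (x : Tup k U W) : tupRead Q Q' (tupConj Q Q' x) = x := by
  have : Q' * (Q * tupMat x * Q') * Q = tupMat x := by
    rw [show Q' * (Q * tupMat x * Q') * Q = (Q' * Q) * tupMat x * (Q' * Q) by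
      simp only [Matrix.mul_assoc], hQ.2, Matrix.one_mul, Matrix.mul_one]
  simp only [tupRead, tupConj, LinearMap.coe_mk, AddHom.coe_mk, this]
  rfl

theorem range_tupConj (hQ : IsInvPair Q Q') : Set.range (tupConj (k := k) Q Q') =
    Subalgebra.centralizer k {Q * blockNilpotent k U W * Q'} := by
  have hmul : ∀ M N : Matrix (U ⊕ W ⊕ U) (U ⊕ W ⊕ U) k,
      (Q * M * Q') * (Q * N * Q') = Q * (M * N) * Q' := fun M N => by
    rw [show (Q * M * Q') * (Q * N * Q') = Q * (M * (Q' * Q) * N) * Q' by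
      simp only [Matrix.mul_assoc], hQ.2, Matrix.mul_one]
  ext y
  simp only [Set.mem_range, SetLike.mem_coe, Subalgebra.mem_centralizer_iff,
    Set.mem_singleton_iff, forall_eq]
  constructor
  · rintro ⟨x, rfl⟩
    change (Q * blockNilpotent k U W * Q') * (Q * tupMat x * Q') =
      (Q * tupMat x * Q') * (Q * blockNilpotent k U W * Q')
    rw [hmul, hmul, tupMat_commute]
  · intro hy
    have hy' : y = Q * (Q' * y * Q) * Q' := by
      rw [show Q * (Q' * y * Q) * Q' = (Q * Q') * y * (Q * Q') by
        simp only [Matrix.mul_assoc], hQ.1, Matrix.one_mul, Matrix.mul_one]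
    rw [hy', hmul, hmul] at hy
    have hcomm := congrArg (fun M => Q' * M * Q) hy
    have hcancel : ∀ M : Matrix (U ⊕ W ⊕ U) (U ⊕ W ⊕ U) k, Q' * (Q * M * Q') * Q = M := fun M => by
      rw [show Q' * (Q * M * Q') * Q = (Q' * Q) * M * (Q' * Q) by
        simp only [Matrix.mul_assoc], hQ.2, Matrix.one_mul, Matrix.mul_one]
    simp only [hcancel] at hcomm
    obtain ⟨x, hx⟩ := exists_tupMat_eq hcomm
    refine ⟨x, ?_⟩
    rw [hy', ← hx]
    rfl

theorem tupConj_mem_centralizerSquareZero (hQ : IsInvPair Q Q') [CharP k 2] {x : Tup k U W} :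
    tupConj Q Q' x ∈ centralizerSquareZero (Q * blockNilpotent k U W * Q') ↔
      x ∈ Tup.sqZero k U W := by
  have hx : tupConj Q Q' x ∈ Subalgebra.centralizer k {Q * blockNilpotent k U W * Q'} := by
    rw [← SetLike.mem_coe, ← range_tupConj hQ]
    exact ⟨x, rfl⟩
  rw [← tupMat_sq_eq_zero]
  change _ ∧ (Q * tupMat x * Q') ^ 2 = 0 ↔ _
  rw [pow_two, show (Q * tupMat x * Q') * (Q * tupMat x * Q') =
    Q * (tupMat x * (Q' * Q) * tupMat x) * Q' by simp only [Matrix.mul_assoc], hQ.2,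
    Matrix.mul_one]
  refine ⟨fun h => ?_, fun h => ⟨hx, by rw [h, Matrix.mul_zero, Matrix.zero_mul]⟩⟩
  have := congrArg (fun M => Q' * M * Q) h.2
  simp only [Matrix.mul_zero, Matrix.zero_mul] at this
  rwa [show Q' * (Q * (tupMat x * tupMat x) * Q') * Q =
    (Q' * Q) * (tupMat x * tupMat x) * (Q' * Q) by simp only [Matrix.mul_assoc], hQ.2,
    Matrix.one_mul, Matrix.mul_one] at this

theorem finrank_centralizer (hQ : IsInvPair Q Q') :
    Module.finrank k (Subalgebra.centralizer k {Q * blockNilpotent k U W * Q'}) =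
      2 * Fintype.card U ^ 2 + 2 * (Fintype.card U * Fintype.card W) + Fintype.card W ^ 2 := by
  rw [← Tup.finrank_eq (k := k)]
  have hr : LinearMap.range (tupConj Q Q') =
      Subalgebra.toSubmodule (Subalgebra.centralizer k {Q * blockNilpotent k U W * Q'}) :=
    SetLike.coe_injective (by
      rw [LinearMap.coe_range, range_tupConj hQ]
      rfl)
  have := LinearMap.finrank_range_of_inj (f := tupConj Q Q')
    (Function.LeftInverse.injective (tupRead_tupConj hQ))
  rw [hr] at this
  exact this

/-- The tuple of a matrix embeds the variety in question into the space of tuples. -/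
theorem exists_embedding_centralizerSquareZero (hQ : IsInvPair Q Q') [CharP k 2] :
    ∃ f : centralizerSquareZero (Q * blockNilpotent k U W * Q') → Tup k U W,
      Topology.IsInducing f ∧ Function.Injective f ∧ Set.range f = Tup.sqZero k U W := by
  have hinv : ∀ y ∈ centralizerSquareZero (Q * blockNilpotent k U W * Q'),
      tupConj Q Q' (tupRead Q Q' y) = y := fun y hy => by
    have : y ∈ Set.range (tupConj (k := k) Q Q') := by
      rw [range_tupConj hQ]
      exact hy.1
    obtain ⟨x, rfl⟩ := this
    rw [tupRead_tupConj hQ]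
  have hcont : Continuous (tupRead (k := k) Q Q') := continuous_linearMap (tupRead Q Q')
  have hcont' : Continuous (tupConj (k := k) Q Q') := continuous_linearMap (tupConj Q Q')
  refine ⟨fun y => tupRead Q Q' y, ?_, ?_, ?_⟩
  · refine .of_comp (hcont.comp continuous_subtype_val) hcont' ?_
    have : tupConj Q Q' ∘ (fun y : centralizerSquareZero (Q * blockNilpotent k U W * Q') =>
        tupRead Q Q' y.1) = Subtype.val := funext fun y => hinv y.1 y.2
    rw [this]
    exact .subtypeVal
  · intro y y' h
    have h' : tupRead Q Q' y.1 = tupRead Q Q' y'.1 := h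
    exact Subtype.ext (by rw [← hinv y.1 y.2, h', hinv y'.1 y'.2])
  · ext x
    constructor
    · rintro ⟨y, rfl⟩
      rw [← tupConj_mem_centralizerSquareZero hQ]
      change tupConj Q Q' (tupRead Q Q' y.1) ∈ _
      rw [hinv y.1 y.2]
      exact y.2
    · intro hx
      exact ⟨⟨_, (tupConj_mem_centralizerSquareZero hQ).2 hx⟩, tupRead_tupConj hQ x⟩

end Conj

end Centralizer

theorem mainTheorem2 {k : Type*} [Field k] [IsAlgClosed k] [CharP k 2] (n i : ℕ) (hi : 2 * i ≤ n)
    (e : Matrix (Fin n) (Fin n) k)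
    (he : HasPartitionType e (Multiset.replicate i 2 + Multiset.replicate (n - 2 * i) 1)) :
    (Even n →
      (irreducibleComponents (centralizerSquareZero e)).ncard = i / 2 + 1 ∧
      ∃ d : ℕ, 4 * d = n ^ 2 + (n - 2 * i) ^ 2 ∧
        2 * d = Module.finrank k (Subalgebra.centralizer k {e}) ∧
        ∀ Z ∈ irreducibleComponents (centralizerSquareZero e), topologicalKrullDim Z = d) ∧
    (Odd n →
      (irreducibleComponents (centralizerSquareZero e)).ncard = i + 1 ∧
      ∃ d : ℕ, 4 * d + 2 = n ^ 2 + (n - 2 * i) ^ 2 ∧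
        2 * d + 1 = Module.finrank k (Subalgebra.centralizer k {e}) ∧
        ∀ Z ∈ irreducibleComponents (centralizerSquareZero e), topologicalKrullDim Z = d) := by
  obtain ⟨U, W, _, _, _, _, Q, Q', hU, hW, hQ, rfl⟩ := exists_conj_blockNilpotent he
  obtain ⟨f, hf, hinj, hrange⟩ := exists_embedding_centralizerSquareZero hQ
  rw [finrank_centralizer hQ, hU, hW]
  obtain ⟨m, rfl⟩ := Nat.exists_eq_add_of_le hi
  rw [Nat.add_sub_cancel_left] at hW ⊢
  refine ⟨fun hn => ?_, fun hn => ?_⟩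
  · obtain ⟨s, rfl⟩ : ∃ s, m = 2 * s :=
      (even_iff_two_dvd.1 ((Nat.even_add.1 hn).1 (even_two_mul i)))
    obtain ⟨Z, hc, hirr, hsub, hcov, hd, hZ⟩ := exists_components_even (k := k) hU hW
    obtain ⟨h1, h2⟩ := ncard_irreducibleComponents hf hinj hc hirr
      (fun j => (hsub j).trans hrange.ge) (fun y => hcov _ (hrange.le ⟨y, rfl⟩)) hd hZ
    refine ⟨by rw [h1, Nat.card_eq_fintype_card, Fintype.card_fin],
      i ^ 2 + 2 * s ^ 2 + 2 * s * i, by ring, by ring, h2⟩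
  · obtain ⟨s, rfl⟩ : ∃ s, m = 2 * s + 1 := by
      obtain ⟨t, ht⟩ := hn
      exact ⟨t - i, by omega⟩
    obtain ⟨Z, hc, hirr, hsub, hcov, hd, hZ⟩ := exists_components_odd (k := k) hU hW
    obtain ⟨h1, h2⟩ := ncard_irreducibleComponents hf hinj hc hirr
      (fun j => (hsub j).trans hrange.ge) (fun y => hcov _ (hrange.le ⟨y, rfl⟩)) hd hZ
    refine ⟨?_, i ^ 2 + 2 * s ^ 2 + 2 * s + i + 2 * s * i, by ring, by ring, h2⟩
    rw [h1, Nat.card_eq_fintype_card, Fintype.card_sum, Fintype.card_fin, Fintype.card_fin]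
    omega
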